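/- Let $d\in\mathbb N_0$, $q\in[1,\infty]$, and let $\phi\in\mathcal S(\mathbb R^d)$ satisfy $\int\phi=1$ and $\int x^\alpha\phi(x)\,dx=0$ for all $\alpha\in\mathbb N_0^d\setminus\{0\}$; put $\phi_\varepsilon=\varepsilon^{-d}\phi(\cdot/\varepsilon)$. **Definitions.** For $\Omega\subseteq\mathbb R^d$ open, a net on $\Omega$ is a family $(f_\varepsilon)_{\varepsilon\in(0,1)}$ in $C^\infty(\Omega)$ such that $\varepsilon\mapsto f_\varepsilon\in C^\infty(\Omega)$ is continuous. Let $\|f\|_{W^{k,p}(\omega)}=\max_{|\alpha|\le k}\|\partial^\alpha f\|_{L^p(\omega)}$, where $p\in[1,\infty]$. The net belongs to $\mathcal E_q(\Omega)$ (respectively $\mathcal N_q(\Omega)$) if for every $k\in\mathbb N_0$ and every open $\omega$ with compact closure in $\Omega$ there is $s\in\mathbb R$ such that (respectively, for all $s\in\mathbb R$) $$\int_0^1\varepsilon^{qs}\|f_\varepsilon\|^q_{W^{k,p}(\omega)}\frac{d\varepsilon}{\varepsilon}<\infty$$ (if $q=\infty$: $\sup_{0<\varepsilon<1}\varepsilon^{s}\|f_\varepsilon\|_{W^{k,p}(\omega)}<\infty$).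 Put $\mathcal G_q(\Omega)=\mathcal E_q(\Omega)/\mathcal N_q(\Omega)$, with restrictions and partial derivatives defined on representatives. Let $\widetilde{\mathbb C}_\infty$ be the ring of continuous nets $(c_\varepsilon)_{\varepsilon\in(0,1)}$ in $\mathbb C$ with $\sup_\varepsilon\varepsilon^s|c_\varepsilon|<\infty$ for some $s$, modulo those for which this holds for all $s$. A sheaf $F$ of modules on a space $X$ is fine if for every locally finite open cover $(W_i)$ of $X$ there are sheaf endomorphisms $h_i$ of $F$, vanishing off closed sets $A_i\subseteq W_i$, with $\sum_i h_i=\mathrm{id}$. The support of a section of $\mathcal G_q$ over $\Omega$ is the set of points of $\Omega$ having no open neighbourhood in $\Omega$ on which the section restricts to $0$. **Proposition.** 1. The spaces $\mathcal E_q(\Omega)$ and $\mathcal N_q(\Omega)$ do not depend on $p\in[1,\infty]$, and $\mathcal G_q$ is a fine sheaf of $\widetilde{\mathbb C}_\infty$-modules on $\mathbb R^d$. 2. Under multiplication induced by pointwise multiplication of representatives, $\mathcal G_\infty$ is a sheaf of commutative differential $\widetilde{\mathbb C}_\infty$-algebras, and $\mathcal G_q$ is a sheaf of differential modules over $\mathcal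 G_\infty$: the module structure over $\mathcal G_\infty$ is compatible with $\widetilde{\mathbb C}_\infty$ and with restrictions, and the partial derivatives are $\widetilde{\mathbb C}_\infty$-linear, commute with each other and with restrictions, and satisfy $\partial_i(a b)=(\partial_i a)b+a\,\partial_i b$ for $a\in\mathcal G_\infty(\Omega)$ and $b\in\mathcal G_q(\Omega)$ (in particular for $b\in\mathcal G_\infty(\Omega)$). The map $f\mapsto[(f)_\varepsilon]$ given by constant nets embeds $C^\infty$ into $\mathcal G_\infty$ as a sheaf of differential subrings, so that $\mathcal G_q$ is in particular a sheaf of differential modules over $C^\infty$. 3. There is a family $\iota$ of injective $\mathbb C$-linear maps $\mathcal D'(\Omega)\to\mathcal G_q(\Omega)$, $\Omega\subseteq\mathbb R^d$ open, that commutes with restrictions (a linear sheaf embedding $\mathcal D'\to\mathcal G_q$), such that $\iota(T)=[((T*\phi_\varepsilon)|_\Omega)_\varepsilon]$ whenever $T\in\mathcal D'(\Omega)$ has compact support in $\Omega$, and such that $\operatorname{supp}\iota(T)=\operatorname{supp}T$ for all $T\in\mathcal D'(\Omega)$. For $f,g\in C^\infty(\Omega)$, regarded as distributions where they are arguments of $\iota$,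 one has $\iota(f)=[(f)_\varepsilon]$, and $\iota(fg)=[(f)_\varepsilon]\cdot\iota(g)$, where the class $[(f)_\varepsilon]$ on the right is taken in $\mathcal G_\infty(\Omega)$; that is, $\iota$ respects products of smooth functions. -/

import Mathlib

open Set MeasureTheory TopologicalSpace Topology
open scoped ENNReal ContDiff Distributions SchwartzMap

noncomputable section

namespace GenFun

/-- The Euclidean space of dimension `d`. -/
abbrev Rn (d : ℕ) : Type := EuclideanSpace ℝ (Fin d)

/-- The parameter interval `(0,1)` of the nets. -/
abbrev Par : Type := Ioo (0 : ℝ) 1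

variable {d : ℕ}

/-- Extension by zero of a function on `U`. -/
def ext (U : Opens (Rn d)) (f : U → ℂ) : Rn d → ℂ :=
  Function.extend Subtype.val f 0

/-- `f` is infinitely differentiable on the open set `U`. -/
def IsSmooth (U : Opens (Rn d)) (f : U → ℂ) : Prop :=
  ContDiffOn ℝ ∞ (ext U f) U

/-- The partial derivative of `f` in the `i`-th coordinate direction. -/
def pderiv (U : Opens (Rn d)) (i : Fin d) (f : U → ℂ) : U → ℂ :=
  fun x => fderiv ℝ (ext U f) x (EuclideanSpace.single i 1)

/-- Iterated partial derivatives: the list `[i₁, …, iₖ]` stands for `∂_{iₖ} ⋯ ∂_{i₁}`. -/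
def iterPderiv (U : Opens (Rn d)) : List (Fin d) → (U → ℂ) → (U → ℂ)
  | [], f => f
  | i :: l, f => iterPderiv U l (pderiv U i f)

/-- The Sobolev norm on `W ⊆ U`: the maximum of the `L^p(W)` norms of all partial derivatives of
order at most `k`. -/
def sobolevNorm (U : Opens (Rn d)) (k : ℕ) (p : ℝ≥0∞) (W : Opens U) (f : U → ℂ) : ℝ≥0∞ :=
  ⨆ (l : List (Fin d)) (_ : l.length ≤ k),
    eLpNorm (iterPderiv U l f) p ((Measure.comap Subtype.val volume : Measure U).restrict W)

/-- The measure `dε/ε` on `(0,1)`. -/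
def parMeasure : Measure Par :=
  (Measure.comap Subtype.val volume : Measure Par).withDensity fun ε => ENNReal.ofReal (ε : ℝ)⁻¹

/-- The weighted `L^q` norm `(∫₀¹ ε^{qs} g(ε)^q dε/ε)^{1/q}` (an essential supremum
if `q = ∞`). -/
def parNorm (q : ℝ≥0∞) (s : ℝ) (g : Par → ℝ≥0∞) : ℝ≥0∞ :=
  eLpNorm (fun ε : Par => ENNReal.ofReal ((ε : ℝ) ^ s) * g ε) q parMeasure

/-- The `L^q`-moderate growth estimates, written with Sobolev norms of exponent `p`. -/
def ModerateEst (p q : ℝ≥0∞) (U : Opens (Rn d)) (f : Par → U → ℂ) : Prop :=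
  ∀ (k : ℕ) (W : Opens U), IsCompact (closure (W : Set U)) →
    ∃ s : ℝ, parNorm q s (fun ε => sobolevNorm U k p W (f ε)) < ⊤

/-- The `L^q`-negligibility estimates, written with Sobolev norms of exponent `p`. -/
def NegligibleEst (p q : ℝ≥0∞) (U : Opens (Rn d)) (f : Par → U → ℂ) : Prop :=
  ∀ (k : ℕ) (W : Opens U), IsCompact (closure (W : Set U)) →
    ∀ s : ℝ, parNorm q s (fun ε => sobolevNorm U k p W (f ε)) < ⊤

/-- Nets of smooth functions depending continuously on the parameter: `ε ↦ f_ε` is continuous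
from `(0,1)` to `C^∞(U)`, that is, all `x`-derivatives are jointly continuous. -/
def IsNet (U : Opens (Rn d)) (f : Par → U → ℂ) : Prop :=
  (∀ ε, IsSmooth U (f ε)) ∧
    ∀ l : List (Fin d), Continuous fun z : Par × U => iterPderiv U l (f z.1) z.2

/-! ### Elementary facts on smooth functions and partial derivatives -/

section Calculus

variable {U V : Opens (Rn d)}

theorem ext_apply (f : U → ℂ) (x : U) : ext U f x = f x :=
  Subtype.val_injective.extend_apply f 0 x

theorem ext_add (f g : U → ℂ) : ext U (f + g) = ext U f + ext U g := by
  ext x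
  by_cases h : x ∈ U
  · lift x to U using h
    simp [ext_apply]
  · have h' : ¬ ∃ a : U, (a : Rn d) = x := by rintro ⟨a, rfl⟩; exact h a.2
    simp [ext, Function.extend_apply' _ _ _ h']

theorem ext_mul (f g : U → ℂ) : ext U (f * g) = ext U f * ext U g := by
  ext x
  by_cases h : x ∈ U
  · lift x to U using h
    simp [ext_apply]
  · have h' : ¬ ∃ a : U, (a : Rn d) = x := by rintro ⟨a, rfl⟩; exact h a.2
    simp [ext, Function.extend_apply' _ _ _ h']

theorem isSmooth_iff_of_eqOn {f : U → ℂ} {g : Rn d → ℂ} (h : ∀ x : U, f x = g x) :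
    IsSmooth U f ↔ ContDiffOn ℝ ∞ g U :=
  contDiffOn_congr fun x hx => by rw [← h ⟨x, hx⟩]; exact ext_apply f ⟨x, hx⟩

theorem isSmooth_const (c : ℂ) : IsSmooth U (fun _ => c) :=
  (isSmooth_iff_of_eqOn (g := fun _ => c) fun _ => rfl).2 contDiffOn_const

theorem IsSmooth.add {f g : U → ℂ} (hf : IsSmooth U f) (hg : IsSmooth U g) :
    IsSmooth U (f + g) := by
  unfold IsSmooth
  rw [ext_add]
  exact ContDiffOn.add hf hg

theorem IsSmooth.mul {f g : U → ℂ} (hf : IsSmooth U f) (hg : IsSmooth U g) :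
    IsSmooth U (f * g) := by
  unfold IsSmooth
  rw [ext_mul]
  exact ContDiffOn.mul hf hg

theorem IsSmooth.differentiableAt {f : U → ℂ} (hf : IsSmooth U f) (x : U) :
    DifferentiableAt ℝ (ext U f) x :=
  (hf.contDiffAt (U.isOpen.mem_nhds x.2)).differentiableAt (by simp)

theorem IsSmooth.pderiv {f : U → ℂ} (hf : IsSmooth U f) (i : Fin d) :
    IsSmooth U (pderiv U i f) :=
  (isSmooth_iff_of_eqOn (g := fun x => fderiv ℝ (ext U f) x (EuclideanSpace.single i 1))
    fun _ => rfl).2 ((hf.fderiv_of_isOpen U.isOpen (by simp)).clm_apply contDiffOn_const)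

theorem pderiv_congr {f : U → ℂ} {g : Rn d → ℂ} (h : ∀ x : U, f x = g x) (i : Fin d) (x : U) :
    pderiv U i f x = fderiv ℝ g x (EuclideanSpace.single i 1) := by
  have : ext U f =ᶠ[𝓝 (x : Rn d)] g := by
    filter_upwards [U.isOpen.mem_nhds x.2] with y hy
    rw [← h ⟨y, hy⟩]
    exact ext_apply f ⟨y, hy⟩
  simp only [pderiv, this.fderiv_eq]

theorem pderiv_const (i : Fin d) (c : ℂ) : pderiv U i (fun _ => c) = 0 := by
  ext x
  rw [pderiv_congr (g := fun _ => c) fun _ => rfl]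
  simp

theorem pderiv_add {f g : U → ℂ} (hf : IsSmooth U f) (hg : IsSmooth U g) (i : Fin d) :
    pderiv U i (f + g) = pderiv U i f + pderiv U i g := by
  ext x
  simp only [pderiv, ext_add]
  rw [fderiv_add (hf.differentiableAt x) (hg.differentiableAt x)]
  rfl

theorem pderiv_mul {f g : U → ℂ} (hf : IsSmooth U f) (hg : IsSmooth U g) (i : Fin d) :
    pderiv U i (f * g) = pderiv U i f * g + f * pderiv U i g := by
  ext x
  simp only [pderiv, ext_mul]
  rw [fderiv_mul (hf.differentiableAt x) (hg.differentiableAt x)]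
  simp [ext_apply, pderiv]
  ring

theorem pderiv_smul (c : ℂ) {f : U → ℂ} (hf : IsSmooth U f) (i : Fin d) :
    pderiv U i (c • f) = c • pderiv U i f := by
  have h : c • f = (fun _ => c) * f := rfl
  rw [h, pderiv_mul (isSmooth_const c) hf, pderiv_const]
  ext x
  simp

theorem iterPderiv_add (l : List (Fin d)) {f g : U → ℂ} (hf : IsSmooth U f) (hg : IsSmooth U g) :
    iterPderiv U l (f + g) = iterPderiv U l f + iterPderiv U l g := by
  induction l generalizing f g with
  | nil => rfl
  | cons i l ih => simp only [iterPderiv, pderiv_add hf hg, ih (hf.pderiv i) (hg.pderiv i)]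

theorem iterPderiv_smul (l : List (Fin d)) (c : ℂ) {f : U → ℂ} (hf : IsSmooth U f) :
    iterPderiv U l (c • f) = c • iterPderiv U l f := by
  induction l generalizing f with
  | nil => rfl
  | cons i l ih => simp only [iterPderiv, pderiv_smul c hf, ih (hf.pderiv i)]

theorem iterPderiv_zero (l : List (Fin d)) : iterPderiv U l (0 : U → ℂ) = 0 := by
  induction l with
  | nil => rfl
  | cons i l ih =>
    have : pderiv U i (0 : U → ℂ) = 0 := pderiv_const i 0
    simp only [iterPderiv, this, ih]

theorem IsSmooth.iterPderiv {f : U → ℂ} (hf : IsSmooth U f) (l : List (Fin d)) :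
    IsSmooth U (iterPderiv U l f) := by
  induction l generalizing f with
  | nil => exact hf
  | cons i l ih => exact ih (hf.pderiv i)

theorem IsSmooth.continuous {f : U → ℂ} (hf : IsSmooth U f) : Continuous f := by
  have h := continuousOn_iff_continuous_domRestrict.1 hf.continuousOn
  exact h.congr fun x => ext_apply f x

/-- Restriction of functions to a smaller open set. -/
def res (h : V ≤ U) (f : U → ℂ) : V → ℂ := fun x => f (Opens.inclusion h x)

theorem IsSmooth.res (h : V ≤ U) {f : U → ℂ} (hf : IsSmooth U f) : IsSmooth V (res h f) :=
  (isSmooth_iff_of_eqOn (g := ext U f) fun x =>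
    (ext_apply f (Opens.inclusion h x)).symm).2 (ContDiffOn.mono hf h)

theorem pderiv_res (h : V ≤ U) (i : Fin d) (f : U → ℂ) :
    pderiv V i (res h f) = res h (pderiv U i f) := by
  ext x
  exact pderiv_congr (g := ext U f) (fun y => (ext_apply f (Opens.inclusion h y)).symm) i x

theorem iterPderiv_res (h : V ≤ U) (l : List (Fin d)) (f : U → ℂ) :
    iterPderiv V l (res h f) = res h (iterPderiv U l f) := by
  induction l generalizing f with
  | nil => rfl
  | cons i l ih => simp only [iterPderiv, pderiv_res, ih]

end Calculus

/-- The algebra `C^∞(U)`. -/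
def Smooth (U : Opens (Rn d)) : Subalgebra ℂ (U → ℂ) where
  carrier := {f | IsSmooth U f}
  mul_mem' := IsSmooth.mul
  add_mem' := IsSmooth.add
  algebraMap_mem' c := isSmooth_const c

/-- Restriction of smooth functions. -/
def Smooth.res {U V : Opens (Rn d)} (h : V ≤ U) (f : Smooth U) : Smooth V :=
  ⟨GenFun.res h f.1, IsSmooth.res h f.2⟩

/-- Partial derivatives of smooth functions. -/
def Smooth.pderiv {U : Opens (Rn d)} (i : Fin d) (f : Smooth U) : Smooth U :=
  ⟨GenFun.pderiv U i f.1, IsSmooth.pderiv f.2 i⟩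

section Nets

variable {U V : Opens (Rn d)}

theorem IsNet.pderiv {f : Par → U → ℂ} (hf : IsNet U f) (i : Fin d) :
    IsNet U (fun ε => pderiv U i (f ε)) :=
  ⟨fun ε => (hf.1 ε).pderiv i, fun l => hf.2 (i :: l)⟩

theorem IsNet.add {f g : Par → U → ℂ} (hf : IsNet U f) (hg : IsNet U g) : IsNet U (f + g) := by
  refine ⟨fun ε => (hf.1 ε).add (hg.1 ε), fun l => ?_⟩
  have : (fun z : Par × U => iterPderiv U l ((f + g) z.1) z.2) =
      fun z => iterPderiv U l (f z.1) z.2 + iterPderiv U l (g z.1) z.2 := by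
    ext z
    rw [Pi.add_apply, iterPderiv_add l (hf.1 _) (hg.1 _)]
    rfl
  rw [this]
  exact (hf.2 l).add (hg.2 l)

theorem IsNet.mul {f g : Par → U → ℂ} (hf : IsNet U f) (hg : IsNet U g) : IsNet U (f * g) := by
  refine ⟨fun ε => (hf.1 ε).mul (hg.1 ε), fun l => ?_⟩
  induction l generalizing f g with
  | nil => exact (hf.2 []).mul (hg.2 [])
  | cons i l ih =>
    have h := (ih (hf.pderiv i) hg).add (ih hf (hg.pderiv i))
    convert h using 2 with z
    simp only [iterPderiv, Pi.mul_apply]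
    rw [pderiv_mul (hf.1 _) (hg.1 _),
      iterPderiv_add l (((hf.1 _).pderiv i).mul (hg.1 _)) ((hf.1 _).mul ((hg.1 _).pderiv i))]
    rfl

theorem isNet_param {c : Par → ℂ} (hc : Continuous c) : IsNet U (fun ε _ => c ε) := by
  refine ⟨fun ε => isSmooth_const _, fun l => ?_⟩
  cases l with
  | nil => exact hc.comp continuous_fst
  | cons i l =>
    simp only [iterPderiv, pderiv_const, iterPderiv_zero]
    exact continuous_const

theorem isNet_const {f : U → ℂ} (hf : IsSmooth U f) : IsNet U (fun _ => f) :=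
  ⟨fun _ => hf, fun l => (hf.iterPderiv l).continuous.comp continuous_snd⟩

theorem IsNet.res (h : V ≤ U) {f : Par → U → ℂ} (hf : IsNet U f) :
    IsNet V (fun ε => res h (f ε)) := by
  refine ⟨fun ε => (hf.1 ε).res h, fun l => ?_⟩
  simp only [iterPderiv_res]
  exact (hf.2 l).comp (continuous_fst.prodMk ((continuous_inclusion h).comp continuous_snd))

end Nets

/-- The subalgebra of nets of smooth functions on `U` with continuous dependence on the
parameter. -/
def netSubalgebra (U : Opens (Rn d)) : Subalgebra ℂ (Par → U → ℂ) where
  carrier := {f | IsNet U f}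
  mul_mem' := IsNet.mul
  add_mem' := IsNet.add
  algebraMap_mem' _ := isNet_param continuous_const

/-- The algebra of nets of smooth functions on `U` with continuous dependence on the parameter,
with pointwise operations. -/
def Net (U : Opens (Rn d)) : Type := netSubalgebra U

instance (U : Opens (Rn d)) : CommRing (Net U) := inferInstanceAs (CommRing (netSubalgebra U))

instance (U : Opens (Rn d)) : Algebra ℂ (Net U) := inferInstanceAs (Algebra ℂ (netSubalgebra U))

/-- The underlying function `(ε, x) ↦ f_ε(x)` of a net. -/
def Net.toFun {U : Opens (Rn d)} (f : Net U) : Par → U → ℂ := Subtype.val f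

theorem Net.isNet {U : Opens (Rn d)} (f : Net U) : IsNet U f.toFun := Subtype.prop f

/-- Constructor for nets. -/
def Net.of {U : Opens (Rn d)} (f : Par → U → ℂ) (hf : IsNet U f) : Net U := ⟨f, hf⟩

theorem Net.ext {U : Opens (Rn d)} {f g : Net U} (h : ∀ ε, f.toFun ε = g.toFun ε) : f = g :=
  Subtype.ext (funext h)


section Norms

variable {U V : Opens (Rn d)}

theorem eLpNorm_top_eq {g : U → ℂ} (hg : Continuous g) (W : Opens U) :
    eLpNorm g ⊤ ((Measure.comap Subtype.val volume : Measure U).restrict W) =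
      ⨆ x : W, ‖g x‖ₑ := by
  rw [eLpNorm_exponent_top, eLpNormEssSup_eq_essSup_enorm]
  apply le_antisymm
  · refine essSup_le_of_ae_le _ ?_
    filter_upwards [ae_restrict_mem W.isOpen.measurableSet] with x hx
    exact le_iSup (fun x : W => ‖g x‖ₑ) ⟨x, hx⟩
  · refine iSup_le fun x => le_of_forall_lt fun c hc => ?_
    by_contra hcon
    have hae : ∀ᵐ y ∂((Measure.comap Subtype.val volume : Measure U).restrict W), ‖g y‖ₑ ≤ c :=
      (ENNReal.ae_le_essSup _).mono fun y hy => hy.trans (not_lt.1 hcon)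
    rw [ae_restrict_iff' W.isOpen.measurableSet] at hae
    have hO : IsOpen ((W : Set U) ∩ {y | c < ‖g y‖ₑ}) :=
      W.isOpen.inter (isOpen_lt continuous_const hg.enorm)
    have h0 : (Measure.comap Subtype.val volume : Measure U) ((W : Set U) ∩ {y | c < ‖g y‖ₑ}) = 0 := by
      refine measure_mono_null (fun y hy => ?_) hae
      simpa using ⟨hy.1, hy.2⟩
    have hemb : MeasurableEmbedding (Subtype.val : U → Rn d) :=
      MeasurableEmbedding.subtype_coe U.isOpen.measurableSet
    rw [hemb.comap_apply] at h0
    have hO' := U.isOpen.isOpenEmbedding_subtypeVal.isOpenMap _ hO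
    exact (hO'.measure_ne_zero volume ⟨_, mem_image_of_mem _ ⟨x.2, hc⟩⟩) h0

theorem parNorm_mono (q : ℝ≥0∞) {s t : ℝ} (hst : s ≤ t) {g h : Par → ℝ≥0∞} (hgh : ∀ ε, g ε ≤ h ε) :
    parNorm q t g ≤ parNorm q s h := by
  refine eLpNorm_mono_enorm fun ε => ?_
  simp only [enorm_eq_self]
  gcongr ENNReal.ofReal ?_ * ?_
  · exact Real.rpow_le_rpow_of_exponent_ge ε.2.1 ε.2.2.le hst
  · exact hgh ε

theorem measurable_weight (s : ℝ) : Measurable fun ε : Par => ENNReal.ofReal ((ε : ℝ) ^ s) := by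
  fun_prop

theorem parNorm_add_lt_top {q : ℝ≥0∞} {s : ℝ} {g h : Par → ℝ≥0∞} (hg : Measurable g)
    (hh : Measurable h) (hg' : parNorm q s g < ⊤) (hh' : parNorm q s h < ⊤) :
    parNorm q s (fun ε => g ε + h ε) < ⊤ := by
  have := eLpNorm_add_lt_top
    (f := fun ε : Par => ENNReal.ofReal ((ε : ℝ) ^ s) * g ε)
    (g := fun ε : Par => ENNReal.ofReal ((ε : ℝ) ^ s) * h ε) (p := q) (μ := parMeasure)
    ⟨((measurable_weight s).mul hg).aestronglyMeasurable, hg'⟩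
    ⟨((measurable_weight s).mul hh).aestronglyMeasurable, hh'⟩
  refine lt_of_le_of_lt (le_of_eq ?_) this
  unfold parNorm
  congr 1
  ext ε
  simp [mul_add]

theorem parNorm_mul_lt_top {q : ℝ≥0∞} {s t : ℝ} {g h : Par → ℝ≥0∞} (C : NNReal)
    (hg : parNorm ⊤ s g < ⊤) (hh : parNorm q t h < ⊤) :
    parNorm q (s + t) (fun ε => C * (g ε * h ε)) < ⊤ := by
  have hb : ∀ᵐ ε : Par ∂parMeasure, ENNReal.ofReal ((ε : ℝ) ^ s) * g ε ≤ parNorm ⊤ s g := by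
    have := enorm_ae_le_eLpNormEssSup (fun ε : Par => ENNReal.ofReal ((ε : ℝ) ^ s) * g ε) parMeasure
    simpa [parNorm] using this
  lift parNorm ⊤ s g to NNReal using hg.ne with B
  refine lt_of_le_of_lt (eLpNorm_le_mul_eLpNorm_of_ae_le_mul' (c := C * B)
    (g := fun ε : Par => ENNReal.ofReal ((ε : ℝ) ^ t) * h ε) ?_ q)
    (ENNReal.mul_lt_top ENNReal.coe_lt_top hh)
  filter_upwards [hb] with ε hε
  simp only [enorm_eq_self]
  rw [Real.rpow_add ε.2.1, ENNReal.ofReal_mul (Real.rpow_nonneg ε.2.1.le _)]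
  calc _ = C * (ENNReal.ofReal ((ε : ℝ) ^ s) * g ε) * (ENNReal.ofReal ((ε : ℝ) ^ t) * h ε) := by ring
    _ ≤ _ := by push_cast; gcongr

theorem parNorm_const_lt_top (C : ℝ≥0∞) (hC : C ≠ ⊤) : parNorm ⊤ 0 (fun _ => C) < ⊤ := by
  unfold parNorm
  simp only [Real.rpow_zero, ENNReal.ofReal_one, one_mul]
  refine lt_of_le_of_lt ?_ hC.lt_top
  rw [eLpNorm_exponent_top, eLpNormEssSup_eq_essSup_enorm]
  exact essSup_le_of_ae_le _ (Filter.Eventually.of_forall fun _ => le_rfl)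

theorem measurable_sobolevNorm {f : Par → U → ℂ} (hf : IsNet U f) (k : ℕ) (W : Opens U) :
    Measurable fun ε => sobolevNorm U k ⊤ W (f ε) := by
  unfold sobolevNorm
  refine Measurable.iSup fun l => Measurable.iSup fun _ => ?_
  have : (fun ε => eLpNorm (iterPderiv U l (f ε)) ⊤
      ((Measure.comap Subtype.val volume : Measure U).restrict W)) =
      fun ε => ⨆ x : W, ‖iterPderiv U l (f ε) x‖ₑ := by
    ext ε
    exact eLpNorm_top_eq ((hf.1 ε).iterPderiv l).continuous W
  rw [this]
  refine LowerSemicontinuous.measurable (lowerSemicontinuous_iSup fun x => ?_)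
  refine Continuous.lowerSemicontinuous ?_
  exact ((hf.2 l).comp (continuous_id.prodMk continuous_const)).enorm

theorem le_sobolevNorm {f : U → ℂ} {k : ℕ} {p : ℝ≥0∞} {W : Opens U} {l : List (Fin d)}
    (hl : l.length ≤ k) :
    eLpNorm (iterPderiv U l f) p ((Measure.comap Subtype.val volume : Measure U).restrict W) ≤
      sobolevNorm U k p W f :=
  le_iSup₂_of_le l hl le_rfl

theorem sobolevNorm_mono {f : U → ℂ} {k m : ℕ} (h : k ≤ m) {p : ℝ≥0∞} {W : Opens U} :
    sobolevNorm U k p W f ≤ sobolevNorm U m p W f :=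
  iSup₂_le fun _ hl => le_sobolevNorm (hl.trans h)

theorem sobolevNorm_pderiv_le (f : U → ℂ) (i : Fin d) (k : ℕ) (p : ℝ≥0∞) (W : Opens U) :
    sobolevNorm U k p W (pderiv U i f) ≤ sobolevNorm U (k + 1) p W f :=
  iSup₂_le fun l hl => le_sobolevNorm (l := i :: l) (by simpa using hl)

theorem sobolevNorm_add_le {f g : U → ℂ} (hf : IsSmooth U f) (hg : IsSmooth U g) (k : ℕ)
    (W : Opens U) :
    sobolevNorm U k ⊤ W (f + g) ≤ sobolevNorm U k ⊤ W f + sobolevNorm U k ⊤ W g := by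
  refine iSup₂_le fun l hl => ?_
  rw [iterPderiv_add l hf hg]
  refine (eLpNorm_add_le (hf.iterPderiv l).continuous.aestronglyMeasurable
    (hg.iterPderiv l).continuous.aestronglyMeasurable le_top).trans ?_
  gcongr <;> exact le_sobolevNorm hl

theorem sobolevNorm_smul_le (c : ℂ) {f : U → ℂ} (hf : IsSmooth U f) (k : ℕ) (p : ℝ≥0∞)
    (W : Opens U) : sobolevNorm U k p W (c • f) ≤ ‖c‖ₑ * sobolevNorm U k p W f := by
  refine iSup₂_le fun l hl => ?_
  rw [iterPderiv_smul l c hf, eLpNorm_const_smul]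
  gcongr
  exact le_sobolevNorm hl

theorem sobolevNorm_mul_le {f g : U → ℂ} (hf : IsSmooth U f) (hg : IsSmooth U g) (k : ℕ)
    (W : Opens U) :
    sobolevNorm U k ⊤ W (f * g) ≤
      ((2 ^ k : NNReal) : ℝ≥0∞) * (sobolevNorm U k ⊤ W f * sobolevNorm U k ⊤ W g) := by
  have key : ∀ (l : List (Fin d)) (f g : U → ℂ), IsSmooth U f → IsSmooth U g →
      eLpNorm (iterPderiv U l (f * g)) ⊤
        ((Measure.comap Subtype.val volume : Measure U).restrict W) ≤
      2 ^ l.length * (sobolevNorm U l.length ⊤ W f * sobolevNorm U l.length ⊤ W g) := by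
    intro l
    induction l with
    | nil =>
      intro f g hf hg
      have h1 := eLpNorm_smul_le_mul_eLpNorm (p := ⊤) (q := ⊤) (r := ⊤)
        (μ := (Measure.comap Subtype.val volume : Measure U).restrict W)
        hg.continuous.aestronglyMeasurable hf.continuous.aestronglyMeasurable
      simp only [List.length_nil, pow_zero, one_mul]
      refine h1.trans ?_
      gcongr
      · exact le_sobolevNorm (l := []) le_rfl
      · exact le_sobolevNorm (l := []) le_rfl
    | cons i l ih =>
      intro f g hf hg
      simp only [iterPderiv]
      rw [pderiv_mul hf hg, iterPderiv_add l ((hf.pderiv i).mul hg) (hf.mul (hg.pderiv i))]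
      refine (eLpNorm_add_le
        (((hf.pderiv i).mul hg).iterPderiv l).continuous.aestronglyMeasurable
        ((hf.mul (hg.pderiv i)).iterPderiv l).continuous.aestronglyMeasurable le_top).trans ?_
      refine (add_le_add (ih _ _ (hf.pderiv i) hg) (ih _ _ hf (hg.pderiv i))).trans ?_
      rw [List.length_cons, pow_succ, mul_assoc, two_mul, ← mul_add]
      gcongr
      · exact sobolevNorm_pderiv_le f i _ _ _
      · exact sobolevNorm_mono (Nat.le_succ _)
      · exact sobolevNorm_mono (Nat.le_succ _)
      · exact sobolevNorm_pderiv_le g i _ _ _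
  refine iSup₂_le fun l hl => (key l f g hf hg).trans ?_
  push_cast
  gcongr
  · norm_num
  · exact sobolevNorm_mono hl
  · exact sobolevNorm_mono hl

/-- An open subset of `V` as an open subset of the larger open set `U`. -/
def pushOpen (h : V ≤ U) (W : Opens V) : Opens U :=
  ⟨Opens.inclusion h '' W, (Opens.isOpenEmbedding_of_le h).isOpenMap _ W.isOpen⟩

theorem isCompact_pushOpen (h : V ≤ U) {W : Opens V} (hW : IsCompact (closure (W : Set V))) :
    IsCompact (closure (pushOpen h W : Set U)) := by
  have hc := hW.image (continuous_inclusion h)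
  exact hc.of_isClosed_subset isClosed_closure
    (closure_minimal (Set.image_mono (f := Opens.inclusion h) subset_closure) hc.isClosed)

theorem sobolevNorm_res_le (h : V ≤ U) {f : U → ℂ} (hf : IsSmooth U f) (k : ℕ) (W : Opens V) :
    sobolevNorm V k ⊤ W (res h f) ≤ sobolevNorm U k ⊤ (pushOpen h W) f := by
  refine iSup₂_le fun l hl => ?_
  rw [eLpNorm_top_eq ((hf.res h).iterPderiv l).continuous, iterPderiv_res]
  refine le_trans ?_ (le_sobolevNorm hl)
  rw [eLpNorm_top_eq (hf.iterPderiv l).continuous]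
  exact iSup_le fun x => le_iSup (fun y : pushOpen h W => ‖iterPderiv U l f y‖ₑ)
    ⟨Opens.inclusion h x, mem_image_of_mem (Opens.inclusion h) x.2⟩

theorem sobolevNorm_const_le (c : ℂ) (k : ℕ) (W : Opens U) :
    sobolevNorm U k ⊤ W (fun _ => c) ≤ ‖c‖ₑ := by
  refine iSup₂_le fun l _ => ?_
  cases l with
  | nil =>
    rw [iterPderiv, eLpNorm_top_eq continuous_const]
    exact iSup_le fun _ => le_rfl
  | cons i l => simp [iterPderiv, pderiv_const, iterPderiv_zero]

theorem sobolevNorm_ne_top {f : U → ℂ} (hf : IsSmooth U f) (k : ℕ) {W : Opens U}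
    (hW : IsCompact (closure (W : Set U))) : sobolevNorm U k ⊤ W f ≠ ⊤ := by
  have hfin : {l : List (Fin d) | l.length ≤ k}.Finite := List.finite_length_le (Fin d) k
  refine ne_top_of_le_ne_top (b := ∑ l ∈ hfin.toFinset, eLpNorm (iterPderiv U l f) ⊤
    ((Measure.comap Subtype.val volume : Measure U).restrict W)) ?_ ?_
  · refine ENNReal.sum_ne_top.2 fun l _ => ?_
    have hc := (hf.iterPderiv l).continuous
    obtain ⟨C, hC⟩ := hW.exists_bound_of_continuousOn hc.continuousOn
    rw [eLpNorm_top_eq hc]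
    refine ne_top_of_le_ne_top (b := ENNReal.ofReal C) ENNReal.ofReal_ne_top
      (iSup_le fun x => ?_)
    rw [← ofReal_norm]
    exact ENNReal.ofReal_le_ofReal (hC _ (subset_closure x.2))
  · refine iSup₂_le fun l hl => ?_
    exact Finset.single_le_sum (f := fun l => eLpNorm (iterPderiv U l f) ⊤
      ((Measure.comap Subtype.val volume : Measure U).restrict W)) (fun _ _ => zero_le)
      (hfin.mem_toFinset.2 hl)

end Norms

section Estimates

variable {U V : Opens (Rn d)} {q : ℝ≥0∞}

theorem ModerateEst.add {f g : Par → U → ℂ} (hfn : IsNet U f) (hgn : IsNet U g)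
    (hf : ModerateEst ⊤ q U f) (hg : ModerateEst ⊤ q U g) : ModerateEst ⊤ q U (f + g) := by
  intro k W hW
  obtain ⟨s, hs⟩ := hf k W hW
  obtain ⟨t, ht⟩ := hg k W hW
  refine ⟨max s t, lt_of_le_of_lt (parNorm_mono q le_rfl
    fun ε => sobolevNorm_add_le (hfn.1 ε) (hgn.1 ε) k W) ?_⟩
  exact parNorm_add_lt_top (measurable_sobolevNorm hfn k W) (measurable_sobolevNorm hgn k W)
    ((parNorm_mono q (le_max_left s t) fun _ => le_rfl).trans_lt hs)
    ((parNorm_mono q (le_max_right s t) fun _ => le_rfl).trans_lt ht)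

theorem NegligibleEst.add {f g : Par → U → ℂ} (hfn : IsNet U f) (hgn : IsNet U g)
    (hf : NegligibleEst ⊤ q U f) (hg : NegligibleEst ⊤ q U g) : NegligibleEst ⊤ q U (f + g) := by
  intro k W hW s
  refine lt_of_le_of_lt (parNorm_mono q le_rfl
    fun ε => sobolevNorm_add_le (hfn.1 ε) (hgn.1 ε) k W) ?_
  exact parNorm_add_lt_top (measurable_sobolevNorm hfn k W) (measurable_sobolevNorm hgn k W)
    (hf k W hW s) (hg k W hW s)

theorem parNorm_mul_sobolev {f g : Par → U → ℂ} (hfn : IsNet U f) (hgn : IsNet U g) {k : ℕ}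
    {W : Opens U} {s t : ℝ} (hs : parNorm ⊤ s (fun ε => sobolevNorm U k ⊤ W (f ε)) < ⊤)
    (ht : parNorm q t (fun ε => sobolevNorm U k ⊤ W (g ε)) < ⊤) :
    parNorm q (s + t) (fun ε => sobolevNorm U k ⊤ W ((f * g) ε)) < ⊤ :=
  lt_of_le_of_lt (parNorm_mono q le_rfl
    fun ε => sobolevNorm_mul_le (hfn.1 ε) (hgn.1 ε) k W) (parNorm_mul_lt_top _ hs ht)

theorem ModerateEst.mul {f g : Par → U → ℂ} (hfn : IsNet U f) (hgn : IsNet U g)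
    (hf : ModerateEst ⊤ ⊤ U f) (hg : ModerateEst ⊤ q U g) : ModerateEst ⊤ q U (f * g) := by
  intro k W hW
  obtain ⟨s, hs⟩ := hf k W hW
  obtain ⟨t, ht⟩ := hg k W hW
  exact ⟨s + t, parNorm_mul_sobolev hfn hgn hs ht⟩

theorem NegligibleEst.mul_left {f g : Par → U → ℂ} (hfn : IsNet U f) (hgn : IsNet U g)
    (hf : NegligibleEst ⊤ ⊤ U f) (hg : ModerateEst ⊤ q U g) : NegligibleEst ⊤ q U (f * g) := by
  intro k W hW s
  obtain ⟨t, ht⟩ := hg k W hW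
  have := parNorm_mul_sobolev hfn hgn (hf k W hW (s - t)) ht
  rwa [sub_add_cancel] at this

theorem NegligibleEst.mul_right {f g : Par → U → ℂ} (hfn : IsNet U f) (hgn : IsNet U g)
    (hf : ModerateEst ⊤ ⊤ U f) (hg : NegligibleEst ⊤ q U g) : NegligibleEst ⊤ q U (f * g) := by
  intro k W hW t
  obtain ⟨s, hs⟩ := hf k W hW
  have := parNorm_mul_sobolev hfn hgn hs (hg k W hW (t - s))
  rwa [add_sub_cancel] at this

theorem ModerateEst.pderiv {f : Par → U → ℂ} (hf : ModerateEst ⊤ q U f) (i : Fin d) :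
    ModerateEst ⊤ q U (fun ε => pderiv U i (f ε)) := by
  intro k W hW
  obtain ⟨s, hs⟩ := hf (k + 1) W hW
  exact ⟨s, lt_of_le_of_lt (parNorm_mono q le_rfl
    fun ε => sobolevNorm_pderiv_le (f ε) i k ⊤ W) hs⟩

theorem NegligibleEst.pderiv {f : Par → U → ℂ} (hf : NegligibleEst ⊤ q U f) (i : Fin d) :
    NegligibleEst ⊤ q U (fun ε => pderiv U i (f ε)) := fun k W hW s =>
  lt_of_le_of_lt (parNorm_mono q le_rfl
    fun ε => sobolevNorm_pderiv_le (f ε) i k ⊤ W) (hf (k + 1) W hW s)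

theorem ModerateEst.res (h : V ≤ U) {f : Par → U → ℂ} (hfn : IsNet U f)
    (hf : ModerateEst ⊤ q U f) : ModerateEst ⊤ q V (fun ε => res h (f ε)) := by
  intro k W hW
  obtain ⟨s, hs⟩ := hf k _ (isCompact_pushOpen h hW)
  exact ⟨s, lt_of_le_of_lt (parNorm_mono q le_rfl
    fun ε => sobolevNorm_res_le h (hfn.1 ε) k W) hs⟩

theorem NegligibleEst.res (h : V ≤ U) {f : Par → U → ℂ} (hfn : IsNet U f)
    (hf : NegligibleEst ⊤ q U f) : NegligibleEst ⊤ q V (fun ε => res h (f ε)) :=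
  fun k W hW s => lt_of_le_of_lt (parNorm_mono q le_rfl
    fun ε => sobolevNorm_res_le h (hfn.1 ε) k W) (hf k _ (isCompact_pushOpen h hW) s)

theorem moderateEst_const {f : U → ℂ} (hf : IsSmooth U f) :
    ModerateEst ⊤ ⊤ U (fun _ => f) := fun k _ hW =>
  ⟨0, parNorm_const_lt_top _ (sobolevNorm_ne_top hf k hW)⟩

theorem negligibleEst_zero : NegligibleEst ⊤ q U 0 := by
  intro k W _ s
  have : ∀ ε : Par, sobolevNorm U k ⊤ W ((0 : Par → U → ℂ) ε) = 0 := fun ε => by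
    simp [sobolevNorm, iterPderiv_zero]
  have h0 : parNorm q s (fun ε => sobolevNorm U k ⊤ W ((0 : Par → U → ℂ) ε)) = 0 := by
    simp only [parNorm, this, mul_zero]
    exact eLpNorm_zero'
  rw [h0]
  exact ENNReal.zero_lt_top

end Estimates

/-- The space of nets of `L^q`-moderate growth. -/
def E (q : ℝ≥0∞) (U : Opens (Rn d)) : Submodule ℂ (Net U) where
  carrier := {f | ModerateEst ⊤ q U f.toFun}
  add_mem' {f g} hf hg := ModerateEst.add f.isNet g.isNet hf hg
  zero_mem' := fun k W hW => ⟨0, negligibleEst_zero k W hW 0⟩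
  smul_mem' c f hf := ModerateEst.mul (isNet_const (isSmooth_const c)) f.isNet
    (moderateEst_const (isSmooth_const c)) hf

/-- The space of `L^q`-negligible nets. -/
def N (q : ℝ≥0∞) (U : Opens (Rn d)) : Submodule ℂ (Net U) where
  carrier := {f | NegligibleEst ⊤ q U f.toFun}
  add_mem' {f g} hf hg := NegligibleEst.add f.isNet g.isNet hf hg
  zero_mem' := negligibleEst_zero
  smul_mem' c f hf := NegligibleEst.mul_right (isNet_const (isSmooth_const c)) f.isNet
    (moderateEst_const (isSmooth_const c)) hf

/-- The space `G_q(U) = E_q(U) / N_q(U)` of generalized functions. -/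
def G (q : ℝ≥0∞) (U : Opens (Rn d)) : Type :=
  E q U ⧸ (N q U).submoduleOf (E q U)

instance (q : ℝ≥0∞) (U : Opens (Rn d)) : AddCommGroup (G q U) :=
  inferInstanceAs (AddCommGroup (E q U ⧸ (N q U).submoduleOf (E q U)))

instance (q : ℝ≥0∞) (U : Opens (Rn d)) : Module ℂ (G q U) :=
  inferInstanceAs (Module ℂ (E q U ⧸ (N q U).submoduleOf (E q U)))

section Operations

variable {U V : Opens (Rn d)} {q : ℝ≥0∞}

/-- The class `[(f_ε)_ε]` of a moderate net. -/
def cls (q : ℝ≥0∞) (U : Opens (Rn d)) : E q U →ₗ[ℂ] G q U :=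
  ((N q U).submoduleOf (E q U)).mkQ

theorem cls_surjective : Function.Surjective (cls q U) :=
  Submodule.mkQ_surjective _

/-- The linear map `G_q(U) → G_r(V)` induced by a map of representatives. -/
def lift {r : ℝ≥0∞} (L : E q U →ₗ[ℂ] E r V) (h : ∀ f : E q U, (f : Net U) ∈ N q U → (L f : Net V) ∈ N r V) :
    G q U →ₗ[ℂ] G r V :=
  Submodule.mapQ _ _ L fun f hf => h f hf

theorem lift_cls {r : ℝ≥0∞} (L : E q U →ₗ[ℂ] E r V)
    (h : ∀ f : E q U, (f : Net U) ∈ N q U → (L f : Net V) ∈ N r V) (f : E q U) :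
    lift L h (cls q U f) = cls r V (L f) := rfl

/-- Restriction of moderate nets. -/
def resE (q : ℝ≥0∞) (h : V ≤ U) : E q U →ₗ[ℂ] E q V where
  toFun f := ⟨Net.of (fun ε => res h (f.1.toFun ε)) (f.1.isNet.res h), ModerateEst.res h f.1.isNet f.2⟩
  map_add' _ _ := rfl
  map_smul' _ _ := rfl

/-- Restriction of generalized functions, via restriction of representatives. -/
def resG (q : ℝ≥0∞) (h : V ≤ U) : G q U →ₗ[ℂ] G q V :=
  lift (resE q h) fun f hf => NegligibleEst.res h f.1.isNet hf

/-- Partial differentiation of moderate nets. -/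
def pderivE (q : ℝ≥0∞) (U : Opens (Rn d)) (i : Fin d) : E q U →ₗ[ℂ] E q U where
  toFun f := ⟨Net.of (fun ε => pderiv U i (f.1.toFun ε)) (f.1.isNet.pderiv i), ModerateEst.pderiv f.2 i⟩
  map_add' f g := Subtype.ext <| Net.ext fun ε =>
    pderiv_add (f.1.isNet.1 ε) (g.1.isNet.1 ε) i
  map_smul' c f := Subtype.ext <| Net.ext fun ε => pderiv_smul c (f.1.isNet.1 ε) i

/-- Partial differentiation of generalized functions, via differentiation of representatives. -/
def pderivG (q : ℝ≥0∞) (U : Opens (Rn d)) (i : Fin d) : G q U →ₗ[ℂ] G q U :=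
  lift (pderivE q U i) fun _ hf => NegligibleEst.pderiv hf i

/-- Pointwise multiplication of nets in `E_∞(U)` with nets in `E_q(U)`. -/
def mulE (q : ℝ≥0∞) (U : Opens (Rn d)) : E ⊤ U →ₗ[ℂ] E q U →ₗ[ℂ] E q U :=
  LinearMap.mk₂ ℂ (fun f g => ⟨f.1 * g.1, ModerateEst.mul f.1.isNet g.1.isNet f.2 g.2⟩)
    (fun _ _ _ => Subtype.ext (add_mul _ _ _)) (fun _ _ _ => Subtype.ext (smul_mul_assoc _ _ _))
    (fun _ _ _ => Subtype.ext (mul_add _ _ _)) (fun _ _ _ => Subtype.ext (mul_smul_comm _ _ _))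

/-- The multiplication `G_∞(U) × G_q(U) → G_q(U)`, via pointwise multiplication of
representatives. -/
def mulG (q : ℝ≥0∞) (U : Opens (Rn d)) : G ⊤ U →ₗ[ℂ] G q U →ₗ[ℂ] G q U :=
  Submodule.liftQ _
    { toFun := fun f => lift (mulE q U f) fun g hg =>
        NegligibleEst.mul_right f.1.isNet g.1.isNet f.2 hg
      map_add' := fun f f' => LinearMap.ext fun x => by
        obtain ⟨g, rfl⟩ := cls_surjective x
        change cls q U (mulE q U (f + f') g) = cls q U (mulE q U f g) + cls q U (mulE q U f' g)
        rw [map_add, LinearMap.add_apply, map_add]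
      map_smul' := fun c f => LinearMap.ext fun x => by
        obtain ⟨g, rfl⟩ := cls_surjective x
        change cls q U (mulE q U (c • f) g) = c • cls q U (mulE q U f g)
        rw [map_smul, LinearMap.smul_apply, map_smul] }
    fun f hf => LinearMap.ext fun x => by
      obtain ⟨g, rfl⟩ := cls_surjective x
      exact (Submodule.Quotient.mk_eq_zero _).2 (NegligibleEst.mul_left f.1.isNet g.1.isNet hf g.2)

theorem mulG_cls (f : E ⊤ U) (g : E q U) :
    mulG q U (cls ⊤ U f) (cls q U g) = cls q U (mulE q U f g) := rfl

/-- Smooth functions as constant nets in `G_∞(U)`. -/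
def constE (U : Opens (Rn d)) (f : Smooth U) : E ⊤ U :=
  ⟨Net.of (fun _ => f.1) (isNet_const f.2), moderateEst_const f.2⟩

theorem mulG_assoc (a b : G ⊤ U) (c : G q U) :
    mulG q U (mulG ⊤ U a b) c = mulG q U a (mulG q U b c) := by
  obtain ⟨a, rfl⟩ := cls_surjective a
  obtain ⟨b, rfl⟩ := cls_surjective b
  obtain ⟨c, rfl⟩ := cls_surjective c
  simp only [mulG_cls]
  exact congrArg _ (Subtype.ext (mul_assoc _ _ _))

theorem mulG_comm (a b : G ⊤ U) : mulG ⊤ U a b = mulG ⊤ U b a := by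
  obtain ⟨a, rfl⟩ := cls_surjective a
  obtain ⟨b, rfl⟩ := cls_surjective b
  simp only [mulG_cls]
  exact congrArg _ (Subtype.ext (mul_comm _ _))

theorem one_mulG (a : G q U) : mulG q U (cls ⊤ U (constE U 1)) a = a := by
  obtain ⟨a, rfl⟩ := cls_surjective a
  simp only [mulG_cls]
  exact congrArg _ (Subtype.ext (one_mul _))

/-- The algebra structure of `G_∞(U)`. -/
instance (U : Opens (Rn d)) : CommRing (G ⊤ U) :=
  { (inferInstance : AddCommGroup (G ⊤ U)) with
    mul := fun a b => mulG ⊤ U a b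
    one := cls ⊤ U (constE U 1)
    mul_assoc := mulG_assoc
    mul_comm := mulG_comm
    one_mul := one_mulG
    mul_one := fun a => (mulG_comm _ _).trans (one_mulG a)
    left_distrib := fun a b c => (mulG ⊤ U a).map_add b c
    right_distrib := fun a b c => LinearMap.map_add₂ (mulG ⊤ U) a b c
    zero_mul := fun a => LinearMap.map_zero₂ (mulG ⊤ U) a
    mul_zero := fun a => (mulG ⊤ U a).map_zero }

/-- `G_q(U)` as a module over the ring `G_∞(U)`. -/
instance (q : ℝ≥0∞) (U : Opens (Rn d)) : Module (G ⊤ U) (G q U) where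
  smul a x := mulG q U a x
  one_smul := one_mulG
  mul_smul := mulG_assoc
  smul_zero a := (mulG q U a).map_zero
  smul_add a := (mulG q U a).map_add
  add_smul := LinearMap.map_add₂ (mulG q U)
  zero_smul := LinearMap.map_zero₂ (mulG q U)

theorem cls_smul_cls (f : E ⊤ U) (g : E q U) :
    cls ⊤ U f • cls q U g = cls q U (mulE q U f g) := rfl

/-- The embedding of `C^∞(U)` into `G_∞(U)` through constant nets. -/
def smoothToG (U : Opens (Rn d)) : Smooth U →+* G ⊤ U where
  toFun f := cls ⊤ U (constE U f)
  map_one' := rfl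
  map_mul' _ _ := rfl
  map_zero' := (cls ⊤ U).map_zero
  map_add' f g := (cls ⊤ U).map_add (constE U f) (constE U g)

end Operations

/-! ### Generalized constants -/

/-- Moderate nets of constants (in the sense of `q = ∞`), continuous in the parameter. -/
def constModSubalgebra : Subalgebra ℂ C(Par, ℂ) where
  carrier := {c | ∃ s : ℝ, parNorm ⊤ s (fun ε => ‖c ε‖ₑ) < ⊤}
  mul_mem' := by
    rintro a b ⟨s, hs⟩ ⟨t, ht⟩
    refine ⟨s + t, lt_of_le_of_lt (parNorm_mono ⊤ le_rfl fun ε => ?_)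
      (parNorm_mul_lt_top 1 hs ht)⟩
    simp [enorm_mul]
  add_mem' := by
    rintro a b ⟨s, hs⟩ ⟨t, ht⟩
    refine ⟨max s t, lt_of_le_of_lt (parNorm_mono ⊤ le_rfl fun ε => enorm_add_le _ _) ?_⟩
    exact parNorm_add_lt_top a.continuous.enorm.measurable b.continuous.enorm.measurable
      ((parNorm_mono ⊤ (le_max_left s t) fun _ => le_rfl).trans_lt hs)
      ((parNorm_mono ⊤ (le_max_right s t) fun _ => le_rfl).trans_lt ht)
  algebraMap_mem' c := ⟨0, parNorm_const_lt_top ‖c‖ₑ enorm_ne_top⟩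

/-- The ring of moderate nets of constants. -/
def ConstMod : Type := constModSubalgebra

instance : CommRing ConstMod := inferInstanceAs (CommRing constModSubalgebra)

/-- The underlying continuous function of a net of constants. -/
def ConstMod.toFun (c : ConstMod) : C(Par, ℂ) := Subtype.val c

/-- Negligible nets of constants (in the sense of `q = ∞`). -/
def ConstNeg : Ideal ConstMod where
  carrier := {c | ∀ s : ℝ, parNorm ⊤ s (fun ε => ‖c.toFun ε‖ₑ) < ⊤}
  add_mem' := by
    intro a b ha hb s
    exact lt_of_le_of_lt (parNorm_mono ⊤ le_rfl fun ε => enorm_add_le _ _)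
      (parNorm_add_lt_top a.toFun.continuous.enorm.measurable b.toFun.continuous.enorm.measurable
        (ha s) (hb s))
  zero_mem' := by
    intro s
    have h0 : parNorm ⊤ s (fun ε => ‖(0 : constModSubalgebra).1 ε‖ₑ) = 0 := by
      simp only [parNorm, ZeroMemClass.coe_zero, ContinuousMap.zero_apply, enorm_zero, mul_zero]
      exact eLpNorm_zero'
    exact h0.trans_lt ENNReal.zero_lt_top
  smul_mem' := by
    rintro ⟨a, s, hs⟩ b hb t
    have := parNorm_mul_lt_top 1 hs (hb (t - s))
    rw [add_sub_cancel] at this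
    refine lt_of_le_of_lt (parNorm_mono ⊤ le_rfl fun ε => ?_) this
    rw [ENNReal.coe_one, one_mul, ← enorm_mul]
    exact le_rfl

/-- The ring of generalized constants. -/
abbrev GenConst : Type := ConstMod ⧸ ConstNeg

theorem moderateEst_param (U : Opens (Rn d)) (c : ConstMod) :
    ModerateEst ⊤ ⊤ U (fun ε _ => c.toFun ε) := by
  intro k W _
  obtain ⟨s, hs⟩ := c.2
  exact ⟨s, lt_of_le_of_lt (parNorm_mono ⊤ le_rfl fun ε => sobolevNorm_const_le _ k W) hs⟩

/-- Nets of constants as nets of functions that are constant in the space variable. -/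
def constModToG (U : Opens (Rn d)) : ConstMod →+* G ⊤ U where
  toFun c := cls ⊤ U ⟨Net.of (fun ε _ => c.toFun ε) (isNet_param c.toFun.continuous), moderateEst_param U c⟩
  map_one' := rfl
  map_mul' _ _ := rfl
  map_zero' := (cls ⊤ U).map_zero
  map_add' c c' := (cls ⊤ U).map_add
    ⟨Net.of (fun ε _ => c.toFun ε) (isNet_param c.toFun.continuous), moderateEst_param U c⟩
    ⟨Net.of (fun ε _ => c'.toFun ε) (isNet_param c'.toFun.continuous), moderateEst_param U c'⟩

/-- The canonical ring homomorphism from the generalized constants to `G_∞(U)`. -/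
def genConstToG (U : Opens (Rn d)) : GenConst →+* G ⊤ U :=
  Ideal.Quotient.lift ConstNeg (constModToG U) fun _ hc =>
    (Submodule.Quotient.mk_eq_zero _).2 fun k W _ s =>
      lt_of_le_of_lt (parNorm_mono ⊤ le_rfl fun _ => sobolevNorm_const_le _ k W) (hc s)

/-- `G_q(U)` as a module over the ring of generalized constants. -/
instance (q : ℝ≥0∞) (U : Opens (Rn d)) : Module GenConst (G q U) :=
  Module.compHom (G q U) (genConstToG U)

theorem genConst_smul_def {q : ℝ≥0∞} {U : Opens (Rn d)} (c : GenConst) (x : G q U) :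
    c • x = genConstToG U c • x := rfl

theorem resG_smul {q : ℝ≥0∞} {U V : Opens (Rn d)} (h : V ≤ U) (a : G ⊤ U) (x : G q U) :
    resG q h (a • x) = resG ⊤ h a • resG q h x := by
  obtain ⟨a, rfl⟩ := cls_surjective a
  obtain ⟨x, rfl⟩ := cls_surjective x
  rfl

theorem resG_genConst {U V : Opens (Rn d)} (h : V ≤ U) (c : GenConst) :
    resG ⊤ h (genConstToG U c) = genConstToG V c := by
  obtain ⟨c, rfl⟩ := Ideal.Quotient.mk_surjective c
  rfl

/-- The presheaf `U ↦ G_q(U)` of modules over the generalized constants. -/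
def GPresheaf (d : ℕ) (q : ℝ≥0∞) :
    TopCat.Presheaf (ModuleCat GenConst) (TopCat.of (Rn d)) where
  obj U := ModuleCat.of GenConst (G q U.unop)
  map {U V} h := ModuleCat.ofHom
    { toFun := resG q h.unop.le
      map_add' := map_add _
      map_smul' := fun c x => by
        simp only [genConst_smul_def, resG_smul, resG_genConst, RingHom.id_apply] }
  map_id U := by
    ext x
    obtain ⟨x, rfl⟩ := cls_surjective x
    rfl
  map_comp f g := by
    ext x
    obtain ⟨x, rfl⟩ := cls_surjective x
    rfl

open CategoryTheory in
/-- A sheaf `F` of modules on a space `X` is fine if every locally finite open cover `(W_i)` of `X`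
admits a subordinate partition of unity in the endomorphisms of `F`: endomorphisms `h_i` of `F`,
vanishing outside closed sets `A_i ⊆ W_i`, with `∑ h_i = id` (a locally finite sum). -/
def IsFine {R : Type} [Ring R] {X : TopCat.{0}} (F : TopCat.Presheaf (ModuleCat.{0} R) X) : Prop :=
  ∀ (ι : Type) (W : ι → Opens X), (⨆ i, W i = ⊤) → LocallyFinite (fun i => (W i : Set X)) →
    ∃ (h : ι → (F ⟶ F)) (A : ι → Set X),
      (∀ i, IsClosed (A i) ∧ A i ⊆ W i) ∧
      (∀ i (V : Opens X), Disjoint (V : Set X) (A i) →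
        ∀ s : F.obj (Opposite.op V), (h i).app (Opposite.op V) s = 0) ∧
      (∀ V : Opens X, {i | ((W i : Set X) ∩ V).Nonempty}.Finite →
        ∀ s : F.obj (Opposite.op V), ∑ᶠ i, (h i).app (Opposite.op V) s = s)

/-- The support of a section `x` of `G_q` over `U`. -/
def suppG {q : ℝ≥0∞} {U : Opens (Rn d)} (x : G q U) : Set U :=
  {y | ∀ (V : Opens (Rn d)) (h : V ≤ U), (y : Rn d) ∈ V → resG q h x ≠ 0}

/-! ### Distributions -/

/-- The space `D'(U)` of distributions on `U`. -/
abbrev Distr (U : Opens (Rn d)) : Type := 𝓓(U, ℂ) →L[ℂ] ℂ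

/-- Restriction of distributions. -/
def resD {U V : Opens (Rn d)} (_h : V ≤ U) (T : Distr U) : Distr V :=
  T ∘L (TestFunction.monoCLM ℂ : 𝓓(V, ℂ) →L[ℂ] 𝓓(U, ℂ))

/-- The support of a distribution on `U`, as a subset of `U`. -/
def suppD {U : Opens (Rn d)} (T : Distr U) : Set U :=
  Subtype.val ⁻¹' Distribution.dsupport T

/-- The regular distribution `ρ ↦ ∫ ρ f` given by a smooth function `f`. -/
def smoothToD (U : Opens (Rn d)) (f : Smooth U) : Distr U :=
  TestFunction.integralAgainstBilinCLM (ContinuousLinearMap.mul ℂ ℂ) volume (ext U f.1)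

/-- The moment conditions on a mollifier: `∫ φ = 1`, and `∫ x^α φ(x) dx = 0` for `α ≠ 0`. -/
def IsMollifier (φ : 𝓢(Rn d, ℂ)) : Prop :=
  ∫ x, φ x = 1 ∧ ∀ α : Fin d → ℕ, α ≠ 0 → ∫ x, (∏ i, (x i : ℂ) ^ α i) * φ x = 0

/-- The test function `y ↦ χ(y) φ_ε(x - y)`, where `φ_ε = ε^{-d} φ(·/ε)`. -/
def mollTest {U : Opens (Rn d)} (φ : 𝓢(Rn d, ℂ)) (χ : 𝓓(U, ℂ)) (ε : Par) (x : Rn d) : 𝓓(U, ℂ) where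
  toFun y := χ y * (((ε : ℝ) : ℂ)⁻¹ ^ d * φ ((ε : ℝ)⁻¹ • (x - y)))
  contDiff' := by
    have h1 := χ.contDiff
    have h2 := φ.smooth ⊤
    refine h1.mul (contDiff_const.mul (h2.comp ?_))
    fun_prop
  hasCompactSupport' := χ.hasCompactSupport.mul_right
  tsupport_subset' := (tsupport_mul_subset_left).trans χ.tsupport_subset

/-- The net `(T ∗ φ_ε)(x) = ⟨T_y, φ_ε(x - y)⟩` on `U`, for a distribution `T` with compact support in
`U`; the pairing with the smooth function `φ_ε(x - ·)` is computed with a cutoff `χ`, which has to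
be `1` near the support of `T`. -/
def mollify {U : Opens (Rn d)} (φ : 𝓢(Rn d, ℂ)) (T : Distr U) (χ : 𝓓(U, ℂ)) : Par → U → ℂ :=
  fun ε x => T (mollTest φ χ ε x)

/-- `x` is the class in `G_q(U)` of the net `f`, which is a moderate net. -/
def IsClassOf {q : ℝ≥0∞} {U : Opens (Rn d)} (x : G q U) (f : Par → U → ℂ) : Prop :=
  ∃ (hf : IsNet U f) (hm : Net.of f hf ∈ E q U), x = cls q U ⟨Net.of f hf, hm⟩

end GenFun

end

open GenFun

/-!
The theorem consists of three facts on growth estimates: they are local, they do not see which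
Lebesgue exponent is used in the space variables, and mollification with a kernel that has vanishing
moments satisfies them.

*Sheaf and fineness.* Moderateness and negligibility can be tested on small neighbourhoods of points
(`moderateEst_iff_forall_nhds`, `negligibleEst_iff_forall_nhds`), because relatively compact sets are
covered by finitely many of these. Hence a generalized function that vanishes locally vanishes, and
representatives of compatible sections can be glued with a smooth partition of unity (`exists_glue`):
the glued net differs from a given representative by a locally finite sum of smooth multiples of
negligible differences. Multiplication by the functions of a partition of unity gives the sheaf
endomorphisms that fineness asks for (`smoothMulHom`).

*Independence of the exponent.* On relatively compact sets the `L^∞` norm dominates the `L^p` norm.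
Conversely, a compactly supported function is bounded by the integral of its mixed derivative
`∂₁ ⋯ ∂_d` (`enorm_le_lintegral_iterGderiv`), so that, after a cutoff, suprema are controlled by `L^p`
norms with `d` more derivatives (`exists_sobolevNorm_top_le`).

*The embedding.* A distribution is of finite order on compact sets. By the Sobolev inequality its
product with a test function `χ` is therefore bounded by an `L²` Sobolev norm, and a representation in
the Hilbert space of jets exhibits it as a finite sum of derivatives of integrable functions supported
near the support of `χ` (`exists_structure`). Consequently the mollification `χT ∗ φ_ε` is a finite sum
of derivatives of convolutions of integrable functions with `φ_ε` (`exists_mollify_eq`). It is moderate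
since each derivative of `φ_ε` costs one power of `ε⁻¹`, and negligible where `χ` vanishes since `φ`
decreases rapidly (`negligibleEst_mollify`). So the class of `χT ∗ φ_ε` on an open set on which `χ = 1`
is independent of `χ`, and these classes glue to the image of `T` (`exists_isEmbedded`, `embed`);
compatibility with restrictions is built into this local characterization (`IsEmbedded.unique`).

*Smooth functions.* The `t`-derivative of `∫ φ(z) g(x - t z) dz` is a sum of integrals of the same form
with `φ` replaced by its products with the coordinates. As the moments vanish, induction shows that
this integral differs from `g(x)` by `O(t^n)` for all `n` (`IsMollifier.exists_norm_smear_sub_le`), so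
that `g ∗ φ_ε - g` is negligible and the embedding is given by constant nets on smooth functions
(`isClassOf_embed_smoothToD`). Products of smooth functions are then respected trivially.

*Injectivity and supports.* Paired with a test function `ρ`, the mollifications of `T` converge to
`T ρ` with error `O(ε)` (`exists_norm_integral_mollTest_sub_le`). If they are negligible, they are
arbitrarily small on the support of `ρ` for suitable small parameters (`exists_lt_of_parNorm_lt_top`),
whence `T ρ = 0` (`injective_embed`). Applied on every open subset, this identifies the supports
(`suppG_embed`).
-/

noncomputable section

namespace GenFun

variable {d : ℕ}

/-! ### Growth estimates are local -/

section Local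

variable {U V : Opens (Rn d)} {q : ℝ≥0∞}

/-- The supremum over the points of `S` of the partial derivatives of `f` of order at most `k`.
Unlike `sobolevNorm` it is indexed by subsets of the ambient space, so that it can be compared
between different domains. -/
def supDeriv (U : Opens (Rn d)) (k : ℕ) (S : Set (Rn d)) (f : U → ℂ) : ℝ≥0∞ :=
  ⨆ (l : List (Fin d)) (_ : l.length ≤ k) (x : U) (_ : (x : Rn d) ∈ S), ‖iterPderiv U l f x‖ₑ

theorem le_supDeriv {k : ℕ} {S : Set (Rn d)} {f : U → ℂ} {l : List (Fin d)} (hl : l.length ≤ k)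
    {x : U} (hx : (x : Rn d) ∈ S) : ‖iterPderiv U l f x‖ₑ ≤ supDeriv U k S f :=
  le_iSup₂_of_le l hl (le_iSup₂_of_le x hx le_rfl)

theorem supDeriv_le {k : ℕ} {S : Set (Rn d)} {f : U → ℂ} {c : ℝ≥0∞}
    (h : ∀ l : List (Fin d), l.length ≤ k → ∀ x : U, (x : Rn d) ∈ S → ‖iterPderiv U l f x‖ₑ ≤ c) :
    supDeriv U k S f ≤ c :=
  iSup₂_le fun l hl => iSup₂_le fun x hx => h l hl x hx

theorem supDeriv_mono {k : ℕ} {S T : Set (Rn d)} (h : S ⊆ T) (f : U → ℂ) :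
    supDeriv U k S f ≤ supDeriv U k T f :=
  supDeriv_le fun _ hl _ hx => le_supDeriv hl (h hx)

theorem supDeriv_union_le {k : ℕ} {S T : Set (Rn d)} (f : U → ℂ) :
    supDeriv U k (S ∪ T) f ≤ supDeriv U k S f + supDeriv U k T f :=
  supDeriv_le fun _ hl _ hx => hx.elim (fun h => (le_supDeriv hl h).trans le_self_add)
    fun h => (le_supDeriv hl h).trans le_add_self

theorem supDeriv_res (h : V ≤ U) {k : ℕ} {S : Set (Rn d)} (hS : S ⊆ V) (f : U → ℂ) :
    supDeriv V k S (res h f) = supDeriv U k S f := by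
  apply le_antisymm
  · refine supDeriv_le fun l hl x hx => ?_
    rw [iterPderiv_res]
    exact le_supDeriv (x := Opens.inclusion h x) hl hx
  · refine supDeriv_le fun l hl x hx => ?_
    have := le_supDeriv (U := V) (f := res h f) (x := ⟨x, hS hx⟩) hl hx
    rwa [iterPderiv_res] at this

theorem sobolevNorm_top_eq_supDeriv {f : U → ℂ} (hf : IsSmooth U f) (k : ℕ) (W : Opens U) :
    sobolevNorm U k ⊤ W f = supDeriv U k (Subtype.val '' (W : Set U)) f := by
  unfold sobolevNorm supDeriv
  refine iSup_congr fun l => iSup_congr fun _ => ?_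
  rw [eLpNorm_top_eq (hf.iterPderiv l).continuous]
  apply le_antisymm
  · exact iSup_le fun x => le_iSup₂_of_le x.1 (mem_image_of_mem _ x.2) le_rfl
  · refine iSup₂_le fun x hx => ?_
    obtain ⟨y, hy, hyx⟩ := hx
    obtain rfl := Subtype.ext hyx
    exact le_iSup (fun x : W => ‖iterPderiv U l f x‖ₑ) ⟨y, hy⟩

/-- As a supremum of continuous functions of the parameter, `supDeriv` is lower semicontinuous,
hence measurable, for an arbitrary set `S`. -/
theorem measurable_supDeriv {f : Par → U → ℂ} (hf : IsNet U f) (k : ℕ) (S : Set (Rn d)) :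
    Measurable fun ε => supDeriv U k S (f ε) := by
  unfold supDeriv
  refine Measurable.iSup fun l => Measurable.iSup fun _ => ?_
  refine LowerSemicontinuous.measurable (lowerSemicontinuous_iSup fun x =>
    lowerSemicontinuous_iSup fun _ => Continuous.lowerSemicontinuous ?_)
  exact ((hf.2 l).comp (continuous_id.prodMk continuous_const)).enorm

theorem supDeriv_empty (k : ℕ) (f : U → ℂ) : supDeriv U k ∅ f = 0 := by
  simp [supDeriv]

theorem parNorm_zero_lt_top (q : ℝ≥0∞) (s : ℝ) : parNorm q s (fun _ => 0) < ⊤ := by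
  simp [parNorm]

/-- Every point of `U` has a relatively compact open neighbourhood in `U`. -/
theorem exists_opens_isCompact_closure (x : U) :
    ∃ W : Opens U, x ∈ W ∧ IsCompact (closure (W : Set U)) := by
  have : LocallyCompactSpace U := U.isOpen.locallyCompactSpace
  obtain ⟨W, hW, hxW, hc⟩ :=
    exists_isOpen_superset_and_isCompact_closure (isCompact_singleton (x := x))
  exact ⟨⟨W, hW⟩, hxW rfl, hc⟩

/-- Moderateness can be tested on small neighbourhoods of the points of the domain. -/
theorem moderateEst_iff_forall_nhds {f : Par → U → ℂ} (hf : IsNet U f) :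
    ModerateEst ⊤ q U f ↔ ∀ (k : ℕ) (x : U), ∃ S ∈ 𝓝 (x : Rn d), ∃ s : ℝ,
      parNorm q s (fun ε => supDeriv U k S (f ε)) < ⊤ := by
  constructor
  · intro h k x
    obtain ⟨W, hx, hW⟩ := exists_opens_isCompact_closure x
    obtain ⟨s, hs⟩ := h k W hW
    refine ⟨Subtype.val '' (W : Set U),
      (U.isOpen.isOpenEmbedding_subtypeVal.isOpenMap _ W.isOpen).mem_nhds
        (mem_image_of_mem _ hx), s, ?_⟩
    simpa only [sobolevNorm_top_eq_supDeriv (hf.1 _)] using hs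
  · intro h k W hW
    simp only [sobolevNorm_top_eq_supDeriv (hf.1 _)]
    have key : ∃ s : ℝ, parNorm q s
        (fun ε => supDeriv U k (Subtype.val '' closure (W : Set U)) (f ε)) < ⊤ := by
      refine hW.induction_on (p := fun S : Set U => ∃ s : ℝ, parNorm q s
        (fun ε => supDeriv U k (Subtype.val '' S) (f ε)) < ⊤) ?_ ?_ ?_ ?_
      · exact ⟨0, by simpa [supDeriv_empty] using parNorm_zero_lt_top q 0⟩
      · rintro S T hST ⟨s, hs⟩
        exact ⟨s, (parNorm_mono q le_rfl fun ε =>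
          supDeriv_mono (image_mono hST) _).trans_lt hs⟩
      · rintro S T ⟨s, hs⟩ ⟨t, ht⟩
        refine ⟨max s t, (parNorm_mono q le_rfl fun ε => ?_).trans_lt
          (parNorm_add_lt_top (measurable_supDeriv hf k (Subtype.val '' S))
            (measurable_supDeriv hf k (Subtype.val '' T))
            ((parNorm_mono q (le_max_left s t) fun _ => le_rfl).trans_lt hs)
            ((parNorm_mono q (le_max_right s t) fun _ => le_rfl).trans_lt ht))⟩
        rw [image_union]
        exact supDeriv_union_le _
      · intro x _
        obtain ⟨S, hS, s, hs⟩ := h k x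
        refine ⟨Subtype.val ⁻¹' S, mem_nhdsWithin_of_mem_nhds
          (continuous_subtype_val.continuousAt hS), s, ?_⟩
        exact (parNorm_mono q le_rfl fun ε =>
          supDeriv_mono (image_preimage_subset _ _) _).trans_lt hs
    obtain ⟨s, hs⟩ := key
    exact ⟨s, (parNorm_mono q le_rfl fun ε =>
      supDeriv_mono (image_mono subset_closure) _).trans_lt hs⟩

/-- Negligibility can be tested on small neighbourhoods of the points of the domain, which may
depend on the exponent. -/
theorem negligibleEst_iff_forall_nhds {f : Par → U → ℂ} (hf : IsNet U f) :
    NegligibleEst ⊤ q U f ↔ ∀ (k : ℕ) (x : U) (s : ℝ), ∃ S ∈ 𝓝 (x : Rn d),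
      parNorm q s (fun ε => supDeriv U k S (f ε)) < ⊤ := by
  constructor
  · intro h k x s
    obtain ⟨W, hx, hW⟩ := exists_opens_isCompact_closure x
    refine ⟨Subtype.val '' (W : Set U),
      (U.isOpen.isOpenEmbedding_subtypeVal.isOpenMap _ W.isOpen).mem_nhds
        (mem_image_of_mem _ hx), ?_⟩
    simpa only [sobolevNorm_top_eq_supDeriv (hf.1 _)] using h k W hW s
  · intro h k W hW s
    simp only [sobolevNorm_top_eq_supDeriv (hf.1 _)]
    have key : parNorm q s
        (fun ε => supDeriv U k (Subtype.val '' closure (W : Set U)) (f ε)) < ⊤ := by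
      refine hW.induction_on (p := fun S : Set U => parNorm q s
        (fun ε => supDeriv U k (Subtype.val '' S) (f ε)) < ⊤) ?_ ?_ ?_ ?_
      · simpa [supDeriv_empty] using parNorm_zero_lt_top q s
      · intro S T hST hs
        exact (parNorm_mono q le_rfl fun ε => supDeriv_mono (image_mono hST) _).trans_lt hs
      · intro S T hs ht
        refine (parNorm_mono q le_rfl fun ε => ?_).trans_lt
          (parNorm_add_lt_top (measurable_supDeriv hf k (Subtype.val '' S))
            (measurable_supDeriv hf k (Subtype.val '' T)) hs ht)
        rw [image_union]
        exact supDeriv_union_le _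
      · intro x _
        obtain ⟨S, hS, hs⟩ := h k x s
        refine ⟨Subtype.val ⁻¹' S, mem_nhdsWithin_of_mem_nhds
          (continuous_subtype_val.continuousAt hS), ?_⟩
        exact (parNorm_mono q le_rfl fun ε =>
          supDeriv_mono (image_preimage_subset _ _) _).trans_lt hs
    exact (parNorm_mono q le_rfl fun ε =>
      supDeriv_mono (image_mono subset_closure) _).trans_lt key

theorem moderateEst_of_local {f : Par → U → ℂ} (hf : IsNet U f)
    (h : ∀ x : U, ∃ (V : Opens (Rn d)) (hV : V ≤ U), (x : Rn d) ∈ V ∧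
      ModerateEst ⊤ q V (fun ε => res hV (f ε))) : ModerateEst ⊤ q U f := by
  rw [moderateEst_iff_forall_nhds hf]
  intro k x
  obtain ⟨V, hV, hx, hm⟩ := h x
  obtain ⟨S, hS, s, hs⟩ := (moderateEst_iff_forall_nhds (hf.res hV)).1 hm k ⟨x, hx⟩
  refine ⟨S ∩ V, Filter.inter_mem hS (V.isOpen.mem_nhds hx), s, ?_⟩
  refine (parNorm_mono q le_rfl fun ε => ?_).trans_lt hs
  rw [← supDeriv_res hV inter_subset_right]
  exact supDeriv_mono inter_subset_left _

theorem negligibleEst_of_local {f : Par → U → ℂ} (hf : IsNet U f)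
    (h : ∀ x : U, ∃ (V : Opens (Rn d)) (hV : V ≤ U), (x : Rn d) ∈ V ∧
      NegligibleEst ⊤ q V (fun ε => res hV (f ε))) : NegligibleEst ⊤ q U f := by
  rw [negligibleEst_iff_forall_nhds hf]
  intro k x s
  obtain ⟨V, hV, hx, hm⟩ := h x
  obtain ⟨S, hS, hs⟩ := (negligibleEst_iff_forall_nhds (hf.res hV)).1 hm k ⟨x, hx⟩ s
  refine ⟨S ∩ V, Filter.inter_mem hS (V.isOpen.mem_nhds hx), ?_⟩
  refine (parNorm_mono q le_rfl fun ε => ?_).trans_lt hs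
  rw [← supDeriv_res hV inter_subset_right]
  exact supDeriv_mono inter_subset_left _

theorem isSmooth_of_local {f : U → ℂ} (h : ∀ x : U, ∃ (V : Opens (Rn d)) (hV : V ≤ U),
    (x : Rn d) ∈ V ∧ IsSmooth V (res hV f)) : IsSmooth U f := by
  intro x hx
  obtain ⟨V, hV, hxV, hs⟩ := h ⟨x, hx⟩
  have hs' : ContDiffOn ℝ ∞ (ext U f) V :=
    (isSmooth_iff_of_eqOn fun y => (ext_apply f (Opens.inclusion hV y)).symm).1 hs
  exact (hs'.contDiffAt (V.isOpen.mem_nhds hxV)).contDiffWithinAt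

theorem isNet_of_local {f : Par → U → ℂ} (h : ∀ x : U, ∃ (V : Opens (Rn d)) (hV : V ≤ U),
    (x : Rn d) ∈ V ∧ IsNet V (fun ε => res hV (f ε))) : IsNet U f := by
  refine ⟨fun ε => isSmooth_of_local fun x => ?_, fun l => ?_⟩
  · obtain ⟨V, hV, hx, hn⟩ := h x
    exact ⟨V, hV, hx, hn.1 ε⟩
  · rw [continuous_iff_continuousAt]
    rintro ⟨ε, x⟩
    obtain ⟨V, hV, hx, hn⟩ := h x
    have hc := hn.2 l
    simp only [iterPderiv_res] at hc
    have hemb : IsOpenEmbedding (Prod.map id (Opens.inclusion hV) : Par × V → Par × U) :=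
      IsOpenEmbedding.id.prodMap (Opens.isOpenEmbedding_of_le hV)
    exact (hemb.continuousAt_iff (x := (ε, ⟨x, hx⟩))).1 hc.continuousAt

theorem cls_eq_zero_iff {f : E q U} : cls q U f = 0 ↔ NegligibleEst ⊤ q U f.1.toFun :=
  Submodule.Quotient.mk_eq_zero _

theorem cls_eq_cls_iff {f g : E q U} :
    cls q U f = cls q U g ↔ NegligibleEst ⊤ q U (f.1.toFun - g.1.toFun) := by
  rw [← sub_eq_zero, ← map_sub, cls_eq_zero_iff]
  rfl

theorem resG_cls (h : V ≤ U) (f : E q U) : resG q h (cls q U f) = cls q V (resE q h f) := rfl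

theorem resG_resG {W : Opens (Rn d)} (h : V ≤ U) (h' : W ≤ V) (a : G q U) :
    resG q h' (resG q h a) = resG q (h'.trans h) a := by
  obtain ⟨f, rfl⟩ := cls_surjective a
  rfl

/-- Generalized functions form a separated presheaf. -/
theorem eq_of_resG_eq {a b : G q U} (h : ∀ x : U, ∃ (V : Opens (Rn d)) (hV : V ≤ U),
    (x : Rn d) ∈ V ∧ resG q hV a = resG q hV b) : a = b := by
  obtain ⟨f, rfl⟩ := cls_surjective a
  obtain ⟨g, rfl⟩ := cls_surjective b
  rw [cls_eq_cls_iff]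
  refine negligibleEst_of_local (f.1 - g.1).isNet fun x => ?_
  obtain ⟨V, hV, hx, he⟩ := h x
  rw [resG_cls, resG_cls, cls_eq_cls_iff] at he
  exact ⟨V, hV, hx, he⟩

theorem IsNet.sub {f g : Par → U → ℂ} (hf : IsNet U f) (hg : IsNet U g) : IsNet U (f - g) :=
  (Net.of f hf - Net.of g hg).isNet

theorem IsNet.sum {ι : Type*} (I : Finset ι) {f : ι → Par → U → ℂ} (hf : ∀ i ∈ I, IsNet U (f i)) :
    IsNet U (∑ i ∈ I, f i) :=
  (netSubalgebra U).sum_mem hf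

theorem ModerateEst.sum {ι : Type*} (I : Finset ι) {f : ι → Par → U → ℂ}
    (hf : ∀ i ∈ I, IsNet U (f i)) (hm : ∀ i ∈ I, ModerateEst ⊤ q U (f i)) :
    ModerateEst ⊤ q U (∑ i ∈ I, f i) := by
  classical
  induction I using Finset.induction_on with
  | empty => exact fun k W hW => ⟨0, negligibleEst_zero k W hW 0⟩
  | insert i I hi ih =>
    rw [Finset.sum_insert hi]
    exact (hm i (by simp)).add (hf i (by simp)) (IsNet.sum I fun j hj => hf j (by simp [hj]))
      (ih (fun j hj => hf j (by simp [hj])) fun j hj => hm j (by simp [hj]))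

theorem NegligibleEst.sum {ι : Type*} (I : Finset ι) {f : ι → Par → U → ℂ}
    (hf : ∀ i ∈ I, IsNet U (f i)) (hm : ∀ i ∈ I, NegligibleEst ⊤ q U (f i)) :
    NegligibleEst ⊤ q U (∑ i ∈ I, f i) := by
  classical
  induction I using Finset.induction_on with
  | empty => exact negligibleEst_zero
  | insert i I hi ih =>
    rw [Finset.sum_insert hi]
    exact (hm i (by simp)).add (hf i (by simp)) (IsNet.sum I fun j hj => hf j (by simp [hj]))
      (ih (fun j hj => hf j (by simp [hj])) fun j hj => hm j (by simp [hj]))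

end Local

/-! ### Partitions of unity and the sheaf property -/

section Sheaf

variable {U V : Opens (Rn d)} {q : ℝ≥0∞}

open scoped Manifold in
theorem isSmooth_of_contMDiff {f : U → ℝ} (hf : ContMDiff (𝓘(ℝ, Rn d)) (𝓘(ℝ, ℝ)) ∞ f) :
    IsSmooth U (fun x => (f x : ℂ)) := by
  have hF : ∀ x : U, Function.extend Subtype.val f 0 (x : Rn d) = f x :=
    fun x => Subtype.val_injective.extend_apply f 0 x
  refine (isSmooth_iff_of_eqOn (g := fun x => ((Function.extend Subtype.val f 0 x : ℝ) : ℂ))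
    fun x => by rw [hF]).2 fun x hx => ?_
  have h1 : ContMDiffAt (𝓘(ℝ, Rn d)) (𝓘(ℝ, ℝ)) ∞ (Function.extend Subtype.val f 0) x := by
    rw [← contMDiffAt_subtype_iff (x := (⟨x, hx⟩ : U))]
    exact (hf ⟨x, hx⟩).congr_of_eventuallyEq (Filter.Eventually.of_forall hF)
  exact (Complex.ofRealCLM.contDiff.contDiffAt.comp x h1.contDiffAt).contDiffWithinAt

open scoped Manifold in
/-- A smooth partition of unity on `U` subordinate to an open cover. The last clause is local
finiteness: near every point only the finitely many functions with index in `I` are nonzero, and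
the corresponding sets of the cover contain the neighbourhood. -/
theorem exists_smooth_partition {ι : Type*} (W : ι → Opens (Rn d)) (hU : U ≤ ⨆ i, W i) :
    ∃ χ : ι → Smooth U, (∀ i, tsupport (χ i).1 ⊆ {x : U | (x : Rn d) ∈ W i}) ∧
      (∀ x, ∑ᶠ i, (χ i).1 x = 1) ∧
      ∀ x : U, ∃ (I : Finset ι) (V : Opens (Rn d)), V ≤ U ∧ (x : Rn d) ∈ V ∧
        (∀ i ∈ I, V ≤ W i) ∧ ∀ i ∉ I, ∀ z : U, (z : Rn d) ∈ V → (χ i).1 z = 0 := by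
  have : LocallyCompactSpace U := U.isOpen.locallyCompactSpace
  obtain ⟨f, hf⟩ := SmoothPartitionOfUnity.exists_isSubordinate (𝓘(ℝ, Rn d)) (s := (univ : Set U))
    isClosed_univ (fun i => {x : U | (x : Rn d) ∈ W i})
    (fun i => (W i).isOpen.preimage continuous_subtype_val)
    (fun x _ => by
      obtain ⟨i, hi⟩ := Opens.mem_iSup.1 (hU x.2)
      exact mem_iUnion.2 ⟨i, hi⟩)
  have hsupp : ∀ i, Function.support (fun x : U => ((f i x : ℝ) : ℂ)) = Function.support (f i) :=
    fun i => by ext x; simp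
  refine ⟨fun i => ⟨fun x => (f i x : ℂ), isSmooth_of_contMDiff (f i).contMDiff⟩, fun i => ?_,
    fun x => ?_, fun x => ?_⟩
  · simpa only [tsupport, hsupp] using hf i
  · have h1 := f.sum_eq_one (mem_univ x)
    have h2 : (Function.support fun i => f i x).Finite := f.locallyFinite.point_finite x
    have := (Complex.ofRealHom.toAddMonoidHom).map_finsum h2
    simp only [RingHom.toAddMonoidHom_eq_coe, AddMonoidHom.coe_coe, h1] at this
    simpa using this.symm
  · obtain ⟨I, n, hn, hI, hs⟩ := f.locallyFinite.exists_finset_nhds_support_subset hf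
      (fun i => (W i).isOpen.preimage continuous_subtype_val) x
    obtain ⟨t, htn, hto, hxt⟩ := mem_nhds_iff.1 hn
    refine ⟨I, ⟨Subtype.val '' t, U.isOpen.isOpenEmbedding_subtypeVal.isOpenMap _ hto⟩, ?_,
      mem_image_of_mem _ hxt, ?_, ?_⟩
    · rintro _ ⟨z, _, rfl⟩
      exact z.2
    · rintro i hi _ ⟨z, hz, rfl⟩
      exact mem_iInter₂.1 (hI (htn hz)) i hi
    · rintro i hi z ⟨z', hz, hzz⟩
      obtain rfl := Subtype.ext hzz
      by_contra hne
      exact hi (hs z' (htn hz) (by simpa using hne))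

theorem finsum_eq_sum_of_zero {ι M : Type*} [AddCommMonoid M] (I : Finset ι) {f : ι → M}
    (h : ∀ i ∉ I, f i = 0) : ∑ᶠ i, f i = ∑ i ∈ I, f i :=
  finsum_eq_sum_of_support_subset f fun i hi => by
    by_contra hn
    exact hi (h i hn)

theorem ext_of_mem (f : U → ℂ) {x : Rn d} (hx : x ∈ U) : ext U f x = f ⟨x, hx⟩ :=
  ext_apply f ⟨x, hx⟩

theorem resG_cls_eq_iff {U' : Opens (Rn d)} (h : V ≤ U) (h' : V ≤ U') {f : E q U} {g : E q U'} :
    resG q h (cls q U f) = resG q h' (cls q U' g) ↔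
      NegligibleEst ⊤ q V
        ((fun ε => res h (f.1.toFun ε)) - fun ε => res h' (g.1.toFun ε)) :=
  cls_eq_cls_iff

/-- Compatible generalized functions glue: representatives are glued by means of a partition of
unity. -/
theorem exists_glue {ι : Type*} (W : ι → Opens (Rn d)) (s : ∀ i, G q (W i))
    (hs : ∀ i j, resG q (inf_le_left : W i ⊓ W j ≤ W i) (s i) =
      resG q (inf_le_right : W i ⊓ W j ≤ W j) (s j)) :
    ∃ t : G q (iSup W), ∀ i, resG q (le_iSup W i) t = s i := by
  choose f hf using fun i => cls_surjective (s i)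
  obtain ⟨χ, -, hχ1, hχ⟩ := exists_smooth_partition (U := iSup W) W le_rfl
  let F : Par → ↥(iSup W) → ℂ :=
    fun ε x => ∑ᶠ i, (χ i).1 x * ext (W i) ((f i).1.toFun ε) x
  -- near every point the glued net is a finite sum of products
  have hloc : ∀ x : (iSup W : Opens (Rn d)), ∃ (I : Finset ι) (V : Opens (Rn d))
      (hV : V ≤ iSup W) (hW : ∀ i ∈ I, V ≤ W i), (x : Rn d) ∈ V ∧
      (∀ i ∉ I, ∀ z : (iSup W : Opens (Rn d)), (z : Rn d) ∈ V → (χ i).1 z = 0) ∧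
      (fun ε => res hV (F ε)) = ∑ i ∈ I.attach, (fun _ => res hV (χ i).1) *
        fun ε => res (hW i i.2) ((f i).1.toFun ε) := by
    intro x
    obtain ⟨I, V, hV, hx, hW, h0⟩ := hχ x
    refine ⟨I, V, hV, hW, hx, h0, ?_⟩
    ext ε z
    have : F ε (Opens.inclusion hV z) = ∑ i ∈ I,
        (χ i).1 (Opens.inclusion hV z) * ext (W i) ((f i).1.toFun ε) z :=
      finsum_eq_sum_of_zero I fun i hi => by rw [h0 i hi _ z.2, zero_mul]
    rw [res, this, ← Finset.sum_attach]
    simp only [Finset.sum_apply, Pi.mul_apply]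
    exact Finset.sum_congr rfl fun i _ => by rw [ext_of_mem _ (hW i i.2 z.2)]; rfl
  have hnet : IsNet (iSup W) F := isNet_of_local fun x => by
    obtain ⟨I, V, hV, hW, hx, -, he⟩ := hloc x
    refine ⟨V, hV, hx, ?_⟩
    rw [he]
    exact IsNet.sum _ fun i _ => (isNet_const ((χ i).2.res hV)).mul ((f i).1.isNet.res (hW i i.2))
  have hmod : ModerateEst ⊤ q (iSup W) F := moderateEst_of_local hnet fun x => by
    obtain ⟨I, V, hV, hW, hx, -, he⟩ := hloc x
    refine ⟨V, hV, hx, ?_⟩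
    rw [he]
    exact ModerateEst.sum _
      (fun i _ => (isNet_const ((χ i).2.res hV)).mul ((f i).1.isNet.res (hW i i.2)))
      fun i _ => ModerateEst.mul (isNet_const ((χ i).2.res hV)) ((f i).1.isNet.res (hW i i.2))
        (moderateEst_const ((χ i).2.res hV)) (ModerateEst.res (hW i i.2) (f i).1.isNet (f i).2)
  refine ⟨cls q _ ⟨Net.of F hnet, hmod⟩, fun j => ?_⟩
  rw [← hf j, resG_cls, cls_eq_cls_iff]
  refine negligibleEst_of_local ((hnet.res (le_iSup W j)).sub (f j).1.isNet) fun x => ?_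
  obtain ⟨I, V, hV, hW, hx, h0, he⟩ := hloc (Opens.inclusion (le_iSup W j) x)
  refine ⟨V ⊓ W j, inf_le_right, ⟨hx, x.2⟩, ?_⟩
  -- on `V ⊓ W j` the glued net differs from `f j` by `∑ i ∈ I, χ i * (f i - f j)`, in which the
  -- differences are negligible by the compatibility of the given sections
  have hn : ∀ i : I, NegligibleEst ⊤ q (V ⊓ W j)
      ((fun ε => res (inf_le_left.trans (hW i i.2)) ((f i).1.toFun ε)) -
        fun ε => res inf_le_right ((f j).1.toFun ε)) := by
    intro i
    have := hs i j
    rw [← hf i, ← hf j, resG_cls_eq_iff] at this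
    have h3 := NegligibleEst.res (le_inf (inf_le_left.trans (hW i i.2)) inf_le_right)
      (((f i).1.isNet.res inf_le_left).sub ((f j).1.isNet.res inf_le_right)) this
    exact h3
  have hsum : (fun ε => res (inf_le_right : V ⊓ W j ≤ W j)
      (((fun ε => res (le_iSup W j) (F ε)) - (f j).1.toFun) ε)) =
      ∑ i ∈ I.attach, (fun _ => res (inf_le_left.trans hV) (χ i).1) *
        ((fun ε => res (inf_le_left.trans (hW i i.2)) ((f i).1.toFun ε)) -
        fun ε => res inf_le_right ((f j).1.toFun ε)) := by
    ext ε z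
    have h1 := congrFun (congrFun he ε) (Opens.inclusion inf_le_left z)
    have h2 : ∑ i ∈ I.attach, (χ i).1 (Opens.inclusion (inf_le_left.trans hV) z) = 1 := by
      rw [Finset.sum_attach I fun i => (χ i).1 (Opens.inclusion (inf_le_left.trans hV) z),
        ← hχ1 (Opens.inclusion (inf_le_left.trans hV) z), finsum_eq_sum_of_zero I]
      exact fun i hi => h0 i hi (Opens.inclusion (inf_le_left.trans hV) z) z.2.1
    simp only [Finset.sum_apply, Pi.mul_apply, Pi.sub_apply, mul_sub, Finset.sum_sub_distrib]
    simp only [Finset.sum_apply, Pi.mul_apply] at h1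
    refine congrArg₂ (· - ·) h1 ?_
    change _ = ∑ i ∈ I.attach, (χ i).1 (Opens.inclusion (inf_le_left.trans hV) z) * _
    rw [← Finset.sum_mul, h2, one_mul]
    rfl
  change NegligibleEst ⊤ q (V ⊓ W j) (fun ε => res (inf_le_right : V ⊓ W j ≤ W j)
      (((fun ε => res (le_iSup W j) (F ε)) - (f j).1.toFun) ε))
  rw [hsum]
  have hc : ∀ i, IsNet (V ⊓ W j) (fun _ => res (inf_le_left.trans hV) (χ i).1) :=
    fun i => isNet_const ((χ i).2.res _)
  have hd : ∀ i : I, IsNet (V ⊓ W j)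
      ((fun ε => res (inf_le_left.trans (hW i i.2)) ((f i).1.toFun ε)) -
        fun ε => res inf_le_right ((f j).1.toFun ε)) :=
    fun i => ((f i).1.isNet.res _).sub ((f j).1.isNet.res _)
  exact NegligibleEst.sum _ (fun i _ => (hc i).mul (hd i)) fun i _ =>
    NegligibleEst.mul_right (hc i) (hd i) (moderateEst_const ((χ i).2.res _)) (hn i)

open CategoryTheory in
theorem isSheaf_GPresheaf (d : ℕ) (q : ℝ≥0∞) : (GPresheaf d q).IsSheaf := by
  rw [TopCat.Presheaf.isSheaf_iff_isSheafUniqueGluing]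
  intro ι W s hs
  obtain ⟨t, ht⟩ := exists_glue (q := q) W s hs
  refine ⟨t, ht, fun t' ht' => eq_of_resG_eq fun x => ?_⟩
  obtain ⟨i, hi⟩ := Opens.mem_iSup.1 x.2
  exact ⟨W i, le_iSup W i, hi, (ht' i).trans (ht i).symm⟩

/-- Multiplication by a global smooth function, as an endomorphism of the sheaf of generalized
functions. -/
def smoothMulHom (q : ℝ≥0∞) (χ : Smooth (⊤ : Opens (Rn d))) : GPresheaf d q ⟶ GPresheaf d q where
  app V := ModuleCat.ofHom
    { toFun := fun x : G q V.unop => smoothToG V.unop (Smooth.res le_top χ) • x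
      map_add' := fun x y => smul_add _ x y
      map_smul' := fun c x => by
        change smoothToG V.unop (Smooth.res le_top χ) • (c • x) =
          c • (smoothToG V.unop (Smooth.res le_top χ) • x)
        rw [genConst_smul_def, genConst_smul_def, smul_smul, smul_smul, mul_comm] }
  naturality {V V'} h := by
    ext x
    exact (resG_smul h.unop.le (smoothToG V.unop (Smooth.res le_top χ)) x).symm

theorem smoothMulHom_app (χ : Smooth (⊤ : Opens (Rn d))) (V : Opens (Rn d)) (x : G q V) :
    (smoothMulHom q χ).app (Opposite.op V) x = smoothToG V (Smooth.res le_top χ) • x := rfl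

/-- The sheaf endomorphisms required by fineness are the multiplications by the functions of a
smooth partition of unity. -/
theorem isFine_GPresheaf (d : ℕ) (q : ℝ≥0∞) : IsFine (GPresheaf d q) := by
  intro ι W hW _
  obtain ⟨χ, hsupp, h1, -⟩ := exists_smooth_partition (d := d) (U := ⊤) W (le_of_eq hW.symm)
  have hzero : ∀ (i : ι) (V : Opens (Rn d)),
      Disjoint (V : Set (Rn d)) (Subtype.val '' tsupport (χ i).1) →
      Smooth.res (le_top : V ≤ ⊤) (χ i) = 0 := by
    intro i V hV
    refine Subtype.ext (funext fun z => ?_)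
    by_contra hne
    exact disjoint_left.1 hV z.2 (mem_image_of_mem Subtype.val
      (subset_tsupport _ (show (Opens.inclusion le_top z) ∈ Function.support (χ i).1 from hne)))
  refine ⟨fun i => smoothMulHom q (χ i), fun i => Subtype.val '' tsupport (χ i).1,
    fun i => ⟨?_, ?_⟩, fun i V hV s => ?_, fun V hV s => ?_⟩
  · exact (isClosed_univ (X := Rn d)).isClosedEmbedding_subtypeVal.isClosedMap _
      (isClosed_tsupport _)
  · rintro _ ⟨x, hx, rfl⟩
    exact hsupp i hx
  · refine (smoothMulHom_app (q := q) (χ i) V s).trans ?_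
    rw [hzero i V hV, map_zero]
    have key : ∀ s : G q V, (0 : G ⊤ V) • s = 0 := zero_smul _
    exact key s
  · have hz : ∀ i ∉ hV.toFinset, Smooth.res (le_top : V ≤ ⊤) (χ i) = 0 := by
      intro i hi
      refine hzero i V (disjoint_left.2 fun z hz hz' => hi ?_)
      obtain ⟨y, hy, rfl⟩ := hz'
      exact hV.mem_toFinset.2 ⟨y, hsupp i hy, hz⟩
    have hsum : ∑ i ∈ hV.toFinset, Smooth.res (le_top : V ≤ ⊤) (χ i) = 1 := by
      refine Subtype.ext (funext fun z => ?_)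
      rw [AddSubmonoidClass.coe_finsetSum, Finset.sum_apply]
      have := h1 (Opens.inclusion le_top z)
      rwa [finsum_eq_sum_of_zero hV.toFinset] at this
      intro i hi
      exact congrFun (congrArg Subtype.val (hz i hi)) z
    have key : ∀ s : G q V, ∑ᶠ i, smoothToG V (Smooth.res (le_top : V ≤ ⊤) (χ i)) • s = s := by
      intro s
      rw [finsum_eq_sum_of_zero hV.toFinset, ← Finset.sum_smul, ← map_sum, hsum, map_one, one_smul]
      intro i hi
      rw [hz i hi, map_zero, zero_smul]
    exact key s

end Sheaf

/-! ### Algebraic structure and smooth functions -/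

section Algebra

variable {U V : Opens (Rn d)} {q : ℝ≥0∞}

theorem isClassOf_cls (f : E q U) : IsClassOf (cls q U f) f.1.toFun :=
  ⟨f.1.isNet, f.2, rfl⟩

theorem isClassOf_smul (f : E ⊤ U) (g : E q U) :
    IsClassOf (cls ⊤ U f • cls q U g) (f.1.toFun * g.1.toFun) :=
  isClassOf_cls (mulE q U f g)

theorem genConst_smul_smul (c : GenConst) (a : G ⊤ U) (x : G q U) : c • (a • x) = (c • a) • x := by
  rw [genConst_smul_def, genConst_smul_def, smul_smul]
  rfl

theorem smul_genConst_smul (c : GenConst) (a : G ⊤ U) (x : G q U) : a • (c • x) = c • (a • x) := by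
  rw [genConst_smul_def, genConst_smul_def, smul_smul, smul_smul, mul_comm]

theorem pderivG_cls (i : Fin d) (f : E q U) : pderivG q U i (cls q U f) = cls q U (pderivE q U i f) :=
  rfl

theorem pderivG_smul (i : Fin d) (a : G ⊤ U) (x : G q U) :
    pderivG q U i (a • x) = pderivG ⊤ U i a • x + a • pderivG q U i x := by
  obtain ⟨f, rfl⟩ := cls_surjective a
  obtain ⟨g, rfl⟩ := cls_surjective x
  simp only [cls_smul_cls, pderivG_cls, ← map_add]
  exact congrArg _ (Subtype.ext (Net.ext fun ε => pderiv_mul (f.1.isNet.1 ε) (g.1.isNet.1 ε) i))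

theorem pderiv_comm {f : U → ℂ} (hf : IsSmooth U f) (i j : Fin d) :
    pderiv U i (pderiv U j f) = pderiv U j (pderiv U i f) := by
  ext x
  have hx : ContDiffAt ℝ ∞ (ext U f) x := hf.contDiffAt (U.isOpen.mem_nhds x.2)
  have hd : DifferentiableAt ℝ (fderiv ℝ (ext U f)) x :=
    (hx.fderiv_right (m := 1) (by norm_cast)).differentiableAt one_ne_zero
  have key : ∀ i j : Fin d, pderiv U i (pderiv U j f) x =
      fderiv ℝ (fderiv ℝ (ext U f)) x (EuclideanSpace.single i 1) (EuclideanSpace.single j 1) := by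
    intro i j
    rw [pderiv_congr (f := pderiv U j f)
      (g := fun x => fderiv ℝ (ext U f) x (EuclideanSpace.single j 1)) fun _ => rfl,
      fderiv_clm_apply hd (differentiableAt_const _)]
    simp
  rw [key, key]
  exact hx.isSymmSndFDerivAt (by simpa using ENat.LEInfty.out) _ _

theorem pderivG_comm (i j : Fin d) (x : G q U) :
    pderivG q U i (pderivG q U j x) = pderivG q U j (pderivG q U i x) := by
  obtain ⟨f, rfl⟩ := cls_surjective x
  exact congrArg (cls q U) (Subtype.ext (Net.ext fun ε => pderiv_comm (f.1.isNet.1 ε) i j))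

theorem pderivG_genConstToG (i : Fin d) (c : GenConst) : pderivG ⊤ U i (genConstToG U c) = 0 := by
  obtain ⟨c, rfl⟩ := Ideal.Quotient.mk_surjective c
  have : pderivE ⊤ U i ⟨Net.of (fun ε _ => c.toFun ε) (isNet_param c.toFun.continuous),
      moderateEst_param U c⟩ = 0 :=
    Subtype.ext (Net.ext fun ε => pderiv_const i _)
  change cls ⊤ U (pderivE ⊤ U i ⟨Net.of (fun ε _ => c.toFun ε) _, _⟩) = 0
  rw [this, map_zero]

theorem pderivG_genConst_smul (i : Fin d) (c : GenConst) (x : G q U) :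
    pderivG q U i (c • x) = c • pderivG q U i x := by
  rw [genConst_smul_def, pderivG_smul, pderivG_genConstToG, zero_smul, zero_add]
  rfl

theorem resG_pderivG (h : V ≤ U) (i : Fin d) (x : G q U) :
    resG q h (pderivG q U i x) = pderivG q V i (resG q h x) := by
  obtain ⟨f, rfl⟩ := cls_surjective x
  exact congrArg (cls q V) (Subtype.ext (Net.ext fun ε => (pderiv_res h i (f.1.toFun ε)).symm))

/-- The intervals `(η/2, η)` have mass bounded from below in the scale-invariant measure `dε/ε`. -/
theorem parMeasure_Ioo_ge {η : ℝ} (h0 : 0 < η) (h1 : η < 1) :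
    2⁻¹ ≤ parMeasure {ε : Par | η / 2 < (ε : ℝ) ∧ (ε : ℝ) < η} := by
  have hemb : MeasurableEmbedding (Subtype.val : Par → ℝ) :=
    MeasurableEmbedding.subtype_coe measurableSet_Ioo
  have hA : MeasurableSet {ε : Par | η / 2 < (ε : ℝ) ∧ (ε : ℝ) < η} :=
    measurable_subtype_coe measurableSet_Ioo
  have himg : Subtype.val '' {ε : Par | η / 2 < (ε : ℝ) ∧ (ε : ℝ) < η} = Ioo (η / 2) η := by
    ext x
    constructor
    · rintro ⟨ε, hε, rfl⟩
      exact hε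
    · intro hx
      exact ⟨⟨x, by linarith [hx.1], by linarith [hx.2]⟩, hx, rfl⟩
  rw [parMeasure, withDensity_apply _ hA]
  calc (2⁻¹ : ℝ≥0∞) = ENNReal.ofReal η⁻¹ * ENNReal.ofReal (η - η / 2) := by
        rw [← ENNReal.ofReal_mul (by positivity)]
        have : η⁻¹ * (η - η / 2) = 2⁻¹ := by field_simp; ring
        rw [this, ENNReal.ofReal_inv_of_pos (by norm_num)]
        simp
    _ = ∫⁻ ε in {ε : Par | η / 2 < (ε : ℝ) ∧ (ε : ℝ) < η}, ENNReal.ofReal η⁻¹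
          ∂(Measure.comap Subtype.val volume) := by
        rw [setLIntegral_const, hemb.comap_apply, himg, Real.volume_Ioo]
    _ ≤ _ := by
        refine setLIntegral_mono' hA fun ε hε => ENNReal.ofReal_le_ofReal ?_
        exact inv_anti₀ ε.2.1 hε.2.le

/-- A function of the parameter which is rapidly decreasing in the mean takes arbitrarily small
values at arbitrarily small parameters. -/
theorem exists_lt_of_parNorm_lt_top (hq : 1 ≤ q) {g : Par → ℝ≥0∞} (h : parNorm q (-1) g < ⊤)
    {c : ℝ} (hc : 0 < c) {δ : ℝ} (hδ : 0 < δ) :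
    ∃ ε : Par, (ε : ℝ) < δ ∧ g ε < ENNReal.ofReal c := by
  by_contra! hcon
  -- if `g ≥ c` on `(η/2, η)`, the norm of `ε⁻¹ g` is at least `c / (2 η)`, for all small `η`
  have key : ∀ η : ℝ, 0 < η → η < 1 → η ≤ δ →
      ENNReal.ofReal (η⁻¹ * c * 2⁻¹) ≤ parNorm q (-1) g := by
    intro η h0 h1 hηδ
    set A : Set Par := {ε : Par | η / 2 < (ε : ℝ) ∧ (ε : ℝ) < η} with hAdef
    have hA : MeasurableSet A := measurable_subtype_coe measurableSet_Ioo
    have hμ : 2⁻¹ ≤ parMeasure A := parMeasure_Ioo_ge h0 h1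
    have h2 : eLpNorm (A.indicator fun _ => η⁻¹ * c) q parMeasure ≤ parNorm q (-1) g := by
      refine eLpNorm_mono_enorm fun ε => ?_
      rw [enorm_eq_self]
      by_cases hε : ε ∈ A
      · rw [indicator_of_mem hε, Real.enorm_of_nonneg (by positivity),
          ENNReal.ofReal_mul (by positivity)]
        refine mul_le_mul' (ENNReal.ofReal_le_ofReal ?_) (hcon ε (hε.2.trans_le hηδ))
        rw [Real.rpow_neg_one]
        exact inv_anti₀ ε.2.1 hε.2.le
      · simp [indicator_of_notMem hε]
    refine le_trans ?_ h2
    rw [eLpNorm_indicator_const' hA (fun h => by simp [h] at hμ)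
      (zero_lt_one.trans_le hq).ne', Real.enorm_of_nonneg (by positivity),
      ENNReal.ofReal_mul (by positivity)]
    gcongr
    have h3 : ENNReal.ofReal 2⁻¹ = 2⁻¹ := by
      rw [ENNReal.ofReal_inv_of_pos (by norm_num)]
      simp
    have hr : 1 / q.toReal ≤ 1 := by
      rcases eq_or_ne q ⊤ with rfl | hqt
      · simp
      · have : 1 ≤ q.toReal := by
          rw [← ENNReal.toReal_one]
          exact ENNReal.toReal_mono hqt hq
        exact (div_le_one (by linarith)).2 this
    calc ENNReal.ofReal 2⁻¹ = (2⁻¹ : ℝ≥0∞) ^ (1 : ℝ) := by rw [h3, ENNReal.rpow_one]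
      _ ≤ (2⁻¹ : ℝ≥0∞) ^ (1 / q.toReal) :=
          ENNReal.rpow_le_rpow_of_exponent_ge (by simp) hr
      _ ≤ _ := ENNReal.rpow_le_rpow hμ (by positivity)
  lift parNorm q (-1) g to NNReal using h.ne with B
  -- this `η` makes the lower bound exceed the norm `B`
  set η : ℝ := min (min (1 / 2) δ) (c / (2 * (B + 1)))
  have hη : 0 < η := by positivity
  have h1 := key η hη ((min_le_left _ _).trans_lt ((min_le_left _ _).trans_lt (by norm_num)))
    ((min_le_left _ _).trans (min_le_right _ _))
  rw [← ENNReal.ofReal_coe_nnreal, ENNReal.ofReal_le_ofReal_iff (by positivity)] at h1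
  have h2 : η ≤ c / (2 * (B + 1)) := min_le_right _ _
  rw [le_div_iff₀ (by positivity)] at h2
  have h3 : (B + 1 : ℝ) ≤ η⁻¹ * c * 2⁻¹ := by
    rw [inv_mul_eq_div, ← div_eq_mul_inv, div_div, le_div_iff₀ (by positivity)]
    linarith
  linarith

/-- A constant net which is negligible takes, at each point, a value smaller in absolute value than
any positive number. -/
theorem injective_smoothToG : Function.Injective (smoothToG U) := by
  rw [injective_iff_map_eq_zero]
  intro f hf
  have hneg : NegligibleEst ⊤ ⊤ U (fun _ => f.1) :=
    (cls_eq_zero_iff (f := constE U f)).1 hf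
  rw [negligibleEst_iff_forall_nhds (isNet_const f.2)] at hneg
  refine Subtype.ext (funext fun x => ?_)
  by_contra hne
  obtain ⟨S, hS, hs⟩ := hneg 0 x (-1)
  obtain ⟨ε, -, hε⟩ := exists_lt_of_parNorm_lt_top (q := ⊤) (g := fun _ => supDeriv U 0 S f.1) (δ := 1)
    le_top hs (norm_pos_iff.2 hne) one_pos
  rw [ofReal_norm] at hε
  have h1 : ‖iterPderiv U [] f.1 x‖ₑ ≤ supDeriv U 0 S f.1 :=
    le_supDeriv le_rfl (mem_of_mem_nhds hS)
  exact not_le_of_gt hε h1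

theorem isClassOf_smoothToG_smul (f : Smooth U) (g : E q U) :
    IsClassOf (smoothToG U f • cls q U g) (fun ε => f.1 * g.1.toFun ε) :=
  isClassOf_smul (constE U f) g

theorem IsClassOf.resG {x : G q U} {f : Par → U → ℂ} (hx : IsClassOf x f) (h : V ≤ U) :
    IsClassOf (resG q h x) (fun ε => res h (f ε)) := by
  obtain ⟨hf, hm, rfl⟩ := hx
  exact ⟨hf.res h, ModerateEst.res h hf hm, rfl⟩

theorem IsClassOf.add {x y : G q U} {f g : Par → U → ℂ} (hx : IsClassOf x f) (hy : IsClassOf y g) :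
    IsClassOf (x + y) (f + g) := by
  obtain ⟨hf, hm, rfl⟩ := hx
  obtain ⟨hg, hm', rfl⟩ := hy
  exact ⟨hf.add hg, hm.add hf hg hm', (map_add _ _ _).symm⟩

theorem IsClassOf.smul {x : G q U} {f : Par → U → ℂ} (hx : IsClassOf x f) (c : ℂ) :
    IsClassOf (c • x) (c • f) := by
  obtain ⟨hf, hm, rfl⟩ := hx
  exact ⟨(c • Net.of f hf).isNet, (c • (⟨Net.of f hf, hm⟩ : E q U)).2, (map_smul _ _ _).symm⟩

theorem IsClassOf.unique {x y : G q U} {f : Par → U → ℂ} (hx : IsClassOf x f) (hy : IsClassOf y f) :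
    x = y := by
  obtain ⟨hf, hm, rfl⟩ := hx
  obtain ⟨hf', hm', rfl⟩ := hy
  rfl

theorem IsClassOf.eq_iff {x y : G q U} {f g : Par → U → ℂ} (hx : IsClassOf x f)
    (hy : IsClassOf y g) : x = y ↔ NegligibleEst ⊤ q U (f - g) := by
  obtain ⟨hf, hm, rfl⟩ := hx
  obtain ⟨hg, hm', rfl⟩ := hy
  exact cls_eq_cls_iff

/-- A net determines its class also through any net that differs from it by a negligible one. -/
theorem IsClassOf.of_negligible {x : G q U} {f g : Par → U → ℂ} (hx : IsClassOf x f)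
    (hg : IsNet U g) (h : NegligibleEst ⊤ q U (f - g)) : IsClassOf x g := by
  obtain ⟨hf, hm, rfl⟩ := hx
  have h' : (-(Net.of f hf - Net.of g hg)) ∈ N q U := (N q U).neg_mem h
  have hneg : NegligibleEst ⊤ q U (g - f) := by rwa [neg_sub] at h'
  have hgm : ModerateEst ⊤ q U g := by
    have := ModerateEst.add (hg.sub hf) hf (fun k W hW => ⟨0, hneg k W hW 0⟩) hm
    rwa [sub_add_cancel] at this
  exact ⟨hg, hgm, cls_eq_cls_iff.2 h⟩

end Algebra

/-! ### Functions on the whole space and cutoffs -/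

section Global

variable {U V : Opens (Rn d)}

/-- The partial derivative of a function on the whole space. -/
def gderiv (i : Fin d) (g : Rn d → ℂ) : Rn d → ℂ :=
  fun x => fderiv ℝ g x (EuclideanSpace.single i 1)

/-- Iterated partial derivatives of a function on the whole space. -/
def iterGderiv : List (Fin d) → (Rn d → ℂ) → (Rn d → ℂ)
  | [], g => g
  | i :: l, g => iterGderiv l (gderiv i g)

theorem contDiff_gderiv {g : Rn d → ℂ} (hg : ContDiff ℝ ∞ g) (i : Fin d) :
    ContDiff ℝ ∞ (gderiv i g) :=
  (hg.fderiv_right (m := ∞) (by simp)).clm_apply contDiff_const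

theorem contDiff_iterGderiv {g : Rn d → ℂ} (hg : ContDiff ℝ ∞ g) (l : List (Fin d)) :
    ContDiff ℝ ∞ (iterGderiv l g) := by
  induction l generalizing g with
  | nil => exact hg
  | cons i l ih => exact ih (contDiff_gderiv hg i)

theorem tsupport_gderiv_subset (g : Rn d → ℂ) (i : Fin d) : tsupport (gderiv i g) ⊆ tsupport g :=
  tsupport_fderiv_apply_subset ℝ _

theorem tsupport_iterGderiv_subset (g : Rn d → ℂ) (l : List (Fin d)) :
    tsupport (iterGderiv l g) ⊆ tsupport g := by
  induction l generalizing g with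
  | nil => exact subset_rfl
  | cons i l ih => exact (ih _).trans (tsupport_gderiv_subset g i)

theorem hasCompactSupport_gderiv {g : Rn d → ℂ} (hg : HasCompactSupport g) (i : Fin d) :
    HasCompactSupport (gderiv i g) :=
  hg.of_isClosed_subset (isClosed_tsupport _) (tsupport_gderiv_subset g i)

theorem iterPderiv_eq_iterGderiv {f : U → ℂ} {g : Rn d → ℂ} (h : ∀ x : U, f x = g x)
    (l : List (Fin d)) (x : U) : iterPderiv U l f x = iterGderiv l g x := by
  induction l generalizing f g with
  | nil => exact h x
  | cons i l ih => exact ih (fun y => pderiv_congr h i y)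

/-- The restriction to `U` of a function on the whole space. -/
def ofGlobal (U : Opens (Rn d)) (g : Rn d → ℂ) : U → ℂ := fun x => g x

theorem isSmooth_ofGlobal {g : Rn d → ℂ} (hg : ContDiff ℝ ∞ g) : IsSmooth U (ofGlobal U g) :=
  (isSmooth_iff_of_eqOn fun _ => rfl).2 hg.contDiffOn

theorem iterPderiv_ofGlobal (g : Rn d → ℂ) (l : List (Fin d)) :
    iterPderiv U l (ofGlobal U g) = ofGlobal U (iterGderiv l g) :=
  funext fun x => iterPderiv_eq_iterGderiv (fun _ => rfl) l x

theorem iterPderiv_append (l m : List (Fin d)) (f : U → ℂ) :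
    iterPderiv U (l ++ m) f = iterPderiv U m (iterPderiv U l f) := by
  induction l generalizing f with
  | nil => rfl
  | cons i l ih => exact ih _

/-- The product of a smooth function with support in `U` and a smooth function on `U`, extended by
zero, is smooth on the whole space. -/
theorem contDiff_mul_ext {χ : Rn d → ℂ} (hχ : ContDiff ℝ ∞ χ) (hsupp : tsupport χ ⊆ U)
    {f : U → ℂ} (hf : IsSmooth U f) : ContDiff ℝ ∞ (fun x => χ x * ext U f x) := by
  rw [contDiff_iff_contDiffAt]
  intro x
  by_cases hx : x ∈ tsupport χ
  · exact hχ.contDiffAt.mul (hf.contDiffAt (U.isOpen.mem_nhds (hsupp hx)))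
  · have : (fun x => χ x * ext U f x) =ᶠ[𝓝 x] fun _ => 0 := by
      filter_upwards [(isClosed_tsupport χ).isOpen_compl.mem_nhds hx] with y hy
      rw [image_eq_zero_of_notMem_tsupport hy, zero_mul]
    exact contDiffAt_const.congr_of_eventuallyEq this

open scoped Manifold in
/-- A smooth cutoff function: it is `1` near the compact set `K` and supported in `O`. -/
theorem exists_cutoff {K O : Set (Rn d)} (hK : IsCompact K) (hO : IsOpen O) (hKO : K ⊆ O) :
    ∃ χ : Rn d → ℂ, ContDiff ℝ ∞ χ ∧ HasCompactSupport χ ∧ tsupport χ ⊆ O ∧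
      ∀ᶠ x in 𝓝ˢ K, χ x = 1 := by
  obtain ⟨t, ht, hKt, htO⟩ := exists_compact_between hK hO hKO
  obtain ⟨f, h1, h0, -⟩ := exists_contMDiffMap_one_nhds_of_subset_interior (n := ⊤) (𝓘(ℝ, Rn d))
    hK.isClosed hKt
  have hsupp : tsupport (fun x => (f x : ℂ)) ⊆ t := by
    refine closure_minimal (fun x hx => ?_) ht.isClosed
    by_contra hxt
    exact hx (by simp [h0 x hxt])
  refine ⟨fun x => (f x : ℂ), Complex.ofRealCLM.contDiff.comp f.contMDiff.contDiff,
    ht.of_isClosed_subset (isClosed_tsupport _) hsupp, hsupp.trans htO, ?_⟩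
  filter_upwards [h1] with x hx
  simp [hx]

end Global

/-! ### A Sobolev inequality and independence of the exponent -/

section Sobolev

variable {U V : Opens (Rn d)} {q : ℝ≥0∞}

theorem toLp_update (x : Fin d → ℝ) (i : Fin d) (t : ℝ) :
    (WithLp.toLp 2 (Function.update x i t) : Rn d) =
      WithLp.toLp 2 (Function.update x i 0) + t • EuclideanSpace.single i 1 := by
  ext j
  by_cases h : j = i
  · subst h
    simp
  · simp [h]

/-- The fundamental theorem of calculus along a line parallel to the `i`-th coordinate axis. -/
theorem enorm_le_lintegral_gderiv {g : Rn d → ℂ} (hg : ContDiff ℝ ∞ g) (hc : HasCompactSupport g)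
    (x : Fin d → ℝ) (i : Fin d) :
    ‖g (WithLp.toLp 2 x)‖ₑ ≤ ∫⁻ t, ‖gderiv i g (WithLp.toLp 2 (Function.update x i t))‖ₑ := by
  set h : ℝ → ℂ := fun t => g (WithLp.toLp 2 (Function.update x i t)) with hh
  have hline : ∀ t, HasDerivAt (fun t : ℝ => (WithLp.toLp 2 (Function.update x i t) : Rn d))
      (EuclideanSpace.single i 1) t := by
    intro t
    rw [funext (toLp_update x i)]
    simpa using ((hasDerivAt_id t).smul_const (EuclideanSpace.single i (1 : ℝ))).const_add
      (WithLp.toLp 2 (Function.update x i 0) : Rn d)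
  have hder : ∀ t, HasDerivAt h (gderiv i g (WithLp.toLp 2 (Function.update x i t))) t := fun t =>
    ((hg.differentiable (by simp)).differentiableAt.hasFDerivAt).comp_hasDerivAt t (hline t)
  have hsm : ContDiff ℝ 1 h := by
    refine (hg.of_le (by simp)).comp ?_
    rw [funext (toLp_update x i)]
    fun_prop
  have hcomp : HasCompactSupport h :=
    hc.comp_isClosedEmbedding (((PiLp.continuousLinearEquiv 2 ℝ
      (fun _ : Fin d => ℝ)).symm.toHomeomorph.isClosedEmbedding).comp
        (isClosedEmbedding_update x i))
  have h1 := HasCompactSupport.enorm_le_lintegral_Ici_deriv hsm hcomp (x i)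
  have h2 : h (x i) = g (WithLp.toLp 2 x) := by simp [hh]
  rw [h2] at h1
  refine h1.trans ((lintegral_mono_set (subset_univ _)).trans ?_)
  rw [Measure.restrict_univ]
  exact lintegral_mono fun t => by rw [(hder t).deriv]

/-- Integrating successively along the coordinate directions in `l` bounds a function by the
integral of its mixed derivative. -/
theorem enorm_le_lmarginal (l : List (Fin d)) (hl : l.Nodup) {g : Rn d → ℂ} (hg : ContDiff ℝ ∞ g)
    (hc : HasCompactSupport g) (x : Fin d → ℝ) :
    ‖g (WithLp.toLp 2 x)‖ₑ ≤ lmarginal (fun _ => volume) l.toFinset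
      (fun y => ‖iterGderiv l g (WithLp.toLp 2 y)‖ₑ) x := by
  induction l generalizing g x with
  | nil => simp [iterGderiv]
  | cons i l ih =>
    have hi : i ∉ l.toFinset := by simpa using (List.nodup_cons.1 hl).1
    have hmeas : Measurable fun y : Fin d → ℝ => ‖iterGderiv (i :: l) g (WithLp.toLp 2 y)‖ₑ := by
      have := (contDiff_iterGderiv hg (i :: l)).continuous
      have h2 : Continuous fun y : Fin d → ℝ => (WithLp.toLp 2 y : Rn d) :=
        PiLp.continuous_toLp 2 _
      exact (this.comp h2).enorm.measurable
    rw [List.toFinset_cons, lmarginal_insert _ hmeas hi]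
    refine (enorm_le_lintegral_gderiv hg hc x i).trans (lintegral_mono fun t => ?_)
    exact ih (List.nodup_cons.1 hl).2 (contDiff_gderiv hg i) (hasCompactSupport_gderiv hc i) _

/-- The mixed derivative `∂₁ ⋯ ∂_d g` controls the values of a compactly supported function `g`. -/
theorem enorm_le_lintegral_iterGderiv {g : Rn d → ℂ} (hg : ContDiff ℝ ∞ g)
    (hc : HasCompactSupport g) (x : Rn d) :
    ‖g x‖ₑ ≤ ∫⁻ y, ‖iterGderiv (List.finRange d) g y‖ₑ := by
  have h := enorm_le_lmarginal (List.finRange d) (List.nodup_finRange d) hg hc (WithLp.ofLp x)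
  have hu : (List.finRange d).toFinset = Finset.univ := by
    ext; simp
  rw [hu, lmarginal_univ] at h
  refine h.trans (le_of_eq ?_)
  exact (PiLp.volume_preserving_toLp (Fin d)).lintegral_comp
    (contDiff_iterGderiv hg _).continuous.enorm.measurable

/-- The Leibniz rule for Sobolev norms, with one of the factors measured in the supremum norm. -/
theorem sobolevNorm_mul_le_of_exponent {p : ℝ≥0∞} (hp : 1 ≤ p) {f g : U → ℂ} (hf : IsSmooth U f)
    (hg : IsSmooth U g) (k : ℕ) (W : Opens U) :
    sobolevNorm U k p W (f * g) ≤
      2 ^ k * (sobolevNorm U k ⊤ W f * sobolevNorm U k p W g) := by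
  have key : ∀ (l : List (Fin d)) (f g : U → ℂ), IsSmooth U f → IsSmooth U g →
      eLpNorm (iterPderiv U l (f * g)) p
        ((Measure.comap Subtype.val volume : Measure U).restrict W) ≤
      2 ^ l.length * (sobolevNorm U l.length ⊤ W f * sobolevNorm U l.length p W g) := by
    intro l
    induction l with
    | nil =>
      intro f g hf hg
      have h1 := eLpNorm_smul_le_mul_eLpNorm (p := ⊤) (q := p) (r := p)
        (μ := (Measure.comap Subtype.val volume : Measure U).restrict W)
        hg.continuous.aestronglyMeasurable hf.continuous.aestronglyMeasurable
      simp only [List.length_nil, pow_zero, one_mul]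
      refine h1.trans ?_
      gcongr
      · exact le_sobolevNorm (l := []) le_rfl
      · exact le_sobolevNorm (l := []) le_rfl
    | cons i l ih =>
      intro f g hf hg
      simp only [iterPderiv]
      rw [pderiv_mul hf hg, iterPderiv_add l ((hf.pderiv i).mul hg) (hf.mul (hg.pderiv i))]
      refine (eLpNorm_add_le
        (((hf.pderiv i).mul hg).iterPderiv l).continuous.aestronglyMeasurable
        ((hf.mul (hg.pderiv i)).iterPderiv l).continuous.aestronglyMeasurable hp).trans ?_
      refine (add_le_add (ih _ _ (hf.pderiv i) hg) (ih _ _ hf (hg.pderiv i))).trans ?_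
      rw [List.length_cons, pow_succ, mul_assoc, two_mul, ← mul_add]
      gcongr
      · exact sobolevNorm_pderiv_le f i _ _ _
      · exact sobolevNorm_mono (Nat.le_succ _)
      · exact sobolevNorm_mono (Nat.le_succ _)
      · exact sobolevNorm_pderiv_le g i _ _ _
  refine iSup₂_le fun l hl => (key l f g hf hg).trans ?_
  gcongr
  · norm_num
  · exact sobolevNorm_mono hl
  · exact sobolevNorm_mono hl

theorem measure_lt_top_of_isCompact_closure {W : Opens U} (hW : IsCompact (closure (W : Set U))) :
    (Measure.comap Subtype.val volume : Measure U) W < ⊤ := by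
  have hemb : MeasurableEmbedding (Subtype.val : U → Rn d) :=
    MeasurableEmbedding.subtype_coe U.isOpen.measurableSet
  rw [hemb.comap_apply]
  exact (measure_mono (image_mono subset_closure)).trans_lt
    (hW.image continuous_subtype_val).measure_lt_top

/-- On relatively compact sets, Sobolev norms of lower exponent are weaker. -/
theorem exists_sobolevNorm_le_of_exponent_le {p r : ℝ≥0∞} (hp : 1 ≤ p) (hpr : p ≤ r) {W : Opens U}
    (hW : IsCompact (closure (W : Set U))) :
    ∃ C : NNReal, ∀ (k : ℕ) (f : U → ℂ), IsSmooth U f →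
      sobolevNorm U k p W f ≤ C * sobolevNorm U k r W f := by
  set M := (Measure.comap Subtype.val volume : Measure U) W ^ (1 / p.toReal - 1 / r.toReal) with hM
  have hexp : 0 ≤ 1 / p.toReal - 1 / r.toReal := by
    rcases eq_or_ne r ⊤ with rfl | hr
    · simp
    · have hp0 : 0 < p.toReal := ENNReal.toReal_pos (zero_lt_one.trans_le hp).ne'
        (ne_top_of_le_ne_top hr hpr)
      exact sub_nonneg.2 (one_div_le_one_div_of_le hp0 (ENNReal.toReal_mono hr hpr))
  have hMtop : M ≠ ⊤ :=
    (ENNReal.rpow_lt_top_of_nonneg hexp (measure_lt_top_of_isCompact_closure hW).ne).ne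
  lift M to NNReal using hMtop with C
  refine ⟨C, fun k f hf => iSup₂_le fun l hl => ?_⟩
  refine (eLpNorm_le_eLpNorm_mul_rpow_measure_univ hpr
    (hf.iterPderiv l).continuous.aestronglyMeasurable).trans ?_
  rw [Measure.restrict_apply_univ, ← hM, mul_comm]
  gcongr
  exact le_sobolevNorm hl

theorem sobolevNorm_iterPderiv_le (f : U → ℂ) (l : List (Fin d)) (k m : ℕ) (h : l.length ≤ m)
    (p : ℝ≥0∞) (W : Opens U) :
    sobolevNorm U k p W (iterPderiv U l f) ≤ sobolevNorm U (m + k) p W f :=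
  iSup₂_le fun l' hl' => by
    rw [← iterPderiv_append]
    exact le_sobolevNorm (by simp only [List.length_append]; omega)

/-- Sobolev inequality: derivatives of order at most `k` are bounded on `W` by the derivatives of
order at most `k + d` in `L^p` on a neighbourhood of the closure of `W`. -/
theorem exists_sobolevNorm_top_le {p : ℝ≥0∞} (hp : 1 ≤ p) {W W' : Opens U}
    (hW : IsCompact (closure (W : Set U))) (hWW' : closure (W : Set U) ⊆ W')
    (hW' : IsCompact (closure (W' : Set U))) (k : ℕ) :
    ∃ C : NNReal, ∀ f : U → ℂ, IsSmooth U f →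
      sobolevNorm U k ⊤ W f ≤ C * sobolevNorm U (k + d) p W' f := by
  have hemb : MeasurableEmbedding (Subtype.val : U → Rn d) :=
    MeasurableEmbedding.subtype_coe U.isOpen.measurableSet
  obtain ⟨χ, hχ, hχc, hχs, hχ1⟩ := exists_cutoff (hW.image continuous_subtype_val)
    (U.isOpen.isOpenEmbedding_subtypeVal.isOpenMap _ W'.isOpen) (image_mono hWW')
  have hχU : tsupport χ ⊆ U := hχs.trans (by rintro _ ⟨x, -, rfl⟩; exact x.2)
  obtain ⟨C₁, hC₁⟩ := exists_sobolevNorm_le_of_exponent_le (r := p) le_rfl hp hW'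
  have hsm : IsSmooth U (ofGlobal U χ) := isSmooth_ofGlobal hχ
  have hfin := sobolevNorm_ne_top hsm d hW'
  set N := sobolevNorm U d ⊤ W' (ofGlobal U χ)
  lift N to NNReal using hfin with C₂ hC₂
  refine ⟨C₁ * (2 ^ d * C₂), fun f hf => iSup₂_le fun l hl => ?_⟩
  have hfl := hf.iterPderiv l
  rw [eLpNorm_top_eq hfl.continuous]
  refine iSup_le fun x => ?_
  -- the inequality for compactly supported functions applies to the localized derivative
  set g : Rn d → ℂ := fun y => χ y * ext U (iterPderiv U l f) y with hg
  have hgs : ContDiff ℝ ∞ g := contDiff_mul_ext hχ hχU hfl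
  have hgsupp : tsupport g ⊆ tsupport χ := tsupport_mul_subset_left
  have hgc : HasCompactSupport g := hχc.of_isClosed_subset (isClosed_tsupport _) hgsupp
  have hgx : g x = iterPderiv U l f x := by
    have := hχ1.self_of_nhdsSet _ (mem_image_of_mem Subtype.val (subset_closure x.2))
    simp only [hg, this, one_mul, ext_apply]
  have hgU : ∀ y : U, (ofGlobal U χ * iterPderiv U l f) y = g y := fun y => by
    simp [hg, ext_apply, ofGlobal]
  calc ‖iterPderiv U l f x‖ₑ ≤ ∫⁻ y, ‖iterGderiv (List.finRange d) g y‖ₑ := by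
        rw [← hgx]
        exact enorm_le_lintegral_iterGderiv hgs hgc x
    _ = ∫⁻ y in Subtype.val '' (W' : Set U), ‖iterGderiv (List.finRange d) g y‖ₑ := by
        refine (setLIntegral_eq_of_support_subset fun y hy => ?_).symm
        have : y ∈ tsupport (iterGderiv (List.finRange d) g) :=
          subset_tsupport _ (by simpa using hy)
        exact hχs (hgsupp (tsupport_iterGderiv_subset _ _ this))
    _ = eLpNorm (iterPderiv U (List.finRange d) (ofGlobal U χ * iterPderiv U l f)) 1
          ((Measure.comap Subtype.val volume : Measure U).restrict W') := by
        rw [eLpNorm_one_eq_lintegral_enorm]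
        have h1 : ((Measure.comap Subtype.val volume : Measure U).restrict W') =
            Measure.comap Subtype.val
              ((volume : Measure (Rn d)).restrict (Subtype.val '' (W' : Set U))) := by
          rw [hemb.comap_restrict, preimage_image_eq _ Subtype.val_injective]
        simp only [iterPderiv_eq_iterGderiv hgU]
        rw [h1, ← hemb.lintegral_map (fun y => ‖iterGderiv (List.finRange d) g y‖ₑ),
          hemb.map_comap, Measure.restrict_restrict hemb.measurableSet_range,
          inter_eq_right.2 (image_subset_range _ _)]
    _ ≤ sobolevNorm U d 1 W' (ofGlobal U χ * iterPderiv U l f) :=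
        le_sobolevNorm (by simp)
    _ ≤ C₁ * sobolevNorm U d p W' (ofGlobal U χ * iterPderiv U l f) := hC₁ d _ (hsm.mul hfl)
    _ ≤ C₁ * (2 ^ d * (C₂ * sobolevNorm U d p W' (iterPderiv U l f))) := by
        gcongr
        rw [hC₂]
        exact sobolevNorm_mul_le_of_exponent hp hsm hfl d W'
    _ ≤ C₁ * (2 ^ d * (C₂ * sobolevNorm U (k + d) p W' f)) := by
        gcongr
        exact sobolevNorm_iterPderiv_le f l d k hl p W'
    _ = _ := by push_cast; ring

/-- No measurability is required, since the norm is monotone. -/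
theorem parNorm_const_mul_lt_top {s : ℝ} {g h : Par → ℝ≥0∞} {C : NNReal}
    (hgh : ∀ ε, g ε ≤ C * h ε) (hh : parNorm q s h < ⊤) : parNorm q s g < ⊤ := by
  have := parNorm_mul_lt_top C (parNorm_const_lt_top 1 ENNReal.one_ne_top) hh
  rw [zero_add] at this
  exact (parNorm_mono q le_rfl fun ε => by simpa using hgh ε).trans_lt this

theorem exists_opens_between {W : Opens U} (hW : IsCompact (closure (W : Set U))) :
    ∃ W' : Opens U, closure (W : Set U) ⊆ W' ∧ IsCompact (closure (W' : Set U)) := by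
  have : LocallyCompactSpace U := U.isOpen.locallyCompactSpace
  obtain ⟨W', h1, h2, h3⟩ := exists_isOpen_superset_and_isCompact_closure hW
  exact ⟨⟨W', h1⟩, h2, h3⟩

/-- Passing from `∞` to `p` loses a constant, passing from `p` to `∞` loses a constant, `d`
derivatives and a neighbourhood; the estimates allow for all of these. -/
theorem moderateEst_iff_of_exponent {p : ℝ≥0∞} (hp : 1 ≤ p) {f : Par → U → ℂ} (hf : IsNet U f) :
    ModerateEst ⊤ q U f ↔ ModerateEst p q U f := by
  constructor
  · intro h k W hW
    obtain ⟨s, hs⟩ := h k W hW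
    obtain ⟨C, hC⟩ := exists_sobolevNorm_le_of_exponent_le (r := ⊤) hp le_top hW
    exact ⟨s, parNorm_const_mul_lt_top (fun ε => hC k _ (hf.1 ε)) hs⟩
  · intro h k W hW
    obtain ⟨W', hWW', hW'⟩ := exists_opens_between hW
    obtain ⟨s, hs⟩ := h (k + d) W' hW'
    obtain ⟨C, hC⟩ := exists_sobolevNorm_top_le hp hW hWW' hW' k
    exact ⟨s, parNorm_const_mul_lt_top (fun ε => hC _ (hf.1 ε)) hs⟩

theorem negligibleEst_iff_of_exponent {p : ℝ≥0∞} (hp : 1 ≤ p) {f : Par → U → ℂ}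
    (hf : IsNet U f) : NegligibleEst ⊤ q U f ↔ NegligibleEst p q U f := by
  constructor
  · intro h k W hW s
    obtain ⟨C, hC⟩ := exists_sobolevNorm_le_of_exponent_le (r := ⊤) hp le_top hW
    exact parNorm_const_mul_lt_top (fun ε => hC k _ (hf.1 ε)) (h k W hW s)
  · intro h k W hW s
    obtain ⟨W', hWW', hW'⟩ := exists_opens_between hW
    obtain ⟨C, hC⟩ := exists_sobolevNorm_top_le hp hW hWW' hW' k
    exact parNorm_const_mul_lt_top (fun ε => hC _ (hf.1 ε)) (h (k + d) W' hW' s)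

end Sobolev

/-! ### The local structure of distributions -/

section Structure

variable {U V : Opens (Rn d)} {q : ℝ≥0∞}

theorem fderiv_eq_sum_gderiv {g : Rn d → ℂ} :
    fderiv ℝ g = fun y => ∑ i : Fin d,
      (ContinuousLinearMap.smulRightL ℝ (Rn d) ℂ (EuclideanSpace.proj i)) (gderiv i g y) := by
  ext y v
  have hv : v = ∑ i : Fin d, v i • EuclideanSpace.single i (1 : ℝ) := by
    ext j
    simp [Finset.sum_apply, Pi.single_apply]
  simp only [_root_.sum_apply]
  conv_lhs => rw [hv, map_sum]
  refine Finset.sum_congr rfl fun i _ => ?_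
  simp [gderiv]

/-- The norm of an iterated Fréchet derivative is controlled by iterated partial derivatives. -/
theorem exists_norm_iteratedFDeriv_le (n : ℕ) : ∃ C : ℝ, 0 ≤ C ∧
    ∀ (g : Rn d → ℂ) (_ : ContDiff ℝ ∞ g) (x : Rn d) (B : ℝ),
      (∀ l : List (Fin d), l.length = n → ‖iterGderiv l g x‖ ≤ B) →
        ‖iteratedFDeriv ℝ n g x‖ ≤ C * B := by
  induction n with
  | zero => exact ⟨1, zero_le_one, fun g _ x B h => by simpa using! h [] rfl⟩
  | succ n ih =>
    obtain ⟨C, hC0, hC⟩ := ih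
    refine ⟨∑ i : Fin d, ‖ContinuousLinearMap.smulRightL ℝ (Rn d) ℂ (EuclideanSpace.proj i)‖ * C,
      by positivity, fun g hg x B h => ?_⟩
    have hsm : ∀ i : Fin d, ContDiff ℝ n (gderiv i g) := fun i =>
      (contDiff_gderiv hg i).of_le (by exact_mod_cast le_top)
    have hL : ∀ i ∈ Finset.univ, ContDiffAt ℝ n (fun y =>
        ContinuousLinearMap.smulRightL ℝ (Rn d) ℂ (EuclideanSpace.proj i) (gderiv i g y)) x :=
      fun i _ => ((ContinuousLinearMap.contDiff _).comp (hsm i)).contDiffAt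
    rw [← norm_iteratedFDeriv_fderiv, fderiv_eq_sum_gderiv, iteratedFDeriv_fun_sum_apply hL,
      Finset.sum_mul]
    refine (norm_sum_le _ _).trans (Finset.sum_le_sum fun i _ => ?_)
    refine (ContinuousLinearMap.norm_iteratedFDeriv_comp_left _ (hsm i).contDiffAt le_rfl).trans ?_
    rw [mul_assoc]
    refine mul_le_mul_of_nonneg_left (hC _ (contDiff_gderiv hg i) x B fun l hl => ?_) (norm_nonneg _)
    exact h (i :: l) (by simp [hl])

/-- A distribution is of finite order on compact sets, by continuity on the Fréchet space of test
functions supported in a fixed compact set. -/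
theorem exists_norm_le_of_tsupport_subset (T : Distr U) {K : Set (Rn d)} (hK : IsCompact K)
    (hKU : K ⊆ U) : ∃ (m : ℕ) (C : ℝ), 0 ≤ C ∧ ∀ ρ : 𝓓(U, ℂ), tsupport ρ ⊆ K → ∀ B : ℝ, 0 ≤ B →
      (∀ l : List (Fin d), l.length ≤ m → ∀ x ∈ K, ‖iterGderiv l ρ x‖ ≤ B) → ‖T ρ‖ ≤ C * B := by
  let K' : Compacts (Rn d) := ⟨K, hK⟩
  let L : 𝓓_{K'}(Rn d, ℂ) →L[ℂ] ℂ := T ∘L TestFunction.ofSupportedInCLM ℂ hKU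
  obtain ⟨s, C, -, hC⟩ := Seminorm.bound_of_continuous
    (ContDiffMapSupportedIn.withSeminorms ℂ (Rn d) ℂ ⊤ K')
    ((normSeminorm ℂ ℂ).comp L.toLinearMap) (by exact continuous_norm.comp L.continuous)
  choose D hD0 hD using fun n => exists_norm_iteratedFDeriv_le (d := d) n
  refine ⟨s.sup id, C * ∑ i ∈ s, D i, mul_nonneg C.2 (Finset.sum_nonneg fun i _ => hD0 i), ?_⟩
  intro ρ hρ B hB h
  let f : 𝓓_{K'}(Rn d, ℂ) := .of_support_subset ρ.contDiff ((subset_tsupport _).trans hρ)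
  have hf : L f = T ρ := congrArg T (TestFunction.ext fun _ => rfl)
  have h1 : ‖L f‖ ≤ C * (s.sup (ContDiffMapSupportedIn.seminorm ℂ (Rn d) ℂ ⊤ K')) f := by
    simpa using! hC f
  rw [← hf, mul_assoc]
  refine h1.trans (mul_le_mul_of_nonneg_left ?_ C.2)
  have hDB : ∀ i, 0 ≤ D i * B := fun i => mul_nonneg (hD0 i) hB
  rw [Finset.sum_mul]
  refine Seminorm.finset_sup_apply_le (Finset.sum_nonneg fun i _ => hDB i) fun i hi => ?_
  refine le_trans ?_ (Finset.single_le_sum (fun i _ => hDB i) hi)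
  rw [ContDiffMapSupportedIn.seminorm_top_le_iff ℂ (hDB i)]
  intro x hx
  exact hD i ρ ρ.contDiff x B fun l hl => h l (hl.le.trans (Finset.le_sup (f := id) hi)) x hx

/-- The product of a test function and a smooth function. -/
def mulTest (χ : 𝓓(U, ℂ)) (ψ : Smooth U) : 𝓓(U, ℂ) where
  toFun y := χ y * ext U ψ.1 y
  contDiff' := contDiff_mul_ext χ.contDiff χ.tsupport_subset ψ.2
  hasCompactSupport' := χ.hasCompactSupport.mul_right
  tsupport_subset' := tsupport_mul_subset_left.trans χ.tsupport_subset

/-- The finite order bound of a distribution, in terms of square integrals: the Sobolev inequality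
allows for replacing suprema by `L²` norms, at the price of `d` more derivatives. -/
theorem exists_norm_le_sobolevNorm (T : Distr U) (χ : 𝓓(U, ℂ)) {W' : Opens U}
    (hW' : IsCompact (closure (W' : Set U))) (hχ : tsupport χ ⊆ Subtype.val '' (W' : Set U)) :
    ∃ (k : ℕ) (C : NNReal), ∀ ψ : Smooth U,
      ‖T (mulTest χ ψ)‖ₑ ≤ C * sobolevNorm U k 2 W' ψ.1 := by
  have : LocallyCompactSpace U := U.isOpen.locallyCompactSpace
  have hK : IsCompact (Subtype.val ⁻¹' tsupport χ : Set U) := by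
    refine (Topology.IsInducing.subtypeVal.isCompact_preimage_iff ?_).2 χ.hasCompactSupport
    rw [Subtype.range_coe]
    exact χ.tsupport_subset
  have hKW : (Subtype.val ⁻¹' tsupport χ : Set U) ⊆ W' := by
    intro x hx
    obtain ⟨y, hy, hyx⟩ := hχ hx
    rwa [← Subtype.ext hyx]
  obtain ⟨W, hWo, hKW, hWW', hWc⟩ := exists_open_between_and_isCompact_closure hK W'.isOpen hKW
  set W₁ : Opens U := ⟨W, hWo⟩
  obtain ⟨m, C, hC0, hC⟩ := exists_norm_le_of_tsupport_subset T χ.hasCompactSupport χ.tsupport_subset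
  obtain ⟨C₁, hC₁⟩ := exists_sobolevNorm_top_le (W := W₁) one_le_two hWc hWW' hW' m
  have hsm : IsSmooth U (ofGlobal U χ) := isSmooth_ofGlobal χ.contDiff
  have hfin := sobolevNorm_ne_top hsm m (W := W₁) hWc
  set N := sobolevNorm U m ⊤ W₁ (ofGlobal U χ)
  lift N to NNReal using hfin with C₂ hC₂
  refine ⟨m + d, C.toNNReal * (2 ^ m * (C₂ * C₁)), fun ψ => ?_⟩
  have hfin' := sobolevNorm_ne_top (hsm.mul ψ.2) m (W := W₁) hWc
  have h1 : ‖T (mulTest χ ψ)‖ₑ ≤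
      C.toNNReal * sobolevNorm U m ⊤ W₁ (ofGlobal U χ * ψ.1) := by
    rw [← ENNReal.ofReal_toReal hfin', ← ofReal_norm]
    change _ ≤ ENNReal.ofReal C * _
    rw [← ENNReal.ofReal_mul hC0]
    refine ENNReal.ofReal_le_ofReal (hC _ tsupport_mul_subset_left _ ENNReal.toReal_nonneg ?_)
    intro l hl x hx
    have hxU : x ∈ U := χ.tsupport_subset hx
    have hsm' := (hsm.mul ψ.2).iterPderiv l
    have h2 : iterPderiv U l (ofGlobal U χ * ψ.1) ⟨x, hxU⟩ = iterGderiv l (mulTest χ ψ) x :=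
      iterPderiv_eq_iterGderiv (U := U) (fun y => congrArg (χ y * ·) (ext_apply ψ.1 y).symm) l
        ⟨x, hxU⟩
    rw [← h2, ← ENNReal.ofReal_le_iff_le_toReal hfin', ofReal_norm]
    refine le_trans ?_ (le_sobolevNorm hl)
    rw [eLpNorm_top_eq hsm'.continuous]
    exact le_iSup (fun y : W₁ => ‖iterPderiv U l (ofGlobal U χ * ψ.1) y‖ₑ)
      ⟨⟨x, hxU⟩, hKW (show x ∈ tsupport χ from hx)⟩
  calc _ ≤ C.toNNReal * sobolevNorm U m ⊤ W₁ (ofGlobal U χ * ψ.1) := h1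
    _ ≤ C.toNNReal * (2 ^ m * (C₂ * sobolevNorm U m ⊤ W₁ ψ.1)) := by
        gcongr
        rw [hC₂]
        exact sobolevNorm_mul_le_of_exponent le_top hsm ψ.2 m W₁
    _ ≤ C.toNNReal * (2 ^ m * (C₂ * (C₁ * sobolevNorm U (m + d) 2 W' ψ.1))) := by
        gcongr
        exact hC₁ _ ψ.2
    _ = _ := by push_cast; ring

/-- A linear functional dominated by a map into a Hilbert space is represented by a vector of
that space. -/
theorem exists_inner_eq_of_norm_le {E H : Type*} [AddCommGroup E] [Module ℂ E]
    [NormedAddCommGroup H] [InnerProductSpace ℂ H] [CompleteSpace H] (J : E →ₗ[ℂ] H)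
    (S : E →ₗ[ℂ] ℂ) (C : ℝ) (h : ∀ v, ‖S v‖ ≤ C * ‖J v‖) : ∃ G : H, ∀ v, S v = inner ℂ G (J v) := by
  have hker : LinearMap.ker J ≤ LinearMap.ker S := fun v hv => by
    have := h v
    rw [LinearMap.mem_ker.1 hv, norm_zero, mul_zero] at this
    exact LinearMap.mem_ker.2 (norm_le_zero_iff.1 this)
  let f : LinearMap.range J →ₗ[ℂ] ℂ :=
    (LinearMap.ker J).liftQ S hker ∘ₗ J.quotKerEquivRange.symm.toLinearMap
  have hf : ∀ v, f ⟨J v, LinearMap.mem_range_self J v⟩ = S v := by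
    intro v
    have : J.quotKerEquivRange.symm ⟨J v, LinearMap.mem_range_self J v⟩ =
        (LinearMap.ker J).mkQ v := by
      rw [LinearEquiv.symm_apply_eq]
      rfl
    simp only [f, LinearMap.comp_apply, LinearEquiv.coe_coe, this]
    rfl
  let F : StrongDual ℂ (LinearMap.range J) := f.mkContinuous C fun y => by
    obtain ⟨_, v, rfl⟩ := y
    rw [hf]
    exact h v
  obtain ⟨F', hF', -⟩ := exists_extension_norm_eq _ F
  refine ⟨(InnerProductSpace.toDual ℂ H).symm F', fun v => ?_⟩
  rw [InnerProductSpace.toDual_symm_apply, ← hf v]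
  exact (hF' ⟨J v, LinearMap.mem_range_self J v⟩).symm

/-- Multi-indices, as lists, of order at most `k`. -/
def listsLE (d k : ℕ) : Finset (List (Fin d)) := (List.finite_length_le (Fin d) k).toFinset

theorem mem_listsLE {k : ℕ} {l : List (Fin d)} : l ∈ listsLE d k ↔ l.length ≤ k := by
  simp [listsLE]

theorem memLp_jet {k : ℕ} {W : Opens U} (hW : IsCompact (closure (W : Set U))) (ψ : Smooth U) :
    MemLp (fun x : U => (WithLp.toLp 2 fun l : listsLE d k => iterPderiv U l ψ.1 x :
      EuclideanSpace ℂ (listsLE d k))) 2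
      ((Measure.comap Subtype.val volume : Measure U).restrict W) := by
  have hc : Continuous fun x : U => (WithLp.toLp 2 fun l : listsLE d k => iterPderiv U l ψ.1 x :
      EuclideanSpace ℂ (listsLE d k)) :=
    (PiLp.continuous_toLp 2 _).comp
      (continuous_pi fun l => (IsSmooth.iterPderiv ψ.2 l.1).continuous)
  have : IsFiniteMeasure ((Measure.comap Subtype.val volume : Measure U).restrict W) :=
    ⟨by rw [Measure.restrict_apply_univ]; exact measure_lt_top_of_isCompact_closure hW⟩
  obtain ⟨C, hC⟩ := hW.exists_bound_of_continuousOn hc.continuousOn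
  refine MemLp.of_bound hc.aestronglyMeasurable C ?_
  filter_upwards [ae_restrict_mem W.isOpen.measurableSet] with x hx
  exact hC x (subset_closure hx)

/-- The partial derivatives of order at most `k` of a smooth function, as an element of a Hilbert
space of square integrable vector-valued functions. -/
def jet (k : ℕ) {W : Opens U} (hW : IsCompact (closure (W : Set U))) :
    Smooth U →ₗ[ℂ] Lp (EuclideanSpace ℂ (listsLE d k)) 2
      ((Measure.comap Subtype.val volume : Measure U).restrict W) where
  toFun ψ := (memLp_jet hW ψ).toLp _
  map_add' ψ ψ' := by
    rw [← MemLp.toLp_add]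
    refine MemLp.toLp_congr _ _ (Filter.Eventually.of_forall fun x => ?_)
    ext l
    change iterPderiv U l.1 (ψ.1 + ψ'.1) x = _
    rw [iterPderiv_add l.1 ψ.2 ψ'.2]
    rfl
  map_smul' c ψ := by
    rw [RingHom.id_apply, ← MemLp.toLp_const_smul]
    refine MemLp.toLp_congr _ _ (Filter.Eventually.of_forall fun x => ?_)
    ext l
    change iterPderiv U l.1 (c • ψ.1) x = _
    rw [iterPderiv_smul l.1 c ψ.2]
    rfl

/-- The map `jet` dominates the `L²` Sobolev norm. -/
theorem sobolevNorm_le_enorm_jet (k : ℕ) {W : Opens U} (hW : IsCompact (closure (W : Set U)))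
    (ψ : Smooth U) : sobolevNorm U k 2 W ψ.1 ≤ ‖jet k hW ψ‖ₑ := by
  have : ‖jet k hW ψ‖ₑ = _ := Lp.enorm_toLp (hf := memLp_jet hW ψ)
  rw [this]
  refine iSup₂_le fun l hl => eLpNorm_mono fun x => ?_
  exact PiLp.norm_apply_le (WithLp.toLp 2 fun l : listsLE d k => iterPderiv U l ψ.1 x :
      EuclideanSpace ℂ (listsLE d k)) ⟨l, mem_listsLE.2 hl⟩

/-- Multiplication by `χ` followed by a distribution, as a functional on smooth functions. -/
def mulTestFunctional (T : Distr U) (χ : 𝓓(U, ℂ)) : Smooth U →ₗ[ℂ] ℂ where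
  toFun ψ := T (mulTest χ ψ)
  map_add' ψ ψ' := by
    rw [← map_add]
    refine congrArg T (TestFunction.ext fun y => ?_)
    change χ y * ext U (ψ.1 + ψ'.1) y = χ y * ext U ψ.1 y + χ y * ext U ψ'.1 y
    rw [ext_add, Pi.add_apply, mul_add]
  map_smul' c ψ := by
    rw [RingHom.id_apply, ← map_smul]
    refine congrArg T (TestFunction.ext fun y => ?_)
    change χ y * ext U (c • ψ.1) y = c * (χ y * ext U ψ.1 y)
    by_cases hy : y ∈ U
    · lift y to U using hy
      simp only [ext_apply, Pi.smul_apply, smul_eq_mul]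
      ring
    · rw [image_eq_zero_of_notMem_tsupport fun h => hy (χ.tsupport_subset h)]
      simp

/-- Local structure of distributions: after multiplication by a test function `χ`, a distribution
is a finite sum of derivatives of integrable functions supported near the support of `χ`. The
functions are the components of the vector that represents the distribution in the Hilbert space
of jets; the signs of the integrations by parts are absorbed in them. -/
theorem exists_structure (T : Distr U) (χ : 𝓓(U, ℂ)) {O : Set (Rn d)} (hO : IsOpen O)
    (hχ : tsupport χ ⊆ O) : ∃ (k : ℕ) (g : List (Fin d) → Rn d → ℂ), (∀ l, Integrable (g l)) ∧
      (∀ l, ∀ y ∉ O, g l y = 0) ∧ ∀ (Ψ : Rn d → ℂ), ContDiff ℝ ∞ Ψ → ∀ ρ : 𝓓(U, ℂ),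
        (∀ y, ρ y = χ y * Ψ y) → T ρ = ∑ l ∈ listsLE d k, ∫ y, g l y * iterGderiv l Ψ y := by
  have : LocallyCompactSpace U := U.isOpen.locallyCompactSpace
  have hemb : MeasurableEmbedding (Subtype.val : U → Rn d) :=
    MeasurableEmbedding.subtype_coe U.isOpen.measurableSet
  have hK : IsCompact (Subtype.val ⁻¹' tsupport χ : Set U) := by
    refine (Topology.IsInducing.subtypeVal.isCompact_preimage_iff ?_).2 χ.hasCompactSupport
    rw [Subtype.range_coe]
    exact χ.tsupport_subset
  obtain ⟨W', hWo, hKW, hWO, hWc⟩ := exists_open_between_and_isCompact_closure hK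
    (hO.preimage continuous_subtype_val) (preimage_mono hχ)
  set W : Opens U := ⟨W', hWo⟩
  have hWc' : IsCompact (closure (W : Set U)) := hWc
  have hχW : tsupport χ ⊆ Subtype.val '' (W : Set U) := fun y hy =>
    ⟨⟨y, χ.tsupport_subset hy⟩, hKW hy, rfl⟩
  obtain ⟨k, C, hC⟩ := exists_norm_le_sobolevNorm T χ hWc' hχW
  let μ := (Measure.comap Subtype.val volume : Measure U).restrict W
  obtain ⟨G, hG⟩ := exists_inner_eq_of_norm_le (jet k hWc') (mulTestFunctional T χ) C fun ψ => by
    have h1 := (hC ψ).trans (mul_le_mul_right (sobolevNorm_le_enorm_jet k hWc' ψ) _)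
    have h2 := ENNReal.toReal_mono (ENNReal.mul_ne_top ENNReal.coe_ne_top enorm_ne_top) h1
    simpa using! h2
  have hfin : IsFiniteMeasure μ :=
    ⟨by rw [Measure.restrict_apply_univ]; exact measure_lt_top_of_isCompact_closure hWc'⟩
  have hmap : Measure.map Subtype.val μ =
      (volume : Measure (Rn d)).restrict (Subtype.val '' (W : Set U)) := by
    have h1 : μ = Measure.comap Subtype.val
        ((volume : Measure (Rn d)).restrict (Subtype.val '' (W : Set U))) := by
      rw [hemb.comap_restrict, preimage_image_eq _ Subtype.val_injective]
    rw [h1, hemb.map_comap, Measure.restrict_restrict hemb.measurableSet_range,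
      inter_eq_right.2 (image_subset_range _ _)]
  have hWm : MeasurableSet (Subtype.val '' (W : Set U)) :=
    (U.isOpen.isOpenEmbedding_subtypeVal.isOpenMap _ W.isOpen).measurableSet
  -- the components of the representing vector, as functions on the whole space
  let h : List (Fin d) → Rn d → ℂ := fun l =>
    ext U fun x => if hl : l ∈ listsLE d k then star (G x ⟨l, hl⟩) else 0
  have hh : ∀ (l : listsLE d k) (x : U), h l x = star (G x l) := fun l x => by
    simp only [h]
    rw [ext_apply, dif_pos l.2]
  have hGl : ∀ l : listsLE d k, Integrable (fun x => G x l) μ := fun l =>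
    ((MemLp.eval_piLp (Lp.memLp G) l).integrable one_le_two)
  have hGs : ∀ l : listsLE d k, Integrable (fun x => star (G x l)) μ := fun l =>
    (starL' ℝ : ℂ ≃L[ℝ] ℂ).toContinuousLinearMap.integrable_comp (hGl l)
  have hint : ∀ l, Integrable ((Subtype.val '' (W : Set U)).indicator (h l)) := by
    intro l
    rw [integrable_indicator_iff hWm, IntegrableOn, ← hmap, hemb.integrable_map_iff]
    by_cases hl : l ∈ listsLE d k
    · refine (hGs ⟨l, hl⟩).congr (Filter.Eventually.of_forall fun x => ?_)
      exact (hh ⟨l, hl⟩ x).symm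
    · refine (integrable_zero _ _ _).congr (Filter.Eventually.of_forall fun x => ?_)
      simp only [h, Function.comp_apply]
      rw [ext_apply, dif_neg hl]
      rfl
  refine ⟨k, fun l => (Subtype.val '' (W : Set U)).indicator (h l), hint, fun l y hy => ?_,
    fun Ψ hΨ ρ hρ => ?_⟩
  · refine indicator_of_notMem (fun hyW => hy ?_) _
    obtain ⟨x, hx, rfl⟩ := hyW
    exact hWO (subset_closure hx)
  · let ψ : Smooth U := ⟨ofGlobal U Ψ, isSmooth_ofGlobal hΨ⟩
    have hρT : T ρ = mulTestFunctional T χ ψ := by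
      refine congrArg T (TestFunction.ext fun y => ?_)
      rw [hρ y]
      change _ = χ y * ext U (ofGlobal U Ψ) y
      by_cases hy : y ∈ U
      · lift y to U using hy
        rw [ext_apply]
        rfl
      · rw [image_eq_zero_of_notMem_tsupport fun h => hy (χ.tsupport_subset h), zero_mul, zero_mul]
    have hjet : ∀ l : listsLE d k, Integrable (fun x => star (G x l) * iterPderiv U l ψ.1 x) μ := by
      intro l
      have hc := (IsSmooth.iterPderiv ψ.2 l.1).continuous
      obtain ⟨B, hB⟩ := hWc'.exists_bound_of_continuousOn hc.continuousOn
      refine (hGs l).mul_bdd (c := B) hc.aestronglyMeasurable ?_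
      filter_upwards [ae_restrict_mem W.isOpen.measurableSet] with x hx
      exact hB x (subset_closure hx)
    have hcongr : ∀ᵐ x ∂μ, inner ℂ (G x) (jet k hWc' ψ x) =
        ∑ l : listsLE d k, star (G x l) * iterPderiv U l ψ.1 x := by
      filter_upwards [(memLp_jet hWc' ψ).coeFn_toLp] with x hx
      have : jet k hWc' ψ x = _ := hx
      rw [this, PiLp.inner_apply]
      exact Finset.sum_congr rfl fun l _ => by rw [RCLike.inner_apply, mul_comm]; rfl
    rw [hρT, hG, L2.inner_def, integral_congr_ae hcongr, integral_finsetSum _ fun l _ => hjet l,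
      ← Finset.sum_coe_sort (listsLE d k)]
    refine Finset.sum_congr rfl fun l _ => ?_
    have h1 : ∀ y, (Subtype.val '' (W : Set U)).indicator (h l) y * iterGderiv l.1 Ψ y =
        (Subtype.val '' (W : Set U)).indicator (fun y => h l y * iterGderiv l.1 Ψ y) y :=
      fun y => (indicator_mul_left _ _ _).symm
    simp only [h1]
    rw [integral_indicator hWm, ← hmap, hemb.integral_map]
    refine integral_congr_ae (Filter.Eventually.of_forall fun x => ?_)
    change _ = h l x * iterGderiv l.1 Ψ x
    rw [hh, ← iterPderiv_eq_iterGderiv (f := ψ.1) (g := Ψ) fun _ => rfl]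

end Structure

/-! ### Convolution integrals -/

section Smear

/-- The partial derivative of a Schwartz function, as a Schwartz function. -/
def sderiv (i : Fin d) (ψ : 𝓢(Rn d, ℂ)) : 𝓢(Rn d, ℂ) :=
  LineDeriv.lineDerivOp (EuclideanSpace.single i (1 : ℝ)) ψ

theorem coe_sderiv (i : Fin d) (ψ : 𝓢(Rn d, ℂ)) : ⇑(sderiv i ψ) = gderiv i ψ :=
  funext fun x => SchwartzMap.lineDerivOp_apply_eq_fderiv _ ψ x

/-- Iterated partial derivatives of a Schwartz function. -/
def iterSderiv : List (Fin d) → 𝓢(Rn d, ℂ) → 𝓢(Rn d, ℂ)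
  | [], ψ => ψ
  | i :: l, ψ => iterSderiv l (sderiv i ψ)

theorem coe_iterSderiv (l : List (Fin d)) (ψ : 𝓢(Rn d, ℂ)) :
    ⇑(iterSderiv l ψ) = iterGderiv l ψ := by
  induction l generalizing ψ with
  | nil => rfl
  | cons i l ih => rw [iterSderiv, ih, coe_sderiv, iterGderiv]

theorem exists_norm_schwartz_le (ψ : 𝓢(Rn d, ℂ)) : ∃ C : ℝ, 0 ≤ C ∧ ∀ x, ‖ψ x‖ ≤ C :=
  ⟨_, apply_nonneg _ _, fun x => SchwartzMap.norm_le_seminorm ℝ ψ x⟩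

/-- The superposition of the translates of `G` by `c a`, with the weights `k a`. Both the
convolution with a mollifier and its form after rescaling the variable of integration are of this
kind. -/
def smear (k : Rn d → ℂ) (c : Rn d → Rn d) (G : Rn d → ℂ) (x : Rn d) : ℂ :=
  ∫ a, k a * G (x - c a)

variable {k : Rn d → ℂ} {c : Rn d → Rn d}

theorem aestronglyMeasurable_smear (hk : Integrable k) (hc : Measurable c) {E : Type*}
    [NormedAddCommGroup E] [NormedSpace ℂ E] {G : Rn d → E} (hG : Continuous G) (x : Rn d) :
    AEStronglyMeasurable (fun a => k a • G (x - c a)) :=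
  hk.aestronglyMeasurable.smul
    (hG.comp_aestronglyMeasurable (measurable_const.sub hc).aestronglyMeasurable)

theorem integrable_smear (hk : Integrable k) (hc : Measurable c) (G : 𝓢(Rn d, ℂ)) (x : Rn d) :
    Integrable fun a => k a * G (x - c a) := by
  obtain ⟨C, -, hC⟩ := exists_norm_schwartz_le G
  exact hk.mul_bdd (c := C)
    (G.continuous.comp_aestronglyMeasurable (measurable_const.sub hc).aestronglyMeasurable)
    (Filter.Eventually.of_forall fun a => hC _)

theorem norm_smear_le (hk : Integrable k) {G : Rn d → ℂ} {C : ℝ} {x : Rn d}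
    (h : ∀ a, k a ≠ 0 → ‖G (x - c a)‖ ≤ C) : ‖smear k c G x‖ ≤ C * ∫ a, ‖k a‖ := by
  rw [← integral_const_mul]
  refine norm_integral_le_of_norm_le (hk.norm.const_mul C) (Filter.Eventually.of_forall fun a => ?_)
  by_cases ha : k a = 0
  · simp [ha]
  · rw [norm_mul, mul_comm]
    exact mul_le_mul_of_nonneg_right (h a ha) (norm_nonneg _)

theorem hasFDerivAt_smear (hk : Integrable k) (hc : Measurable c) (G : 𝓢(Rn d, ℂ)) (x : Rn d) :
    HasFDerivAt (smear k c G) (∫ a, k a • fderiv ℝ G (x - c a)) x := by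
  obtain ⟨C, hC⟩ : ∃ C : ℝ, ∀ y, ‖fderiv ℝ G y‖ ≤ C :=
    ⟨_, fun y => SchwartzMap.norm_le_seminorm ℝ (SchwartzMap.fderivCLM ℝ (Rn d) ℂ G) y⟩
  have hcont : Continuous (fderiv ℝ G) := (G.smooth ⊤).continuous_fderiv (by simp)
  refine hasFDerivAt_integral_of_dominated_of_fderiv_le (𝕜 := ℝ)
    (F := fun x a => k a * G (x - c a)) (F' := fun x a => k a • fderiv ℝ G (x - c a))
    (bound := fun a => ‖k a‖ * C) Filter.univ_mem
    (Filter.Eventually.of_forall fun y => (integrable_smear hk hc G y).aestronglyMeasurable)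
    (integrable_smear hk hc G x) (aestronglyMeasurable_smear hk hc hcont x)
    (Filter.Eventually.of_forall fun a y _ => ?_) (hk.norm.mul_const C)
    (Filter.Eventually.of_forall fun a y _ => ?_)
  · rw [norm_smul]
    exact mul_le_mul_of_nonneg_left (hC _) (norm_nonneg _)
  · have h := (G.differentiable (y - c a)).hasFDerivAt.comp y ((hasFDerivAt_id y).sub_const (c a))
    exact h.const_mul (k a)

theorem fderiv_smear_apply (hk : Integrable k) (hc : Measurable c) (G : 𝓢(Rn d, ℂ)) (v x : Rn d) :
    fderiv ℝ (smear k c G) x v = smear k c (LineDeriv.lineDerivOp v G : 𝓢(Rn d, ℂ)) x := by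
  have hcont : Continuous (fderiv ℝ G) := (G.smooth ⊤).continuous_fderiv (by simp)
  rw [(hasFDerivAt_smear hk hc G x).fderiv, ContinuousLinearMap.integral_apply]
  · refine integral_congr_ae (Filter.Eventually.of_forall fun a => ?_)
    simp [SchwartzMap.lineDerivOp_apply_eq_fderiv]
  · refine (hk.norm.mul_const
      (SchwartzMap.seminorm ℝ 0 0 (SchwartzMap.fderivCLM ℝ (Rn d) ℂ G))).mono'
      (aestronglyMeasurable_smear hk hc hcont x) (Filter.Eventually.of_forall fun a => ?_)
    rw [norm_smul]
    exact mul_le_mul_of_nonneg_left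
      (SchwartzMap.norm_le_seminorm ℝ (SchwartzMap.fderivCLM ℝ (Rn d) ℂ G) _) (norm_nonneg _)

theorem contDiff_smear (hk : Integrable k) (hc : Measurable c) (G : 𝓢(Rn d, ℂ)) :
    ContDiff ℝ ∞ (smear k c G) := by
  refine contDiff_infty.2 fun n => ?_
  induction n generalizing G with
  | zero =>
    exact contDiff_zero.2 (continuous_iff_continuousAt.2 fun x =>
      (hasFDerivAt_smear hk hc G x).continuousAt)
  | succ n ih =>
    push_cast
    refine contDiff_succ_iff_fderiv_apply.2
      ⟨fun x => (hasFDerivAt_smear hk hc G x).differentiableAt, by simp, fun v => ?_⟩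
    simp only [fderiv_smear_apply hk hc]
    exact ih _

/-- Derivatives of a convolution integral fall on the Schwartz function. -/
theorem iterGderiv_smear (hk : Integrable k) (hc : Measurable c) (l : List (Fin d))
    (G : 𝓢(Rn d, ℂ)) : iterGderiv l (smear k c G) = smear k c (iterSderiv l G) := by
  induction l generalizing G with
  | nil => rfl
  | cons i l ih =>
    rw [iterGderiv, iterSderiv, ← ih]
    congr 1
    exact funext fun x => fderiv_smear_apply hk hc G _ x

end Smear

/-! ### Rescaled Schwartz functions -/

section Scale

/-- The rescaled function `ψ_ε = ε^{-d} ψ(·/ε)`. -/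
def scale (ε : Par) (ψ : 𝓢(Rn d, ℂ)) : 𝓢(Rn d, ℂ) :=
  (((ε : ℝ) : ℂ)⁻¹ ^ d) • SchwartzMap.compCLMOfContinuousLinearEquiv ℂ
    (ContinuousLinearEquiv.smulLeft (Units.mk0 (ε : ℝ)⁻¹ (inv_ne_zero ε.2.1.ne'))) ψ

theorem scale_apply (ε : Par) (ψ : 𝓢(Rn d, ℂ)) (x : Rn d) :
    scale ε ψ x = ((ε : ℝ) : ℂ)⁻¹ ^ d * ψ ((ε : ℝ)⁻¹ • x) := rfl

theorem sderiv_scale (ε : Par) (i : Fin d) (ψ : 𝓢(Rn d, ℂ)) :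
    sderiv i (scale ε ψ) = ((ε : ℝ) : ℂ)⁻¹ • scale ε (sderiv i ψ) := by
  rw [sderiv, scale, LineDeriv.lineDerivOp_smul,
    SchwartzMap.lineDerivOp_compCLMOfContinuousLinearEquiv]
  have h : (ContinuousLinearEquiv.smulLeft (Units.mk0 (ε : ℝ)⁻¹ (inv_ne_zero ε.2.1.ne')) :
      Rn d ≃L[ℝ] Rn d) (EuclideanSpace.single i (1 : ℝ)) =
        (ε : ℝ)⁻¹ • EuclideanSpace.single i (1 : ℝ) := rfl
  rw [h, LineDeriv.lineDerivOp_left_smul]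
  ext x
  change ((ε : ℝ) : ℂ)⁻¹ ^ d * ((ε : ℝ)⁻¹ • sderiv i ψ ((ε : ℝ)⁻¹ • x)) =
    ((ε : ℝ) : ℂ)⁻¹ * (((ε : ℝ) : ℂ)⁻¹ ^ d * sderiv i ψ ((ε : ℝ)⁻¹ • x))
  rw [Complex.real_smul]
  push_cast
  ring

theorem iterSderiv_smul (l : List (Fin d)) (a : ℂ) (ψ : 𝓢(Rn d, ℂ)) :
    iterSderiv l (a • ψ) = a • iterSderiv l ψ := by
  induction l generalizing ψ with
  | nil => rfl
  | cons i l ih =>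
    rw [iterSderiv, iterSderiv, ← ih, sderiv, sderiv, LineDeriv.lineDerivOp_smul]

theorem iterSderiv_scale (ε : Par) (l : List (Fin d)) (ψ : 𝓢(Rn d, ℂ)) :
    iterSderiv l (scale ε ψ) = ((ε : ℝ) : ℂ)⁻¹ ^ l.length • scale ε (iterSderiv l ψ) := by
  induction l generalizing ψ with
  | nil => simp [iterSderiv]
  | cons i l ih =>
    rw [iterSderiv, iterSderiv, sderiv_scale, iterSderiv_smul, ih, smul_smul, List.length_cons,
      pow_succ']

theorem continuous_smear_scale {h : Rn d → ℂ} (hh : Integrable h) (ψ : 𝓢(Rn d, ℂ)) :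
    Continuous fun z : Par × Rn d => smear h id (scale z.1 ψ) z.2 := by
  obtain ⟨C, -, hC⟩ := exists_norm_schwartz_le ψ
  have hinv : Continuous fun z : Par × Rn d => (z.1 : ℝ)⁻¹ :=
    (continuous_subtype_val.comp continuous_fst).inv₀ fun z => z.1.2.1.ne'
  have h1 : Continuous fun z : Par × Rn d => ∫ y, h y * ψ ((z.1 : ℝ)⁻¹ • (z.2 - y)) := by
    refine continuous_of_dominated (bound := fun y => ‖h y‖ * C) (fun z => ?_)
      (fun z => Filter.Eventually.of_forall fun y => ?_) (hh.norm.mul_const C)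
      (Filter.Eventually.of_forall fun y => ?_)
    · refine hh.aestronglyMeasurable.mul (Continuous.aestronglyMeasurable ?_)
      exact ψ.continuous.comp (by fun_prop)
    · rw [norm_mul]
      exact mul_le_mul_of_nonneg_left (hC _) (norm_nonneg _)
    · exact continuous_const.mul
        (ψ.continuous.comp (hinv.smul (continuous_snd.sub continuous_const)))
  have h2 : (fun z : Par × Rn d => smear h id (scale z.1 ψ) z.2) = fun z =>
      (((z.1 : ℝ)⁻¹ : ℝ) : ℂ) ^ d * ∫ y, h y * ψ ((z.1 : ℝ)⁻¹ • (z.2 - y)) := by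
    ext z
    rw [← integral_const_mul]
    refine integral_congr_ae (Filter.Eventually.of_forall fun y => ?_)
    simp only [scale_apply, id, Complex.ofReal_inv]
    ring
  rw [h2]
  exact ((Complex.continuous_ofReal.comp hinv).pow d).mul h1

end Scale

/-! ### Nets given by convolution with rescaled Schwartz functions -/

section ConvNet

variable {U : Opens (Rn d)} {q : ℝ≥0∞}

/-- A weighted net of size `O(ε)` has finite norm: `∫₀¹ ε^q dε/ε` is finite because `q ≥ 1`. -/
theorem parNorm_lt_top_of_le (hq : 1 ≤ q) {s C : ℝ} {g : Par → ℝ≥0∞}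
    (h : ∀ ε : Par, ENNReal.ofReal ((ε : ℝ) ^ s) * g ε ≤ ENNReal.ofReal C * ENNReal.ofReal ε) :
    parNorm q s g < ⊤ := by
  have h1 : ∀ ε : Par, ENNReal.ofReal (ε : ℝ) ≤ 1 := fun ε => by simpa using ε.2.2.le
  refine (eLpNorm_mono_enorm (g := fun ε : Par => ENNReal.ofReal C * ENNReal.ofReal ε)
    fun ε => by simpa only [enorm_eq_self] using h ε).trans_lt ?_
  by_cases hqt : q = ⊤
  · rw [hqt, eLpNorm_exponent_top]
    refine (eLpNormEssSup_le_of_ae_enorm_bound (C := ENNReal.ofReal C)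
      (Filter.Eventually.of_forall fun ε => ?_)).trans_lt ENNReal.ofReal_lt_top
    rw [enorm_eq_self]
    exact mul_le_of_le_one_right' (h1 ε)
  have hq1 : 1 ≤ q.toReal := by
    rw [← ENNReal.toReal_one]
    exact ENNReal.toReal_mono hqt hq
  refine (eLpNorm_lt_top_iff_lintegral_rpow_enorm_lt_top (zero_lt_one.trans_le hq).ne' hqt).2 ?_
  simp only [enorm_eq_self]
  have hm : Measurable fun ε : Par => ENNReal.ofReal (ε : ℝ)⁻¹ := by fun_prop
  rw [parMeasure, lintegral_withDensity_eq_lintegral_mul _ hm (by fun_prop)]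
  have hvol : (Measure.comap Subtype.val volume : Measure Par) univ = 1 := by
    rw [(MeasurableEmbedding.subtype_coe measurableSet_Ioo).comap_apply, image_univ,
      Subtype.range_coe, Real.volume_Ioo]
    simp
  refine (lintegral_mono (g := fun _ => ENNReal.ofReal C ^ q.toReal) fun ε => ?_).trans_lt ?_
  · rw [Pi.mul_apply, ENNReal.mul_rpow_of_nonneg _ _ (zero_le_one.trans hq1)]
    calc _ ≤ ENNReal.ofReal (ε : ℝ)⁻¹ * (ENNReal.ofReal C ^ q.toReal * ENNReal.ofReal ε) := by
          gcongr
          simpa using! ENNReal.rpow_le_rpow_of_exponent_ge (h1 ε) hq1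
      _ = ENNReal.ofReal C ^ q.toReal * (ENNReal.ofReal (ε : ℝ)⁻¹ * ENNReal.ofReal ε) := by ring
      _ ≤ _ := by
          rw [← ENNReal.ofReal_mul (inv_nonneg.2 ε.2.1.le), inv_mul_cancel₀ ε.2.1.ne']
          simp
  · rw [lintegral_const, hvol, mul_one]
    exact ENNReal.rpow_lt_top_of_nonneg (zero_le_one.trans hq1) ENNReal.ofReal_ne_top

/-- A criterion for moderateness in which each derivative may cost a further power of `ε⁻¹`. -/
theorem moderateEst_of_norm_le (hq : 1 ≤ q) {f : Par → U → ℂ} (hf : IsNet U f) (a : ℕ)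
    (h : ∀ l : List (Fin d), ∃ C : ℝ, ∀ (ε : Par) (x : U),
      ‖iterPderiv U l (f ε) x‖ ≤ C * (ε : ℝ)⁻¹ ^ (a + l.length)) : ModerateEst ⊤ q U f := by
  rw [moderateEst_iff_forall_nhds hf]
  intro k x
  choose C hC using h
  -- the weight `ε^(a + k)` compensates the growth, and one more power of `ε` gives integrability
  refine ⟨univ, Filter.univ_mem, ((a + k + 1 : ℕ) : ℝ),
    parNorm_lt_top_of_le hq (C := ∑ l ∈ listsLE d k, |C l|) fun ε => ?_⟩
  have hε := ε.2.1
  have h1 : supDeriv U k univ (f ε) ≤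
      ENNReal.ofReal ((∑ l ∈ listsLE d k, |C l|) * (ε : ℝ)⁻¹ ^ (a + k)) := by
    refine supDeriv_le fun l hl y _ => ?_
    rw [← ofReal_norm]
    refine ENNReal.ofReal_le_ofReal ((hC l ε y).trans ?_)
    refine mul_le_mul ?_ ?_ (by positivity) (Finset.sum_nonneg fun _ _ => abs_nonneg _)
    · exact (le_abs_self _).trans (Finset.single_le_sum (f := fun l => |C l|)
        (fun _ _ => abs_nonneg _) (mem_listsLE.2 hl))
    · exact pow_le_pow_right₀ (one_le_inv_iff₀.2 ⟨hε, ε.2.2.le⟩) (by omega)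
  refine (mul_le_mul_right h1 _).trans (le_of_eq ?_)
  rw [← ENNReal.ofReal_mul (Real.rpow_nonneg hε.le _),
    ← ENNReal.ofReal_mul (Finset.sum_nonneg fun _ _ => abs_nonneg _), Real.rpow_natCast]
  congr 1
  have h2 : (ε : ℝ) ^ (a + k) * (ε : ℝ)⁻¹ ^ (a + k) = 1 := by
    rw [← mul_pow, mul_inv_cancel₀ hε.ne', one_pow]
  linear_combination (∑ l ∈ listsLE d k, |C l|) * ε * h2

/-- A net all of whose derivatives are uniformly `O(ε^n)`, for all `n`, is negligible. -/
theorem negligibleEst_of_norm_le (hq : 1 ≤ q) {f : Par → U → ℂ} (hf : IsNet U f)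
    (h : ∀ (l : List (Fin d)) (n : ℕ), ∃ C : ℝ, ∀ (ε : Par) (x : U),
      ‖iterPderiv U l (f ε) x‖ ≤ C * (ε : ℝ) ^ n) : NegligibleEst ⊤ q U f := by
  rw [negligibleEst_iff_forall_nhds hf]
  intro k x s
  obtain ⟨n, hn⟩ := exists_nat_gt (1 - s)
  choose C hC using fun l => h l n
  refine ⟨univ, Filter.univ_mem,
    parNorm_lt_top_of_le hq (C := ∑ l ∈ listsLE d k, |C l|) fun ε => ?_⟩
  have hε := ε.2.1
  have h1 : supDeriv U k univ (f ε) ≤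
      ENNReal.ofReal ((∑ l ∈ listsLE d k, |C l|) * (ε : ℝ) ^ n) := by
    refine supDeriv_le fun l hl y _ => ?_
    rw [← ofReal_norm]
    refine ENNReal.ofReal_le_ofReal ((hC l ε y).trans
      (mul_le_mul_of_nonneg_right ?_ (by positivity)))
    exact (le_abs_self _).trans (Finset.single_le_sum (f := fun l => |C l|)
      (fun _ _ => abs_nonneg _) (mem_listsLE.2 hl))
  refine (mul_le_mul_right h1 _).trans ?_
  have h0 : 0 ≤ ∑ l ∈ listsLE d k, |C l| := Finset.sum_nonneg fun _ _ => abs_nonneg _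
  rw [← ENNReal.ofReal_mul (Real.rpow_nonneg hε.le _), ← ENNReal.ofReal_mul h0,
    ← Real.rpow_natCast, mul_left_comm, ← Real.rpow_add hε]
  refine ENNReal.ofReal_le_ofReal (mul_le_mul_of_nonneg_left ?_ h0)
  calc (ε : ℝ) ^ (s + n) ≤ (ε : ℝ) ^ (1 : ℝ) :=
        Real.rpow_le_rpow_of_exponent_ge hε ε.2.2.le (by linarith)
    _ = ε := Real.rpow_one _

/-- The net of the convolutions `h ∗ ψ_ε`, restricted to `U`. -/
def convNet (U : Opens (Rn d)) (h : Rn d → ℂ) (ψ : 𝓢(Rn d, ℂ)) : Par → U → ℂ :=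
  fun ε => ofGlobal U (smear h id (scale ε ψ))

variable {h : Rn d → ℂ}

theorem iterPderiv_convNet (hh : Integrable h) (ψ : 𝓢(Rn d, ℂ)) (l : List (Fin d)) (ε : Par) :
    iterPderiv U l (convNet U h ψ ε) =
      ofGlobal U (((ε : ℝ) : ℂ)⁻¹ ^ l.length • smear h id (scale ε (iterSderiv l ψ))) := by
  rw [convNet, iterPderiv_ofGlobal, iterGderiv_smear hh measurable_id, iterSderiv_scale]
  congr 1
  ext x
  rw [Pi.smul_apply, smul_eq_mul, smear, smear, ← integral_const_mul]
  refine integral_congr_ae (Filter.Eventually.of_forall fun y => ?_)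
  simp only [smul_apply, smul_eq_mul]
  ring

theorem continuous_smear_scale_coe (hh : Integrable h) (ψ : 𝓢(Rn d, ℂ)) :
    Continuous fun z : Par × U => smear h id (scale z.1 ψ) z.2 := by
  have h1 : Continuous fun z : Par × U => ((z.1, (z.2 : Rn d)) : Par × Rn d) := by fun_prop
  have h2 := (continuous_smear_scale hh ψ).comp h1
  simp only [Function.comp_def] at h2
  convert h2

theorem isNet_convNet (hh : Integrable h) (ψ : 𝓢(Rn d, ℂ)) : IsNet U (convNet U h ψ) := by
  refine ⟨fun ε => isSmooth_ofGlobal (contDiff_smear hh measurable_id _), fun l => ?_⟩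
  simp only [iterPderiv_convNet hh]
  have h1 : Continuous fun z : Par × U => ((z.1 : ℝ) : ℂ)⁻¹ :=
    (Complex.continuous_ofReal.comp (continuous_subtype_val.comp continuous_fst)).inv₀
      fun z => Complex.ofReal_ne_zero.2 z.1.2.1.ne'
  have h3 := continuous_smear_scale_coe (U := U) hh (iterSderiv l ψ)
  refine ((h1.pow l.length).mul h3).congr fun z => ?_
  rw [ofGlobal, Pi.smul_apply, smul_eq_mul]
  rfl

theorem norm_iterPderiv_convNet (hh : Integrable h) (ψ : 𝓢(Rn d, ℂ)) (l : List (Fin d)) (ε : Par)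
    (x : U) : ‖iterPderiv U l (convNet U h ψ ε) x‖ =
      (ε : ℝ)⁻¹ ^ l.length * ‖smear h id (scale ε (iterSderiv l ψ)) x‖ := by
  rw [iterPderiv_convNet hh, ofGlobal, Pi.smul_apply, smul_eq_mul, norm_mul, norm_pow, norm_inv,
    Complex.norm_real, Real.norm_of_nonneg ε.2.1.le]

theorem norm_scale (ε : Par) (ψ : 𝓢(Rn d, ℂ)) (x : Rn d) :
    ‖scale ε ψ x‖ = (ε : ℝ)⁻¹ ^ d * ‖ψ ((ε : ℝ)⁻¹ • x)‖ := by
  rw [scale_apply, norm_mul, norm_pow, norm_inv, Complex.norm_real, Real.norm_of_nonneg ε.2.1.le]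

theorem moderateEst_convNet (hq : 1 ≤ q) (hh : Integrable h) (ψ : 𝓢(Rn d, ℂ)) :
    ModerateEst ⊤ q U (convNet U h ψ) := by
  refine moderateEst_of_norm_le hq (isNet_convNet hh ψ) d fun l => ?_
  obtain ⟨C, -, hC⟩ := exists_norm_schwartz_le (iterSderiv l ψ)
  refine ⟨C * ∫ a, ‖h a‖, fun ε x => ?_⟩
  have hε := ε.2.1
  rw [norm_iterPderiv_convNet hh]
  have := norm_smear_le hh (c := id) (G := scale ε (iterSderiv l ψ)) (x := x)
    (C := (ε : ℝ)⁻¹ ^ d * C) fun a _ => by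
      rw [norm_scale]
      exact mul_le_mul_of_nonneg_left (hC _) (by positivity)
  refine (mul_le_mul_of_nonneg_left this (by positivity)).trans (le_of_eq ?_)
  ring

/-- Away from `h`, the net `h ∗ ψ_ε` is negligible, because `ψ` decreases rapidly. -/
theorem negligibleEst_convNet (hq : 1 ≤ q) (hh : Integrable h) (ψ : 𝓢(Rn d, ℂ)) {δ : ℝ}
    (hδ : 0 < δ) (hU : ∀ x ∈ U, ∀ y, h y ≠ 0 → δ ≤ ‖x - y‖) :
    NegligibleEst ⊤ q U (convNet U h ψ) := by
  refine negligibleEst_of_norm_le hq (isNet_convNet hh ψ) fun l n => ?_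
  -- the factors `ε⁻¹` from the normalization and from the derivatives cost `d + l.length` powers
  set m := n + d + l.length
  set C := SchwartzMap.seminorm ℝ m 0 (iterSderiv l ψ)
  refine ⟨C * δ⁻¹ ^ m * ∫ a, ‖h a‖, fun ε x => ?_⟩
  have hε := ε.2.1
  rw [norm_iterPderiv_convNet hh]
  have := norm_smear_le hh (c := id) (G := scale ε (iterSderiv l ψ)) (x := x)
    (C := (ε : ℝ)⁻¹ ^ d * (C * δ⁻¹ ^ m * (ε : ℝ) ^ m)) fun a ha => by
      rw [norm_scale]
      refine mul_le_mul_of_nonneg_left ?_ (by positivity)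
      have h1 : ‖(ε : ℝ)⁻¹ • ((x : Rn d) - a)‖ ^ m *
          ‖iterSderiv l ψ ((ε : ℝ)⁻¹ • ((x : Rn d) - a))‖ ≤ C :=
        SchwartzMap.norm_pow_mul_le_seminorm ℝ _ m _
      have h2 : (ε : ℝ)⁻¹ * δ ≤ ‖(ε : ℝ)⁻¹ • ((x : Rn d) - a)‖ := by
        rw [norm_smul, Real.norm_of_nonneg (inv_nonneg.2 hε.le)]
        exact mul_le_mul_of_nonneg_left (hU x x.2 a ha) (inv_nonneg.2 hε.le)
      have h3 := (mul_le_mul_of_nonneg_right (pow_le_pow_left₀ (by positivity) h2 m)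
        (norm_nonneg (iterSderiv l ψ ((ε : ℝ)⁻¹ • ((x : Rn d) - a))))).trans h1
      calc _ = δ⁻¹ ^ m * (ε : ℝ) ^ m * (((ε : ℝ)⁻¹ * δ) ^ m *
            ‖iterSderiv l ψ ((ε : ℝ)⁻¹ • ((x : Rn d) - a))‖) := by
            have h4 : δ⁻¹ ^ m * δ ^ m = 1 := by rw [← mul_pow, inv_mul_cancel₀ hδ.ne', one_pow]
            have h5 : (ε : ℝ) ^ m * (ε : ℝ)⁻¹ ^ m = 1 := by
              rw [← mul_pow, mul_inv_cancel₀ hε.ne', one_pow]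
            rw [mul_pow, id]
            linear_combination (-‖iterSderiv l ψ ((ε : ℝ)⁻¹ • ((x : Rn d) - a))‖) *
              (h4 + δ⁻¹ ^ m * δ ^ m * h5)
        _ ≤ δ⁻¹ ^ m * (ε : ℝ) ^ m * C := mul_le_mul_of_nonneg_left h3 (by positivity)
        _ = _ := by ring
  refine (mul_le_mul_of_nonneg_left this (by positivity)).trans (le_of_eq ?_)
  have h1 : ∀ j : ℕ, (ε : ℝ)⁻¹ ^ j * (ε : ℝ) ^ j = 1 := fun j => by
    rw [← mul_pow, inv_mul_cancel₀ hε.ne', one_pow]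
  have h2 : (ε : ℝ) ^ m = (ε : ℝ) ^ n * (ε : ℝ) ^ d * (ε : ℝ) ^ l.length := by
    simp only [m, pow_add]
  rw [h2]
  linear_combination C * δ⁻¹ ^ m * (∫ a, ‖h a‖) * (ε : ℝ) ^ n *
    (h1 d + (ε : ℝ)⁻¹ ^ d * (ε : ℝ) ^ d * h1 l.length)

theorem isNet_iterPderiv {f : Par → U → ℂ} (hf : IsNet U f) (l : List (Fin d)) :
    IsNet U fun ε => iterPderiv U l (f ε) := by
  induction l generalizing f with
  | nil => exact hf
  | cons i l ih => exact ih (hf.pderiv i)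

theorem moderateEst_iterPderiv {f : Par → U → ℂ} (hf : ModerateEst ⊤ q U f) (l : List (Fin d)) :
    ModerateEst ⊤ q U fun ε => iterPderiv U l (f ε) := by
  induction l generalizing f with
  | nil => exact hf
  | cons i l ih => exact ih (hf.pderiv i)

theorem negligibleEst_iterPderiv {f : Par → U → ℂ} (hf : NegligibleEst ⊤ q U f)
    (l : List (Fin d)) : NegligibleEst ⊤ q U fun ε => iterPderiv U l (f ε) := by
  induction l generalizing f with
  | nil => exact hf
  | cons i l ih => exact ih (hf.pderiv i)

end ConvNet

/-! ### The mollification of a distribution -/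

section Mollify

variable {U V : Opens (Rn d)} {q : ℝ≥0∞}

theorem iterGderiv_neg (l : List (Fin d)) (f : Rn d → ℂ) :
    iterGderiv l (-f) = -iterGderiv l f := by
  induction l generalizing f with
  | nil => rfl
  | cons i l ih =>
    have : gderiv i (-f) = -gderiv i f := by
      ext z
      simp only [gderiv, fderiv_neg]
      rfl
    rw [iterGderiv, this, ih, iterGderiv]

theorem iterGderiv_comp_sub_left {g : Rn d → ℂ} (hg : ContDiff ℝ ∞ g) (l : List (Fin d))
    (x y : Rn d) :
    iterGderiv l (fun y => g (x - y)) y = (-1) ^ l.length * iterGderiv l g (x - y) := by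
  induction l generalizing g with
  | nil => simp [iterGderiv]
  | cons i l ih =>
    have h : gderiv i (fun y => g (x - y)) = fun y => (-gderiv i g) (x - y) := by
      ext z
      have h1 : DifferentiableAt ℝ g (x - z) := (hg.differentiable (by simp)).differentiableAt
      have h2 : HasFDerivAt (fun y => g (x - y)) _ z :=
        h1.hasFDerivAt.comp z ((hasFDerivAt_id z).const_sub x)
      rw [gderiv, h2.fderiv]
      simp [gderiv]
    rw [iterGderiv, h, ih (g := -gderiv i g) (contDiff_gderiv hg i).neg, iterGderiv,
      iterGderiv_neg, List.length_cons, Pi.neg_apply]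
    ring

theorem iterGderiv_scale_comp_sub_left (φ : 𝓢(Rn d, ℂ)) (ε : Par) (l : List (Fin d)) (x y : Rn d) :
    iterGderiv l (fun y => scale ε φ (x - y)) y =
      (-1) ^ l.length * iterSderiv l (scale ε φ) (x - y) := by
  rw [iterGderiv_comp_sub_left ((scale ε φ).smooth ⊤), coe_iterSderiv]

/-- The mollification of a distribution is a sum of derivatives of convolutions with integrable
functions supported near the support of the cutoff. -/
theorem exists_mollify_eq (T : Distr U) (χ : 𝓓(U, ℂ)) {O : Set (Rn d)} (hO : IsOpen O)
    (hχ : tsupport χ ⊆ O) : ∃ (k : ℕ) (g : List (Fin d) → Rn d → ℂ), (∀ l, Integrable (g l)) ∧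
      (∀ l, ∀ y ∉ O, g l y = 0) ∧ ∀ φ : 𝓢(Rn d, ℂ), mollify φ T χ =
        ∑ l ∈ listsLE d k, (-1 : ℂ) ^ l.length • fun ε => iterPderiv U l (convNet U (g l) φ ε) := by
  obtain ⟨k, g, hg, hgO, h⟩ := exists_structure T χ hO hχ
  refine ⟨k, g, hg, hgO, fun φ => ?_⟩
  ext ε x
  have h1 : ContDiff ℝ ∞ fun y : Rn d => scale ε φ (x - y) :=
    ((scale ε φ).smooth ⊤).comp (contDiff_const.sub contDiff_id)
  rw [mollify, h _ h1 _ fun _ => rfl, Finset.sum_apply, Finset.sum_apply]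
  refine Finset.sum_congr rfl fun l _ => ?_
  simp only [iterGderiv_scale_comp_sub_left]
  rw [Pi.smul_apply, Pi.smul_apply, smul_eq_mul, convNet, iterPderiv_ofGlobal,
    iterGderiv_smear (hg l) measurable_id, ofGlobal, smear, ← integral_const_mul]
  refine integral_congr_ae (Filter.Eventually.of_forall fun y => ?_)
  simp only [id]
  ring

theorem IsNet.smul {f : Par → U → ℂ} (hf : IsNet U f) (c : ℂ) : IsNet U (c • f) :=
  (netSubalgebra U).smul_mem hf c

theorem ModerateEst.smul {f : Par → U → ℂ} (hf : IsNet U f) (hm : ModerateEst ⊤ q U f) (c : ℂ) :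
    ModerateEst ⊤ q U (c • f) :=
  (E q U).smul_mem c (x := Net.of f hf) hm

theorem NegligibleEst.smul {f : Par → U → ℂ} (hf : IsNet U f) (hm : NegligibleEst ⊤ q U f)
    (c : ℂ) : NegligibleEst ⊤ q U (c • f) :=
  (N q U).smul_mem c (x := Net.of f hf) hm

theorem isNet_mollify (φ : 𝓢(Rn d, ℂ)) (T : Distr U) (χ : 𝓓(U, ℂ)) : IsNet U (mollify φ T χ) := by
  obtain ⟨k, g, hg, -, h⟩ := exists_mollify_eq T χ U.isOpen χ.tsupport_subset
  rw [h φ]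
  exact IsNet.sum _ fun l _ => (isNet_iterPderiv (isNet_convNet (hg l) φ) l).smul _

theorem moderateEst_mollify (hq : 1 ≤ q) (φ : 𝓢(Rn d, ℂ)) (T : Distr U) (χ : 𝓓(U, ℂ)) :
    ModerateEst ⊤ q U (mollify φ T χ) := by
  obtain ⟨k, g, hg, -, h⟩ := exists_mollify_eq T χ U.isOpen χ.tsupport_subset
  have hn := fun l => isNet_iterPderiv (isNet_convNet (U := U) (hg l) φ) l
  rw [h φ]
  exact ModerateEst.sum _ (fun l _ => (hn l).smul _) fun l _ =>
    ModerateEst.smul (hn l) (moderateEst_iterPderiv (moderateEst_convNet hq (hg l) φ) l) _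

/-- The mollification is negligible where the cutoff vanishes. -/
theorem negligibleEst_mollify (hq : 1 ≤ q) (φ : 𝓢(Rn d, ℂ)) (T : Distr U) (χ : 𝓓(U, ℂ))
    (hV : V ≤ U) (hχ : ∀ x ∈ V, χ x = 0) :
    NegligibleEst ⊤ q V (fun ε => res hV (mollify φ T χ ε)) := by
  refine negligibleEst_of_local ((isNet_mollify φ T χ).res hV) fun x => ?_
  obtain ⟨r, hr, hrV⟩ := Metric.isOpen_iff.1 V.isOpen x x.2
  -- near `x` the functions of the structure theorem can be chosen to vanish, since `χ` does
  have hO : tsupport χ ⊆ (Metric.closedBall (x : Rn d) (r / 2))ᶜ := by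
    have h1 : tsupport χ ⊆ (Metric.ball (x : Rn d) r)ᶜ :=
      closure_minimal (fun y hy hyb => hy (hχ y (hrV hyb))) Metric.isOpen_ball.isClosed_compl
    exact h1.trans (compl_subset_compl.2 (Metric.closedBall_subset_ball (by linarith)))
  obtain ⟨k, g, hg, hgO, h⟩ := exists_mollify_eq T χ Metric.isClosed_closedBall.isOpen_compl hO
  let B : Opens (Rn d) := ⟨Metric.ball x (r / 4), Metric.isOpen_ball⟩
  have hBV : B ≤ V := (Metric.ball_subset_ball (by linarith)).trans hrV
  refine ⟨B, hBV, Metric.mem_ball_self (by linarith), ?_⟩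
  have hres : (fun ε => res hBV (res hV (mollify φ T χ ε))) =
      ∑ l ∈ listsLE d k, (-1 : ℂ) ^ l.length • fun ε => iterPderiv B l (convNet B (g l) φ ε) := by
    ext ε y
    have h2 := congrFun (congrFun (h φ) ε) (Opens.inclusion (hBV.trans hV) y)
    refine h2.trans ?_
    simp only [Finset.sum_apply, Pi.smul_apply]
    refine Finset.sum_congr rfl fun l _ => ?_
    simp only [convNet, iterPderiv_ofGlobal]
    rfl
  rw [hres]
  have hn := fun l => isNet_iterPderiv (isNet_convNet (U := B) (hg l) φ) l
  refine NegligibleEst.sum _ (fun l _ => (hn l).smul _) fun l _ => NegligibleEst.smul (hn l)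
    (negligibleEst_iterPderiv (negligibleEst_convNet hq (hg l) φ (δ := r / 4) (by linarith)
      fun y hy z hz => ?_) l) _
  have hz' : z ∉ Metric.closedBall (x : Rn d) (r / 2) := fun h => hz (hgO l z fun hc => hc h)
  rw [Metric.mem_closedBall, not_le] at hz'
  have hy' : dist y x < r / 4 := hy
  rw [← dist_eq_norm]
  linarith [dist_triangle z y (x : Rn d), dist_comm z y]

end Mollify

/-! ### Mollification of smooth functions -/

section Moments

variable {U V : Opens (Rn d)} {q : ℝ≥0∞}

/-- The convolution with `ψ_ε`, after rescaling the variable of integration. -/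
theorem smear_scale_eq (ε : Par) (ψ : 𝓢(Rn d, ℂ)) (g : Rn d → ℂ) :
    smear g id (scale ε ψ) = smear ψ (fun z => (ε : ℝ) • z) g := by
  ext x
  have hε := ε.2.1
  have h1 := integral_sub_left_eq_self (fun y => g y * scale ε ψ (x - y)) volume x
  have h2 := Measure.integral_comp_smul_of_nonneg (volume : Measure (Rn d))
    (fun u => g (x - u) * ψ ((ε : ℝ)⁻¹ • u)) (ε : ℝ) (hR := hε.le)
  rw [smear, smear]
  simp only [id]
  rw [← h1]
  simp only [sub_sub_cancel, scale_apply]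
  have h3 : ∀ z : Rn d, ψ z * g (x - (ε : ℝ) • z) =
      g (x - (ε : ℝ) • z) * ψ ((ε : ℝ)⁻¹ • (ε : ℝ) • z) := fun z => by
    rw [smul_smul, inv_mul_cancel₀ hε.ne', one_smul, mul_comm]
  simp only [h3]
  rw [h2, finrank_euclideanSpace_fin, Complex.real_smul, ← integral_const_mul]
  refine integral_congr_ae (Filter.Eventually.of_forall fun y => ?_)
  simp only [Complex.ofReal_inv, Complex.ofReal_pow, inv_pow]
  ring

/-- All moments of `ψ`, including the integral, vanish. -/
def AllMomentsVanish (ψ : 𝓢(Rn d, ℂ)) : Prop :=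
  ∀ α : Fin d → ℕ, ∫ x, (∏ i, (x i : ℂ) ^ α i) * ψ x = 0

/-- The product of a Schwartz function and a coordinate function. -/
def coordMul (i : Fin d) (ψ : 𝓢(Rn d, ℂ)) : 𝓢(Rn d, ℂ) :=
  SchwartzMap.smulLeftCLM ℂ (EuclideanSpace.proj i : Rn d →L[ℝ] ℝ) ψ

theorem coordMul_apply (i : Fin d) (ψ : 𝓢(Rn d, ℂ)) (x : Rn d) :
    coordMul i ψ x = (x i : ℂ) * ψ x := by
  rw [coordMul, SchwartzMap.smulLeftCLM_apply_apply (ContinuousLinearMap.hasTemperateGrowth _),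
    Complex.real_smul]
  rfl

theorem integral_moment_coordMul (i : Fin d) (ψ : 𝓢(Rn d, ℂ)) (α : Fin d → ℕ) :
    ∫ x, (∏ j, (x j : ℂ) ^ α j) * coordMul i ψ x =
      ∫ x, (∏ j, (x j : ℂ) ^ (α + Pi.single i 1 : Fin d → ℕ) j) * ψ x := by
  refine integral_congr_ae (Filter.Eventually.of_forall fun x => ?_)
  simp only [coordMul_apply, Pi.add_apply, pow_add, Finset.prod_mul_distrib]
  have : ∏ j, (x j : ℂ) ^ (Pi.single i 1 : Fin d → ℕ) j = x i := by
    rw [Finset.prod_eq_single i (fun j _ hj => by simp [hj]) (by simp)]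
    simp
  rw [this]
  ring

theorem AllMomentsVanish.coordMul {ψ : 𝓢(Rn d, ℂ)} (h : AllMomentsVanish ψ) (i : Fin d) :
    AllMomentsVanish (coordMul i ψ) := fun α => by
  rw [integral_moment_coordMul, h]

theorem IsMollifier.coordMul {φ : 𝓢(Rn d, ℂ)} (h : IsMollifier φ) (i : Fin d) :
    AllMomentsVanish (coordMul i φ) := fun α => by
  rw [integral_moment_coordMul, h.2]
  intro h0
  have := congrFun h0 i
  simp at this

/-- The derivative in `t` of `∫ ψ(z) g(x - t z) dz` is a sum of integrals of the same form, in which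
`ψ` has been multiplied by a coordinate; this makes induction on the order of vanishing possible. -/
theorem hasDerivAt_smear_smul (ψ g : 𝓢(Rn d, ℂ)) (x : Rn d) (t : ℝ) :
    HasDerivAt (fun t : ℝ => smear ψ (fun z => t • z) g x)
      (-∑ i, smear (coordMul i ψ) (fun z => t • z) (sderiv i g) x) t := by
  obtain ⟨C, hC⟩ : ∃ C : ℝ, ∀ y, ‖fderiv ℝ g y‖ ≤ C :=
    ⟨_, fun y => SchwartzMap.norm_le_seminorm ℝ (SchwartzMap.fderivCLM ℝ (Rn d) ℂ g) y⟩
  have hcont : Continuous (fderiv ℝ g) := (g.smooth ⊤).continuous_fderiv (by simp)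
  have hc : ∀ t : ℝ, Measurable fun z : Rn d => t • z := fun t => measurable_const_smul t
  have h := (hasDerivAt_integral_of_dominated_loc_of_deriv_le (μ := (volume : Measure (Rn d)))
    (F := fun (t : ℝ) z => ψ z * g (x - t • z)) (F' := fun t z => ψ z * fderiv ℝ g (x - t • z) (-z))
    (bound := fun z => ‖z‖ ^ 1 * ‖ψ z‖ * C) (x₀ := t) Filter.univ_mem
    (Filter.Eventually.of_forall fun t =>
      (integrable_smear ψ.integrable (hc t) g x).aestronglyMeasurable)
    (integrable_smear ψ.integrable (hc t) g x) ?_ (Filter.Eventually.of_forall fun z t _ => ?_)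
    ((ψ.integrable_pow_mul volume 1).mul_const C) (Filter.Eventually.of_forall fun z t _ => ?_)).2
  · refine HasDerivAt.congr_deriv h (Eq.symm ?_)
    simp only [smear]
    rw [← integral_finsetSum _ fun i _ =>
      integrable_smear (coordMul i ψ).integrable (hc t) (sderiv i g) x, ← integral_neg]
    refine integral_congr_ae (Filter.Eventually.of_forall fun z => ?_)
    rw [fderiv_eq_sum_gderiv]
    change -∑ i, coordMul i ψ z * sderiv i g (x - t • z) = ψ z * _
    simp only [coordMul_apply, coe_sderiv, map_neg]
    simp [_root_.sum_apply, Finset.mul_sum]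
    refine Finset.sum_congr rfl fun i _ => ?_
    ring
  · refine Continuous.aestronglyMeasurable (ψ.continuous.mul ?_)
    exact (hcont.comp (by fun_prop)).clm_apply continuous_neg
  · rw [norm_mul, pow_one]
    calc _ ≤ ‖ψ z‖ * (C * ‖z‖) := by
          refine mul_le_mul_of_nonneg_left ?_ (norm_nonneg _)
          refine (ContinuousLinearMap.le_opNorm _ _).trans ?_
          rw [norm_neg]
          exact mul_le_mul_of_nonneg_right (hC _) (norm_nonneg _)
      _ = _ := by ring
  · have h1 : HasDerivAt (fun t : ℝ => x - t • z) (-z) t := by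
      simpa using ((hasDerivAt_id t).smul_const z).const_sub x
    exact ((g.differentiable (x - t • z)).hasFDerivAt.comp_hasDerivAt t h1).const_mul (ψ z)

/-- One step of the Taylor expansion of `t ↦ ∫ ψ(z) g(x - t z) dz`. -/
theorem exists_norm_smear_sub_le {ψ : 𝓢(Rn d, ℂ)} {n : ℕ}
    (h : ∀ (i : Fin d) (g : 𝓢(Rn d, ℂ)), ∃ C : ℝ, ∀ t ∈ Icc (0 : ℝ) 1, ∀ x,
      ‖smear (coordMul i ψ) (fun z => t • z) g x‖ ≤ C * t ^ n) (g : 𝓢(Rn d, ℂ)) :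
    ∃ C : ℝ, ∀ t ∈ Icc (0 : ℝ) 1, ∀ x,
      ‖smear ψ (fun z => t • z) g x - (∫ z, ψ z) * g x‖ ≤ C * t ^ (n + 1) := by
  choose C hC using fun i => h i (sderiv i g)
  refine ⟨∑ i, |C i|, fun t ht x => ?_⟩
  have h0 : smear ψ (fun z => (0 : ℝ) • z) g x = (∫ z, ψ z) * g x := by
    simp only [smear, zero_smul, sub_zero]
    exact integral_mul_const _ _
  have h1 := norm_image_sub_le_of_norm_deriv_le_segment' (a := 0) (b := t)
    (f := fun t : ℝ => smear ψ (fun z => t • z) g x) (C := (∑ i, |C i|) * t ^ n)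
    (fun s _ => (hasDerivAt_smear_smul ψ g x s).hasDerivWithinAt) (fun s hs => ?_) t
    ⟨ht.1, le_rfl⟩
  · rw [← h0]
    refine h1.trans (le_of_eq ?_)
    ring
  · rw [norm_neg, Finset.sum_mul]
    refine (norm_sum_le _ _).trans (Finset.sum_le_sum fun i _ => ?_)
    refine (hC i s ⟨hs.1, hs.2.le.trans ht.2⟩ x).trans ?_
    exact mul_le_mul (le_abs_self _) (pow_le_pow_left₀ hs.1 hs.2.le n) (pow_nonneg hs.1 n)
      (abs_nonneg _)

/-- If all moments of `ψ` vanish, then `∫ ψ(z) g(x - t z) dz` vanishes at `t = 0` to infinite order,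
uniformly in `x`. -/
theorem AllMomentsVanish.exists_norm_smear_le (n : ℕ) {ψ : 𝓢(Rn d, ℂ)} (h : AllMomentsVanish ψ)
    (g : 𝓢(Rn d, ℂ)) : ∃ C : ℝ, ∀ t ∈ Icc (0 : ℝ) 1, ∀ x,
      ‖smear ψ (fun z => t • z) g x‖ ≤ C * t ^ n := by
  induction n generalizing ψ g with
  | zero =>
    obtain ⟨C, -, hC⟩ := exists_norm_schwartz_le g
    refine ⟨C * ∫ z, ‖ψ z‖, fun t _ x => ?_⟩
    rw [pow_zero, mul_one]
    exact norm_smear_le ψ.integrable fun _ _ => hC _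
  | succ n ih =>
    obtain ⟨C, hC⟩ := exists_norm_smear_sub_le (fun i g => ih (h.coordMul i) g) g
    have h0 : ∫ z, ψ z = 0 := by simpa using h 0
    exact ⟨C, fun t ht x => by simpa [h0] using hC t ht x⟩

/-- The products of a mollifier with the coordinates have vanishing moments, so that mollification
is exact up to errors of arbitrarily high order. -/
theorem IsMollifier.exists_norm_smear_sub_le {φ : 𝓢(Rn d, ℂ)} (hφ : IsMollifier φ) (n : ℕ)
    (g : 𝓢(Rn d, ℂ)) : ∃ C : ℝ, ∀ t ∈ Icc (0 : ℝ) 1, ∀ x,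
      ‖smear φ (fun z => t • z) g x - g x‖ ≤ C * t ^ (n + 1) := by
  obtain ⟨C, hC⟩ := GenFun.exists_norm_smear_sub_le
    (fun i g => (hφ.coordMul i).exists_norm_smear_le n g) g
  exact ⟨C, fun t ht x => by simpa [hφ.1] using hC t ht x⟩

/-- Smooth functions with compact support are approximated by their mollifications up to a
negligible error. -/
theorem negligibleEst_convNet_sub (hq : 1 ≤ q) {φ : 𝓢(Rn d, ℂ)} (hφ : IsMollifier φ)
    {g : Rn d → ℂ} (hg : ContDiff ℝ ∞ g) (hgc : HasCompactSupport g) :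
    NegligibleEst ⊤ q U (convNet U g φ - fun _ => ofGlobal U g) := by
  set G := hgc.toSchwartzMap hg
  have hG : ⇑G = g := rfl
  have hgi : Integrable g := G.integrable
  refine negligibleEst_of_norm_le hq
    ((isNet_convNet hgi φ).sub (isNet_const (isSmooth_ofGlobal hg))) fun l n => ?_
  obtain ⟨C, hC⟩ := hφ.exists_norm_smear_sub_le n (iterSderiv l G)
  refine ⟨|C|, fun ε x => ?_⟩
  have hε := ε.2.1
  have hm : Measurable fun z : Rn d => (ε : ℝ) • z := measurable_const_smul _
  have h1 : iterPderiv U l ((convNet U g φ - fun _ => ofGlobal U g : Par → U → ℂ) ε) =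
      iterPderiv U l (convNet U g φ ε) - iterPderiv U l (ofGlobal U g) := by
    have h2 : (convNet U g φ - fun _ => ofGlobal U g : Par → U → ℂ) ε =
        convNet U g φ ε + (-1 : ℂ) • ofGlobal U g := by
      rw [Pi.sub_apply, neg_one_smul, sub_eq_add_neg]
    have h3 : IsSmooth U ((-1 : ℂ) • ofGlobal U g) :=
      (Smooth U).smul_mem (isSmooth_ofGlobal (U := U) hg) _
    rw [h2, iterPderiv_add l ((isNet_convNet hgi φ).1 ε) h3,
      iterPderiv_smul l _ (isSmooth_ofGlobal hg), neg_one_smul, sub_eq_add_neg]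
  rw [h1, convNet, smear_scale_eq, iterPderiv_ofGlobal, iterPderiv_ofGlobal, ← hG,
    iterGderiv_smear φ.integrable hm, ← coe_iterSderiv]
  refine (hC ε ⟨hε.le, ε.2.2.le⟩ x).trans ?_
  refine mul_le_mul (le_abs_self _) ?_ (by positivity) (abs_nonneg _)
  exact pow_le_pow_of_le_one hε.le ε.2.2.le n.le_succ

theorem smoothToD_apply (f : Smooth U) (ρ : 𝓓(U, ℂ)) :
    smoothToD U f ρ = ∫ y, ρ y * ext U f.1 y := by
  have h : LocallyIntegrableOn (ext U f.1) U :=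
    ContinuousOn.locallyIntegrableOn (ContDiffOn.continuousOn f.2) U.isOpen.measurableSet
  exact TestFunction.integralAgainstBilinCLM_eq_integral h

theorem mollify_smoothToD (φ : 𝓢(Rn d, ℂ)) (f : Smooth U) (χ : 𝓓(U, ℂ)) :
    mollify φ (smoothToD U f) χ = convNet U (mulTest χ f) φ := by
  ext ε x
  rw [mollify, smoothToD_apply, convNet, ofGlobal, smear]
  refine integral_congr_ae (Filter.Eventually.of_forall fun y => ?_)
  change χ y * scale ε φ (x - y) * ext U f.1 y = χ y * ext U f.1 y * scale ε φ (x - y)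
  ring

end Moments

/-! ### The embedding of distributions -/

section Embed

variable {U V : Opens (Rn d)} {q : ℝ≥0∞}

theorem mulTest_apply (χ : 𝓓(U, ℂ)) (ψ : Smooth U) (y : U) : mulTest χ ψ y = χ y * ψ.1 y :=
  congrArg (χ y * ·) (ext_apply ψ.1 y)

theorem mollTest_sub (φ : 𝓢(Rn d, ℂ)) (χ χ' : 𝓓(U, ℂ)) (ε : Par) (x : Rn d) :
    mollTest φ (χ - χ') ε x = mollTest φ χ ε x - mollTest φ χ' ε x :=
  TestFunction.ext fun _ => sub_mul _ _ _

theorem mollify_sub (φ : 𝓢(Rn d, ℂ)) (T : Distr U) (χ χ' : 𝓓(U, ℂ)) :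
    mollify φ T χ - mollify φ T χ' = mollify φ T (χ - χ') := by
  ext ε x
  simp only [mollify, mollTest_sub, map_sub, Pi.sub_apply]

theorem isClassOf_mollify_res (hq : 1 ≤ q) (φ : 𝓢(Rn d, ℂ)) (T : Distr U) (χ : 𝓓(U, ℂ))
    (hV : V ≤ U) : ∃ t : G q V, IsClassOf t (fun ε => res hV (mollify φ T χ ε)) :=
  ⟨_, IsClassOf.resG ⟨isNet_mollify φ T χ, moderateEst_mollify hq φ T χ, rfl⟩ hV⟩

/-- Where two cutoffs agree, the mollifications define the same generalized function. -/
theorem eq_of_isClassOf_mollify (hq : 1 ≤ q) (φ : 𝓢(Rn d, ℂ)) (T : Distr U) {χ χ' : 𝓓(U, ℂ)}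
    (hV : V ≤ U) (h : ∀ x ∈ V, χ x = χ' x) {t t' : G q V}
    (ht : IsClassOf t (fun ε => res hV (mollify φ T χ ε)))
    (ht' : IsClassOf t' (fun ε => res hV (mollify φ T χ' ε))) : t = t' := by
  refine (ht.eq_iff ht').2 ?_
  have := negligibleEst_mollify hq φ T (χ - χ') hV fun x hx => by
    rw [sub_apply, h x hx, sub_self]
  rwa [← mollify_sub] at this

/-- A smooth function with compact support in `U` underlies a test function on `U`. -/
theorem exists_test {f : Rn d → ℂ} (hf : ContDiff ℝ ∞ f) (hc : HasCompactSupport f)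
    (hU : tsupport f ⊆ U) : ∃ χ : 𝓓(U, ℂ), ∀ x, χ x = f x :=
  ⟨⟨f, hf, hc, hU⟩, fun _ => rfl⟩

theorem exists_test_eq_one {K : Set (Rn d)} (hK : IsCompact K) (hKU : K ⊆ U) :
    ∃ (V : Opens (Rn d)) (_ : V ≤ U) (χ : 𝓓(U, ℂ)), K ⊆ V ∧ ∀ y ∈ V, χ y = 1 := by
  obtain ⟨f, hf, hc, hU, h1⟩ := exists_cutoff hK U.isOpen hKU
  obtain ⟨χ, hχ⟩ := exists_test hf hc hU
  obtain ⟨O, hO, hKO, hO1⟩ := eventually_nhdsSet_iff_exists.1 h1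
  refine ⟨⟨O ∩ U, hO.inter U.isOpen⟩, inter_subset_right, χ, subset_inter hKO hKU, fun y hy => ?_⟩
  rw [hχ, hO1 y hy.1]

/-- The characteristic property of the image of a distribution `T` in `G_q(U)`: on every open set on
which the cutoff `χ` is `1`, it is the class of the mollification of `χ T`. -/
def IsEmbedded (φ : 𝓢(Rn d, ℂ)) (T : Distr U) (t : G q U) : Prop :=
  ∀ (V : Opens (Rn d)) (hV : V ≤ U) (χ : 𝓓(U, ℂ)), (∀ x ∈ V, χ x = 1) →
    IsClassOf (resG q hV t) (fun ε => res hV (mollify φ T χ ε))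

theorem IsEmbedded.unique {φ : 𝓢(Rn d, ℂ)} {T : Distr U} {t t' : G q U}
    (h : IsEmbedded φ T t) (h' : IsEmbedded φ T t') : t = t' := by
  refine eq_of_resG_eq fun x => ?_
  obtain ⟨V, hV, χ, hxV, hχ⟩ := exists_test_eq_one (isCompact_singleton (x := (x : Rn d)))
    (singleton_subset_iff.2 x.2)
  exact ⟨V, hV, hxV rfl, (h V hV χ hχ).unique (h' V hV χ hχ)⟩

/-- The mollifications with different cutoffs glue to a generalized function. -/
theorem exists_isEmbedded (hq : 1 ≤ q) (φ : 𝓢(Rn d, ℂ)) (T : Distr U) :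
    ∃ t : G q U, IsEmbedded φ T t := by
  -- the cover of `U` by all open sets on which some cutoff is `1`, each with all such cutoffs
  let ι := {p : Opens (Rn d) × 𝓓(U, ℂ) // p.1 ≤ U ∧ ∀ x ∈ p.1, p.2 x = 1}
  let W : ι → Opens (Rn d) := fun i => i.1.1
  choose s hs using fun i : ι => isClassOf_mollify_res hq φ T i.1.2 i.2.1
  obtain ⟨t, ht⟩ := exists_glue W s fun i j =>
    eq_of_isClassOf_mollify hq φ T (inf_le_left.trans i.2.1)
      (fun x hx => (i.2.2 x hx.1).trans (j.2.2 x hx.2).symm)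
      ((hs i).resG inf_le_left) ((hs j).resG inf_le_right)
  have hU : U ≤ iSup W := by
    intro x hx
    obtain ⟨V, hV, χ, hxV, hχ⟩ := exists_test_eq_one (isCompact_singleton (x := x))
      (singleton_subset_iff.2 hx)
    exact Opens.mem_iSup.2 ⟨⟨(V, χ), hV, hχ⟩, hxV rfl⟩
  refine ⟨resG q hU t, fun V hV χ hχ => ?_⟩
  rw [resG_resG]
  have := ht ⟨(V, χ), hV, hχ⟩
  rw [this]
  exact hs ⟨(V, χ), hV, hχ⟩

/-- The embedding of the distributions into the generalized functions, given by mollification. -/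
def embed (hq : 1 ≤ q) (φ : 𝓢(Rn d, ℂ)) (U : Opens (Rn d)) : Distr U →ₗ[ℂ] G q U where
  toFun T := (exists_isEmbedded hq φ T).choose
  map_add' T S := by
    refine (exists_isEmbedded hq φ (T + S)).choose_spec.unique fun V hV χ hχ => ?_
    rw [map_add]
    exact ((exists_isEmbedded hq φ T).choose_spec V hV χ hχ).add
      ((exists_isEmbedded hq φ S).choose_spec V hV χ hχ)
  map_smul' c T := by
    refine (exists_isEmbedded hq φ (c • T)).choose_spec.unique fun V hV χ hχ => ?_
    rw [RingHom.id_apply, map_smul]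
    exact ((exists_isEmbedded hq φ T).choose_spec V hV χ hχ).smul c

theorem isEmbedded_embed (hq : 1 ≤ q) (φ : 𝓢(Rn d, ℂ)) (T : Distr U) :
    IsEmbedded φ T (embed hq φ U T) :=
  (exists_isEmbedded hq φ T).choose_spec

theorem coe_monoCLM (h : V ≤ U) (χ : 𝓓(V, ℂ)) :
    ⇑(TestFunction.monoCLM ℂ χ : 𝓓(U, ℂ)) = χ := by
  rw [TestFunction.monoCLM_apply, if_pos ⟨le_rfl, h⟩]

theorem mollify_resD (φ : 𝓢(Rn d, ℂ)) (h : V ≤ U) (T : Distr U) (χ : 𝓓(V, ℂ)) :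
    mollify φ (resD h T) χ =
      fun ε => res h (mollify φ T (TestFunction.monoCLM ℂ χ : 𝓓(U, ℂ)) ε) := by
  ext ε x
  change T _ = T _
  refine congrArg T (TestFunction.ext fun y => ?_)
  refine (congrFun (coe_monoCLM h (mollTest φ χ ε x)) y).trans ?_
  change χ y * _ = (TestFunction.monoCLM ℂ χ : 𝓓(U, ℂ)) y * _
  rw [coe_monoCLM h]

theorem embed_resD (hq : 1 ≤ q) (φ : 𝓢(Rn d, ℂ)) (h : V ≤ U) (T : Distr U) :
    embed hq φ V (resD h T) = resG q h (embed hq φ U T) := by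
  refine (isEmbedded_embed hq φ (resD h T)).unique fun W hW χ hχ => ?_
  rw [resG_resG, mollify_resD]
  exact isEmbedded_embed hq φ T W (hW.trans h) _ fun x hx => by rw [coe_monoCLM h, hχ x hx]

open scoped Manifold in
/-- A distribution vanishes on test functions that vanish near its support. -/
theorem eq_zero_of_eventuallyEq_zero (T : Distr U) (ρ : 𝓓(U, ℂ))
    (h : ∀ᶠ y in 𝓝ˢ (Subtype.val '' suppD T), ρ y = 0) : T ρ = 0 := by
  have hex : ∀ y : tsupport ρ, ∃ s : Set (Rn d),
      Distribution.IsVanishingOn T s ∧ IsOpen s ∧ (y : Rn d) ∈ s := by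
    intro y
    rw [← Distribution.notMem_dsupport_iff]
    intro hy
    have hyU : (y : Rn d) ∈ U := ρ.tsupport_subset y.2
    have h1 : ∀ᶠ z in 𝓝 (y : Rn d), ρ z = 0 :=
      (eventually_nhdsSet_iff_forall.1 h) y ⟨⟨y, hyU⟩, hy, rfl⟩
    exact notMem_tsupport_iff_eventuallyEq.2 h1 y.2
  choose s hs hso hys using hex
  obtain ⟨I, hI⟩ := ρ.hasCompactSupport.isCompact.elim_finite_subcover s hso
    fun y hy => mem_iUnion.2 ⟨⟨y, hy⟩, hys _⟩
  have hI' : tsupport ρ ⊆ ⋃ i : I, s i := by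
    refine hI.trans (iUnion₂_subset fun i hi => subset_iUnion_of_subset ⟨i, hi⟩ subset_rfl)
  obtain ⟨f, hf⟩ := SmoothPartitionOfUnity.exists_isSubordinate 𝓘(ℝ, Rn d) (isClosed_tsupport ρ)
    (fun i : I => s i) (fun i => hso i) hI'
  have hsm : ∀ i, IsSmooth U (ofGlobal U fun x => (f i x : ℂ)) := fun i =>
    isSmooth_ofGlobal (Complex.ofRealCLM.contDiff.comp (f i).contMDiff.contDiff)
  have hval : ∀ i y, mulTest ρ ⟨_, hsm i⟩ y = ρ y * f i y := by
    intro i y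
    by_cases hy : y ∈ U
    · exact mulTest_apply ρ ⟨_, hsm i⟩ ⟨y, hy⟩
    · change ρ y * _ = _
      rw [image_eq_zero_of_notMem_tsupport fun h => hy (ρ.tsupport_subset h), zero_mul, zero_mul]
  have hsum : ρ = ∑ i : I, mulTest ρ ⟨_, hsm i⟩ := by
    ext y
    rw [sum_apply]
    simp only [hval]
    by_cases hy : y ∈ tsupport ρ
    · have h1 := f.sum_eq_one hy
      rw [finsum_eq_sum_of_fintype] at h1
      rw [← Finset.mul_sum, ← Complex.ofReal_sum, h1, Complex.ofReal_one, mul_one]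
    · simp [image_eq_zero_of_notMem_tsupport hy]
  rw [hsum, map_sum]
  refine Finset.sum_eq_zero fun i _ => hs i _ ?_
  have h2 : ⇑(mulTest ρ ⟨_, hsm i⟩) = fun y => ρ y * (f i y : ℂ) := funext (hval i)
  rw [h2]
  refine tsupport_mul_subset_right.trans ((closure_mono fun y hy => ?_).trans (hf i))
  simpa using hy

/-- A cutoff that is `1` near the support of the distribution may be used on all of `U`. Such a
cutoff exists only if the support is compact. -/
theorem isClassOf_embed_of_isCompact (hq : 1 ≤ q) (φ : 𝓢(Rn d, ℂ)) (T : Distr U) (χ : 𝓓(U, ℂ))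
    (hχ : ∀ᶠ y in 𝓝ˢ (Subtype.val '' suppD T), χ y = 1) :
    IsClassOf (embed hq φ U T) (mollify φ T χ) := by
  refine ⟨isNet_mollify φ T χ, moderateEst_mollify hq φ T χ, Eq.symm ?_⟩
  refine IsEmbedded.unique (fun V hV χ' hχ' => ?_) (isEmbedded_embed hq φ T)
  set ψ : Smooth U := ⟨ofGlobal U χ', isSmooth_ofGlobal χ'.contDiff⟩
  have hψ : ∀ y, mulTest χ ψ y = χ y * χ' y := by
    intro y
    by_cases hy : y ∈ U
    · exact mulTest_apply χ ψ ⟨y, hy⟩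
    · change χ y * _ = _
      rw [image_eq_zero_of_notMem_tsupport fun h => hy (χ.tsupport_subset h), zero_mul, zero_mul]
  -- the product of the two cutoffs agrees with `χ'` near the support of `T`, so that it leads to the
  -- same mollification, and agrees with `χ` on `V`, so that it leads to the same class there
  have h1 : mollify φ T χ' = mollify φ T (mulTest χ ψ) := by
    rw [← sub_eq_zero, mollify_sub]
    ext ε x
    refine eq_zero_of_eventuallyEq_zero T _ (hχ.mono fun y hy => ?_)
    change (χ' - mulTest χ ψ) y * _ = 0
    rw [sub_apply, hψ, hy, one_mul, sub_self, zero_mul]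
  rw [h1]
  obtain ⟨t, ht⟩ := isClassOf_mollify_res hq φ T (mulTest χ ψ) hV
  have h2 : IsClassOf (resG q hV (cls q U ⟨Net.of (mollify φ T χ) (isNet_mollify φ T χ),
      moderateEst_mollify hq φ T χ⟩)) (fun ε => res hV (mollify φ T χ ε)) :=
    IsClassOf.resG ⟨_, _, rfl⟩ hV
  rw [eq_of_isClassOf_mollify hq φ T hV (fun x hx => ?_) h2 ht]
  · exact ht
  · rw [hψ, hχ' x hx, mul_one]

/-- Constant nets are moderate for every `q`, as the weight `ε` makes them integrable. -/
theorem moderateEst_of_const (hq : 1 ≤ q) {f : U → ℂ} (hf : IsSmooth U f) :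
    ModerateEst ⊤ q U fun _ => f := fun k W hW =>
  ⟨1, parNorm_lt_top_of_le hq (C := (sobolevNorm U k ⊤ W f).toReal) fun ε => by
    rw [ENNReal.ofReal_toReal (sobolevNorm_ne_top hf k hW), Real.rpow_one, mul_comm]⟩

/-- On smooth functions the embedding is given by constant nets. -/
theorem isClassOf_embed_smoothToD (hq : 1 ≤ q) {φ : 𝓢(Rn d, ℂ)} (hφ : IsMollifier φ)
    (f : Smooth U) : IsClassOf (embed hq φ U (smoothToD U f)) (fun _ => f.1) := by
  have hm := moderateEst_of_const hq f.2
  refine ⟨isNet_const f.2, hm, eq_of_resG_eq fun x => ?_⟩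
  obtain ⟨V, hV, χ, hxV, hχ⟩ := exists_test_eq_one (isCompact_singleton (x := (x : Rn d)))
    (singleton_subset_iff.2 x.2)
  have h1 : IsClassOf (resG q hV (cls q U ⟨Net.of (fun _ => f.1) (isNet_const f.2), hm⟩))
      (fun _ => res hV f.1) := IsClassOf.resG ⟨_, _, rfl⟩ hV
  have h2 := isEmbedded_embed hq φ (smoothToD U f) V hV χ hχ
  have h3 : ofGlobal V (mulTest χ f) = res hV f.1 := by
    ext y
    refine (mulTest_apply χ f (Opens.inclusion hV y)).trans ?_
    rw [show χ (Opens.inclusion hV y) = 1 from hχ y y.2, one_mul]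
    rfl
  -- the product of `f` with the cutoff, which is `f` on `V`, has compact support
  have h4 := negligibleEst_convNet_sub (U := V) hq hφ (mulTest χ f).contDiff
    (mulTest χ f).hasCompactSupport
  rw [h3] at h4
  rw [mollify_smoothToD] at h2
  exact ⟨V, hV, hxV rfl, (h2.of_negligible (isNet_const (f.2.res hV)) h4).unique h1⟩

theorem embed_smoothToD_mul (hq : 1 ≤ q) {φ : 𝓢(Rn d, ℂ)} (hφ : IsMollifier φ)
    (f g : Smooth U) : embed hq φ U (smoothToD U (f * g)) =
      smoothToG U f • embed hq φ U (smoothToD U g) := by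
  obtain ⟨hn, hm, h⟩ := isClassOf_embed_smoothToD hq hφ g
  rw [h]
  exact (isClassOf_embed_smoothToD hq hφ (f * g)).unique (isClassOf_smoothToG_smul f _)

end Embed

/-! ### Injectivity of the embedding, and supports -/

section Injective

variable {U V : Opens (Rn d)} {q : ℝ≥0∞}

/-- The reflected function `x ↦ φ(-x)`. -/
def reflect (φ : 𝓢(Rn d, ℂ)) : 𝓢(Rn d, ℂ) :=
  SchwartzMap.compCLMOfContinuousLinearEquiv ℂ (ContinuousLinearEquiv.neg ℝ) φ

theorem scale_reflect (ε : Par) (φ : 𝓢(Rn d, ℂ)) (x y : Rn d) :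
    scale ε (reflect φ) (y - x) = scale ε φ (x - y) := by
  rw [scale_apply, scale_apply]
  change _ * φ (-((ε : ℝ)⁻¹ • (y - x))) = _
  rw [← smul_neg, neg_sub]

theorem integral_reflect (φ : 𝓢(Rn d, ℂ)) : ∫ z, reflect φ z = ∫ z, φ z :=
  integral_neg_eq_self φ volume

theorem iterGderiv_comp_sub (l : List (Fin d)) (g : Rn d → ℂ) (x : Rn d) :
    iterGderiv l (fun y => g (y - x)) = fun y => iterGderiv l g (y - x) := by
  induction l generalizing g with
  | nil => rfl
  | cons i l ih =>
    rw [iterGderiv, iterGderiv, ← ih]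
    congr 1
    ext y
    simp only [gderiv]
    rw [fderiv_comp_sub]

/-- Integration by parts, followed by rescaling the variable of integration. -/
theorem smear_iterSderiv_scale (ε : Par) (ψ ρ : 𝓢(Rn d, ℂ)) (l : List (Fin d)) :
    smear ρ id (iterSderiv l (scale ε ψ)) = smear ψ (fun z => (ε : ℝ) • z) (iterSderiv l ρ) := by
  rw [← iterGderiv_smear ρ.integrable measurable_id, smear_scale_eq,
    iterGderiv_smear ψ.integrable (measurable_const_smul _)]

/-- Approximate identities converge at least linearly in the parameter. -/
theorem exists_norm_smear_sub_le_mul (ψ g : 𝓢(Rn d, ℂ)) : ∃ C : ℝ, ∀ t ∈ Icc (0 : ℝ) 1, ∀ x,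
    ‖smear ψ (fun z => t • z) g x - (∫ z, ψ z) * g x‖ ≤ C * t := by
  have h : ∀ (i : Fin d) (g : 𝓢(Rn d, ℂ)), ∃ C : ℝ, ∀ t ∈ Icc (0 : ℝ) 1, ∀ x,
      ‖smear (coordMul i ψ) (fun z => t • z) g x‖ ≤ C * t ^ 0 := fun i g => by
    obtain ⟨C, -, hC⟩ := exists_norm_schwartz_le g
    refine ⟨C * ∫ z, ‖coordMul i ψ z‖, fun t _ x => ?_⟩
    rw [pow_zero, mul_one]
    exact norm_smear_le (coordMul i ψ).integrable fun _ _ => hC _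
  obtain ⟨C, hC⟩ := exists_norm_smear_sub_le h g
  exact ⟨C, by simpa using hC⟩

/-- The integrability behind the exchange of integrals in pairing a mollification with a test
function. -/
theorem integrable_prod_smear {ρ h : Rn d → ℂ} (hρ : Integrable ρ) (hh : Integrable h)
    (K : 𝓢(Rn d, ℂ)) : Integrable (Function.uncurry fun x y => ρ x * (h y * K (y - x)))
      ((volume : Measure (Rn d)).prod volume) := by
  obtain ⟨C, -, hC⟩ := exists_norm_schwartz_le K
  have h1 := (hρ.mul_prod hh).mul_bdd (c := C) (g := fun z : Rn d × Rn d => K (z.2 - z.1))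
    (K.continuous.comp (continuous_snd.sub continuous_fst)).aestronglyMeasurable
    (Filter.Eventually.of_forall fun _ => hC _)
  refine h1.congr (Filter.Eventually.of_forall fun z => ?_)
  exact mul_assoc _ _ _

/-- Mollifications converge to the distribution: tested against `ρ`, the error is `O(ε)`. -/
theorem exists_norm_integral_mollTest_sub_le {φ : 𝓢(Rn d, ℂ)} (hφ : ∫ x, φ x = 1) (T : Distr U)
    (χ ρ : 𝓓(U, ℂ)) (hχ : ∀ y, χ y * ρ y = ρ y) : ∃ C : ℝ, ∀ ε : Par,
      ‖(∫ x, ρ x * T (mollTest φ χ ε x)) - T ρ‖ ≤ C * ε := by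
  obtain ⟨k, g, hg, -, hT⟩ := exists_structure T χ U.isOpen χ.tsupport_subset
  let R : 𝓢(Rn d, ℂ) := ρ.hasCompactSupport.toSchwartzMap ρ.contDiff
  have hR : ⇑R = ρ := rfl
  choose C hC using fun l => exists_norm_smear_sub_le_mul (reflect φ) (iterSderiv l R)
  simp only [integral_reflect, hφ, one_mul] at hC
  refine ⟨∑ l ∈ listsLE d k, C l * ∫ y, ‖g l y‖, fun ε => ?_⟩
  have hε : (ε : ℝ) ∈ Icc (0 : ℝ) 1 := ⟨ε.2.1.le, ε.2.2.le⟩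
  let K : List (Fin d) → 𝓢(Rn d, ℂ) := fun l => iterSderiv l (scale ε (reflect φ))
  have h1 : ∀ x, T (mollTest φ χ ε x) = ∑ l ∈ listsLE d k, ∫ y, g l y * K l (y - x) := by
    intro x
    have hΨ : ContDiff ℝ ∞ fun y : Rn d => scale ε (reflect φ) (y - x) :=
      ((scale ε (reflect φ)).smooth ⊤).comp (contDiff_id.sub contDiff_const)
    rw [hT _ hΨ _ fun y => by rw [scale_reflect]; rfl]
    refine Finset.sum_congr rfl fun l _ => ?_
    rw [iterGderiv_comp_sub, ← coe_iterSderiv]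
  have hint := fun l => integrable_prod_smear R.integrable (hg l) (K l)
  have hint' : ∀ l, Integrable fun x => ∫ y, R x * (g l y * K l (y - x)) :=
    fun l => (hint l).integral_prod_left
  have h2 : ∫ x, ρ x * T (mollTest φ χ ε x) = ∑ l ∈ listsLE d k,
      ∫ y, g l y * smear (reflect φ) (fun z => (ε : ℝ) • z) (iterSderiv l R) y := by
    have h3 : ∀ x, ρ x * T (mollTest φ χ ε x) =
        ∑ l ∈ listsLE d k, ∫ y, R x * (g l y * K l (y - x)) := fun x => by
      rw [h1, Finset.mul_sum]
      simp only [integral_const_mul]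
      rfl
    simp only [h3]
    rw [integral_finsetSum _ fun l _ => hint' l]
    refine Finset.sum_congr rfl fun l _ => ?_
    rw [integral_integral_swap (hint l)]
    refine integral_congr_ae (Filter.Eventually.of_forall fun y => ?_)
    simp only
    rw [← smear_iterSderiv_scale, smear, ← integral_const_mul]
    refine integral_congr_ae (Filter.Eventually.of_forall fun x => ?_)
    simp only [id, K]
    ring
  have h4 : T ρ = ∑ l ∈ listsLE d k, ∫ y, g l y * iterSderiv l R y := by
    simp only [coe_iterSderiv]
    exact hT ρ ρ.contDiff ρ fun y => (hχ y).symm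
  have hb : ∀ (l : List (Fin d)) (S : 𝓢(Rn d, ℂ)), Integrable fun y => g l y * S y := fun l S => by
    obtain ⟨B, -, hB⟩ := exists_norm_schwartz_le S
    exact (hg l).mul_bdd (c := B) S.continuous.aestronglyMeasurable
      (Filter.Eventually.of_forall hB)
  have hb' : ∀ l : List (Fin d), Integrable fun y =>
      g l y * smear (reflect φ) (fun z => (ε : ℝ) • z) (iterSderiv l R) y := fun l => by
    obtain ⟨B, -, hB⟩ := exists_norm_schwartz_le (iterSderiv l R)
    exact (hg l).mul_bdd (c := B * ∫ z, ‖reflect φ z‖)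
      (contDiff_smear (reflect φ).integrable (measurable_const_smul _)
        (iterSderiv l R)).continuous.aestronglyMeasurable
      (Filter.Eventually.of_forall fun y =>
        norm_smear_le (reflect φ).integrable fun _ _ => hB _)
  rw [h2, h4, ← Finset.sum_sub_distrib, Finset.sum_mul]
  refine (norm_sum_le _ _).trans (Finset.sum_le_sum fun l _ => ?_)
  rw [← integral_sub (hb' l) (hb l _), mul_right_comm, ← integral_const_mul]
  refine norm_integral_le_of_norm_le ((hg l).norm.const_mul _)
    (Filter.Eventually.of_forall fun y => ?_)
  rw [← mul_sub, norm_mul, mul_comm]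
  exact mul_le_mul_of_nonneg_right (hC l ε hε y) (norm_nonneg _)

theorem IsClassOf.negligibleEst {x : G q U} {f : Par → U → ℂ} (h : IsClassOf x f) (hx : x = 0) :
    NegligibleEst ⊤ q U f := by
  obtain ⟨hn, hm, h⟩ := h
  rw [hx] at h
  have h' := cls_eq_zero_iff.1 h.symm
  exact h'

/-- If the mollifications are negligible, their pairings with a test function `ρ` are arbitrarily
small for suitable small parameters, while they converge to `T ρ`. -/
theorem injective_embed (hq : 1 ≤ q) {φ : 𝓢(Rn d, ℂ)} (hφ : ∫ x, φ x = 1) :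
    Function.Injective (embed hq φ U) := by
  refine (injective_iff_map_eq_zero _).2 fun T hT => ContinuousLinearMap.ext fun ρ => ?_
  obtain ⟨V, hV, χ, hKV, hχ⟩ := exists_test_eq_one ρ.hasCompactSupport ρ.tsupport_subset
  have hχρ : ∀ y, χ y * ρ y = ρ y := fun y => by
    by_cases hy : y ∈ tsupport ρ
    · rw [hχ y (hKV hy), one_mul]
    · rw [image_eq_zero_of_notMem_tsupport hy, mul_zero]
  obtain ⟨C, hC⟩ := exists_norm_integral_mollTest_sub_le hφ T χ ρ hχρ
  have hneg : NegligibleEst ⊤ q V (fun ε => res hV (mollify φ T χ ε)) := by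
    refine (isEmbedded_embed hq φ T V hV χ hχ).negligibleEst ?_
    rw [hT, map_zero]
  have : LocallyCompactSpace V := V.isOpen.locallyCompactSpace
  have hK : IsCompact (Subtype.val ⁻¹' tsupport ρ : Set V) := by
    refine (Topology.IsInducing.subtypeVal.isCompact_preimage_iff ?_).2 ρ.hasCompactSupport
    rw [Subtype.range_coe]
    exact hKV
  obtain ⟨W, hWo, hKW, hWc⟩ := exists_isOpen_superset_and_isCompact_closure hK
  have hW := hneg 0 ⟨W, hWo⟩ hWc (-1)
  have hbound : ∀ η : ℝ, 0 < η → ‖T ρ‖ ≤ (|C| + ∫ x, ‖ρ x‖) * η := by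
    intro η hη
    obtain ⟨ε, hεη, hε⟩ := exists_lt_of_parNorm_lt_top hq hW hη hη
    have hpt : ∀ x ∈ tsupport ρ, ‖T (mollTest φ χ ε x)‖ ≤ η := by
      intro x hx
      rw [← ENNReal.ofReal_le_ofReal_iff hη.le, ofReal_norm]
      refine le_trans ?_ hε.le
      rw [sobolevNorm_top_eq_supDeriv (((isNet_mollify φ T χ).res hV).1 ε)]
      exact le_supDeriv (U := V) (l := []) (x := ⟨x, hKV hx⟩) le_rfl
        (mem_image_of_mem Subtype.val (hKW (show x ∈ tsupport ρ from hx)))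
    have h1 : ‖∫ x, ρ x * T (mollTest φ χ ε x)‖ ≤ η * ∫ x, ‖ρ x‖ := by
      have hρ : Integrable ρ := (ρ.hasCompactSupport.toSchwartzMap ρ.contDiff).integrable
      rw [← integral_const_mul]
      refine norm_integral_le_of_norm_le (hρ.norm.const_mul η)
        (Filter.Eventually.of_forall fun x => ?_)
      by_cases hx : x ∈ tsupport ρ
      · rw [norm_mul, mul_comm]
        exact mul_le_mul_of_nonneg_right (hpt x hx) (norm_nonneg _)
      · simp [image_eq_zero_of_notMem_tsupport hx]
    have h2 : C * ε ≤ |C| * η :=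
      mul_le_mul (le_abs_self _) hεη.le ε.2.1.le (abs_nonneg _)
    have h3 := norm_sub_norm_le (T ρ) (∫ x, ρ x * T (mollTest φ χ ε x))
    rw [norm_sub_rev] at h3
    linarith [hC ε]
  rw [zero_apply, ← norm_le_zero_iff]
  refine le_of_forall_pos_le_add fun c hc => ?_
  have hpos : 0 < |C| + (∫ x, ‖ρ x‖) + 1 := by positivity
  have h1 := hbound (c / (|C| + (∫ x, ‖ρ x‖) + 1)) (by positivity)
  have h2 : (|C| + ∫ x, ‖ρ x‖) * (c / (|C| + (∫ x, ‖ρ x‖) + 1)) ≤ c := by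
    rw [mul_div_assoc', div_le_iff₀ hpos]
    nlinarith
  linarith

theorem resD_eq_zero_iff (h : V ≤ U) (T : Distr U) :
    resD h T = 0 ↔ Distribution.IsVanishingOn T V := by
  constructor
  · intro h0 u hu
    let v : 𝓓(V, ℂ) := ⟨u, u.contDiff, u.hasCompactSupport, hu⟩
    have h1 : (TestFunction.monoCLM ℂ v : 𝓓(U, ℂ)) = u :=
      TestFunction.ext fun y => congrFun (coe_monoCLM h v) y
    rw [← h1]
    exact congrArg (fun S : Distr V => S v) h0
  · intro h0
    refine ContinuousLinearMap.ext fun v => h0 (TestFunction.monoCLM ℂ v : 𝓓(U, ℂ)) ?_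
    rw [coe_monoCLM h]
    exact v.tsupport_subset

/-- By naturality and injectivity, the image of a distribution vanishes on an open set exactly if
the distribution does. -/
theorem suppG_embed (hq : 1 ≤ q) {φ : 𝓢(Rn d, ℂ)} (hφ : ∫ x, φ x = 1) (T : Distr U) :
    suppG (embed hq φ U T) = suppD T := by
  have key : ∀ (V : Opens (Rn d)) (h : V ≤ U),
      resG q h (embed hq φ U T) = 0 ↔ Distribution.IsVanishingOn T V := fun V h => by
    rw [← embed_resD, map_eq_zero_iff _ (injective_embed hq hφ), resD_eq_zero_iff]
  ext y
  change (∀ (V : Opens (Rn d)) (h : V ≤ U), (y : Rn d) ∈ V → _) ↔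
    (y : Rn d) ∈ Distribution.dsupport T
  rw [Distribution.mem_dsupport_iff_not_isVanishingOn]
  constructor
  · intro h s hs hso hv
    refine h ⟨s ∩ U, hso.inter U.isOpen⟩ inter_subset_right ⟨hs, y.2⟩ ((key _ _).2 ?_)
    exact hv.mono inter_subset_left
  · intro h V hV hy h0
    exact h V hy V.isOpen ((key V hV).1 h0)

end Injective

end GenFun

end

theorem mainTheorem8 (d : ℕ) (q : ℝ≥0∞) (hq : 1 ≤ q) (φ : 𝓢(Rn d, ℂ)) (hφ : IsMollifier φ) :
    -- the spaces do not depend on the exponent of the Sobolev norms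
    (∀ p : ℝ≥0∞, 1 ≤ p → ∀ (U : Opens (Rn d)) (f : Net U),
      (f ∈ E q U ↔ ModerateEst p q U f.toFun) ∧ (f ∈ N q U ↔ NegligibleEst p q U f.toFun)) ∧
    -- `G_q` is a fine sheaf of modules over the generalized constants
    (GPresheaf d q).IsSheaf ∧ IsFine (GPresheaf d q) ∧
    -- `G_∞` is a sheaf of differential algebras
    (GPresheaf d ⊤).IsSheaf ∧
    (∀ (U : Opens (Rn d)) (f g : E ⊤ U),
      IsClassOf (cls ⊤ U f * cls ⊤ U g) (f.1.toFun * g.1.toFun)) ∧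
    (∀ (U : Opens (Rn d)) (c : GenConst) (a b : G ⊤ U), c • (a * b) = (c • a) * b) ∧
    (∀ (U V : Opens (Rn d)) (h : V ≤ U), resG ⊤ h 1 = 1 ∧
      ∀ a b : G ⊤ U, resG ⊤ h (a * b) = resG ⊤ h a * resG ⊤ h b) ∧
    (∀ (U : Opens (Rn d)) (i : Fin d) (a b : G ⊤ U),
      pderivG ⊤ U i (a * b) = pderivG ⊤ U i a * b + a * pderivG ⊤ U i b) ∧
    (∀ (U : Opens (Rn d)) (i j : Fin d) (a : G ⊤ U),
      pderivG ⊤ U i (pderivG ⊤ U j a) = pderivG ⊤ U j (pderivG ⊤ U i a)) ∧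
    (∀ (U : Opens (Rn d)) (i : Fin d) (c : GenConst) (a : G ⊤ U),
      pderivG ⊤ U i (c • a) = c • pderivG ⊤ U i a) ∧
    (∀ (U V : Opens (Rn d)) (h : V ≤ U) (i : Fin d) (a : G ⊤ U),
      resG ⊤ h (pderivG ⊤ U i a) = pderivG ⊤ V i (resG ⊤ h a)) ∧
    -- `G_q` is a sheaf of differential modules over `G_∞`
    (∀ (U : Opens (Rn d)) (f : E ⊤ U) (g : E q U),
      IsClassOf (cls ⊤ U f • cls q U g) (f.1.toFun * g.1.toFun)) ∧
    (∀ (U : Opens (Rn d)) (c : GenConst) (a : G ⊤ U) (x : G q U),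
      c • (a • x) = (c • a) • x ∧ a • (c • x) = c • (a • x)) ∧
    (∀ (U V : Opens (Rn d)) (h : V ≤ U) (a : G ⊤ U) (x : G q U),
      resG q h (a • x) = resG ⊤ h a • resG q h x) ∧
    (∀ (U : Opens (Rn d)) (i : Fin d) (f : E q U),
      IsClassOf (pderivG q U i (cls q U f)) (fun ε => pderiv U i (f.1.toFun ε))) ∧
    (∀ (U : Opens (Rn d)) (i : Fin d) (a : G ⊤ U) (x : G q U),
      pderivG q U i (a • x) = pderivG ⊤ U i a • x + a • pderivG q U i x) ∧
    (∀ (U : Opens (Rn d)) (i j : Fin d) (x : G q U),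
      pderivG q U i (pderivG q U j x) = pderivG q U j (pderivG q U i x)) ∧
    (∀ (U : Opens (Rn d)) (i : Fin d) (c : GenConst) (x : G q U),
      pderivG q U i (c • x) = c • pderivG q U i x) ∧
    (∀ (U V : Opens (Rn d)) (h : V ≤ U) (i : Fin d) (x : G q U),
      resG q h (pderivG q U i x) = pderivG q V i (resG q h x)) ∧
    -- `C^∞` is a sheaf of differential subalgebras of `G_∞`, so that `G_q` is a sheaf of
    -- differential modules over `C^∞`
    (∀ U : Opens (Rn d), Function.Injective (smoothToG U)) ∧
    (∀ (U V : Opens (Rn d)) (h : V ≤ U) (f : Smooth U),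
      resG ⊤ h (smoothToG U f) = smoothToG V (Smooth.res h f)) ∧
    (∀ (U : Opens (Rn d)) (i : Fin d) (f : Smooth U),
      pderivG ⊤ U i (smoothToG U f) = smoothToG U (Smooth.pderiv i f)) ∧
    (∀ (U : Opens (Rn d)) (f : Smooth U) (g : E q U),
      IsClassOf (smoothToG U f • cls q U g) (fun ε => f.1 * g.1.toFun ε)) ∧
    -- the sheaf embedding of the distributions
    ∃ ι : (U : Opens (Rn d)) → (Distr U →ₗ[ℂ] G q U),
      (∀ U : Opens (Rn d), Function.Injective (ι U)) ∧
      (∀ (U V : Opens (Rn d)) (h : V ≤ U) (T : Distr U), ι V (resD h T) = resG q h (ι U T)) ∧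
      (∀ (U : Opens (Rn d)) (T : Distr U) (χ : 𝓓(U, ℂ)), IsCompact (suppD T) →
        (∀ᶠ y in 𝓝ˢ (Subtype.val '' suppD T), χ y = 1) →
          IsClassOf (ι U T) (mollify φ T χ)) ∧
      (∀ (U : Opens (Rn d)) (T : Distr U), suppG (ι U T) = suppD T) ∧
      (∀ (U : Opens (Rn d)) (f : Smooth U), IsClassOf (ι U (smoothToD U f)) (fun _ => f.1)) ∧
      (∀ (U : Opens (Rn d)) (f g : Smooth U),
        ι U (smoothToD U (f * g)) = smoothToG U f • ι U (smoothToD U g)) := by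
  refine ⟨fun p hp U f => ⟨moderateEst_iff_of_exponent hp f.isNet,
      negligibleEst_iff_of_exponent hp f.isNet⟩,
    isSheaf_GPresheaf d q, isFine_GPresheaf d q, isSheaf_GPresheaf d ⊤,
    fun U f g => isClassOf_smul f g, fun U c a b => genConst_smul_smul c a b,
    fun U V h => ⟨rfl, resG_smul h⟩, fun U => pderivG_smul, fun U => pderivG_comm,
    fun U => pderivG_genConst_smul, fun U V => resG_pderivG, fun U => isClassOf_smul,
    fun U c a x => ⟨genConst_smul_smul c a x, smul_genConst_smul c a x⟩,
    fun U V => resG_smul, fun U i f => isClassOf_cls (pderivE q U i f), fun U => pderivG_smul,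
    fun U => pderivG_comm, fun U => pderivG_genConst_smul, fun U V => resG_pderivG,
    fun U => injective_smoothToG, fun U V h f => rfl, fun U i f => rfl,
    fun U => isClassOf_smoothToG_smul, embed hq φ, fun U => injective_embed hq hφ.1,
    fun U V h T => embed_resD hq φ h T,
    fun U T χ _ hχ => isClassOf_embed_of_isCompact hq φ T χ hχ,
    fun U T => suppG_embed hq hφ.1 T, fun U f => isClassOf_embed_smoothToD hq hφ f,
    fun U f g => embed_smoothToD_mul hq hφ f g⟩
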